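/- Let $K=\{0,a,b,c\}$ be the Kleinian four group, with the symmetric bilinear dot product $K\times K\to\mathbf F_2$ for which $x\cdot y=1$ if $x,y$ are distinct and nonzero, and $x\cdot y=0$ otherwise. A code of length $n$ is a subgroup $C\subseteq K^n$; its dual is $C^\perp=\{x\in K^n:\sum_i x_i\cdot y_i=0\text{ for all }y\in C\}$, and $C$ is self-dual if $C^\perp=C$. The weight of a word is the number of its nonzero entries; $C$ is even if all its codewords have even weight; $A_i$ denotes the number of codewords of weight $i$, so that the weight enumerator is $\sum_i A_iu^{n-i}v^i$. Let $G=S_3^n{:}S_n$ be the group of the permutations of the positions together with permutations of $a,b,c$ at each position. Two codes are equivalent if some $g\in G$ carries one to the other, and $\mathrm{Aut}(C)=\{g\in G: gC=C\}$. Let $\delta_l$ be the code of length $l$ of all words with entries in $\{0,a\}$ and an even number of entries $a$, let $\varepsilon_2=\{00,aa,bb,cc\}$, and let the Hexacode $\mathcal C_6$ be the code of length $6$ spanned by $a0a0bb$, $a0bba0$, $bba0a0$, $00aaaa$, $aa00aa$, $b0b0ca$. For a code $C$ let $\bar C$ be the subcode generated by the codewords of weight $1$ and $2$; its components are its nonzero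 indecomposable direct summands. Let $G_0\subseteq\mathrm{Aut}(C)$ be the group of the automorphisms which fix every component of $\bar C$ and every coset of $\bar C$ in $C$, let $G_1$ be the group of the automorphisms of $C$ fixing every component of $\bar C$, modulo $G_0$, and let $G_2$ be the permutation group which $\mathrm{Aut}(C)$ induces on the components of $\bar C$. For $k\ge1$ let $\delta_k^0,\delta_k^1,\delta_k^2,\delta_k^3$ be the cosets of $\delta_k$ in $K^k$ that contain $(0,\dots,0)$, $(a,0,\dots,0)$, $(b,\dots,b)$ and $(c,b,\dots,b)$. Let $D$ be a self-dual code of length $m$ with $m+k$ even. If $D$ is even, put $P=D\oplus(\delta_k^0\cup\delta_k^2)$. Otherwise let $D_0$ and $D_1$ be the sets of codewords of $D$ of even and of odd weight, let $D_2,D_3$ be the two cosets of $D_0$ in $D_0^\perp\setminus D$, and put $P=\bigcup_{j=0}^3D_j\oplus\delta_k^j$. The code $P$ has length $m+k$ and is determined by $D$ and $k$ up to equivalence; $D$ is called a child of every code equivalent to $P$. Let $n_k$ be the number of equivalence classes of children of length $n-k$ of a code of length $n$. **Theorem.** The numbers of equivalence classes of even self-dual codes of lengths $2,4,6,8$ are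 $1,2,6,21$, and there are no even self-dual codes of length $1,3,5,7$. For $n\in\{2,4,6,8\}$, representatives of the equivalence classes correspond one to one to the rows of the following table for that $n$, in such a way that each representative has the invariants listed in its row. The column $\bar C$ gives $\bar C$ up to equivalence and up to added positions at which all words of $\bar C$ are zero; $A_i=0$ for odd $i$ and in the columns left blank. $$\begin{array}{rrlrrrrrrrr} n & \text{No.} & \bar C & |G_1||G_2| & A_0 & A_2 & A_4 & A_6 & A_8 & n_1 & n_2\\ \hline 2 & 1 & \varepsilon_2 & 1 & 1 & 3 & & & & 1 & 1 \\ 4 & 1 & \delta_4 & 1 & 1 & 6 & 9 & & & 2 & 1 \\ 4 & 2 & \varepsilon_2^{2} & 2 & 1 & 6 & 9 & & & 1 & 1 \\ 6 & 1 & \delta_6 & 1 & 1 & 15 & 15 & 33 & & 2 & 1 \\ 6 & 2 & \delta_4\oplus \varepsilon_2 & 1 & 1 & 9 & 27 & 27 & & 3 & 2 \\ 6 & 3 & \delta_3^{2} & 2 & 1 & 6 & 33 & 24 & & 2 & 1 \\ 6 & 4 & \varepsilon_2^{3} & 6 & 1 & 9 & 27 & 27 & & 1 & 1 \\ 6 &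 5 & \delta_2^{3} & 6 & 1 & 3 & 39 & 21 & & 2 & 1 \\ 6 & 6 & 0 & 2160 & 1 & 0 & 45 & 18 & & 1 & 0 \\ 8 & 1 & \delta_8 & 1 & 1 & 28 & 70 & 28 & 129 & 2 & 1 \\ 8 & 2 & \delta_6\oplus \varepsilon_2 & 1 & 1 & 18 & 60 & 78 & 99 & 3 & 2 \\ 8 & 3 & \delta_5\oplus \delta_3 & 1 & 1 & 13 & 55 & 103 & 84 & 4 & 2 \\ 8 & 4 & \delta_4^{2} & 2 & 1 & 12 & 54 & 108 & 81 & 2 & 1 \\ 8 & 5 & \delta_4\oplus \varepsilon_2^{2} & 2 & 1 & 12 & 54 & 108 & 81 & 3 & 2 \\ 8 & 6 & \delta_4\oplus \delta_2^{2} & 2 & 1 & 8 & 50 & 128 & 69 & 4 & 2 \\ 8 & 7 & \delta_3^{2}\oplus \varepsilon_2 & 2 & 1 & 9 & 51 & 123 & 72 & 3 & 2 \\ 8 & 8 & \delta_3^{2}\oplus \delta_2 & 2 & 1 & 7 & 49 & 133 & 66 & 4 & 2 \\ 8 & 9 & \delta_3\oplus \delta_2^{2} & 2 & 1 & 5 &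 47 & 143 & 60 & 7 & 2 \\ 8 & 10 & \delta_3 & 120 & 1 & 3 & 45 & 153 & 54 & 3 & 1 \\ 8 & 11 & \varepsilon_2^{4} & 24 & 1 & 12 & 54 & 108 & 81 & 1 & 1 \\ 8 & 12 & \varepsilon_2\oplus \delta_2^{3} & 6 & 1 & 6 & 48 & 138 & 63 & 3 & 2 \\ 8 & 13 & \varepsilon_2 & 2160 & 1 & 3 & 45 & 153 & 54 & 2 & 1 \\ 8 & 14 & \delta_2^{4} & 24 & 1 & 4 & 46 & 148 & 57 & 2 & 1 \\ 8 & 15 & \delta_2^{4} & 8 & 1 & 4 & 46 & 148 & 57 & 2 & 1 \\ 8 & 16 & \delta_2^{3} & 6 & 1 & 3 & 45 & 153 & 54 & 3 & 1 \\ 8 & 17 & \delta_2^{2} & 16 & 1 & 2 & 44 & 158 & 51 & 4 & 1 \\ 8 & 18 & \delta_2 & 48 & 1 & 1 & 43 & 163 & 48 & 4 & 1 \\ 8 & 19 & 0 & 8064 & 1 & 0 & 42 & 168 & 45 & 1 & 0 \\ 8 & 20 & 0 & 1152 & 1 & 0 & 42 & 168 & 45 & 1 & 0 \\ 8 & 21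 & 0 & 336 & 1 & 0 & 42 & 168 & 45 & 1 & 0 \end{array}$$ The code No. 6 of length $6$ is the Hexacode $\mathcal C_6$. -/

import Mathlib

open scoped Pointwise

namespace Kleinian

/-- The Kleinian four group. -/
abbrev K : Type := ZMod 2 × ZMod 2

/-- The nonzero element `a` of `K`. -/
def a : K := (1, 0)

/-- The nonzero element `b` of `K`. -/
def b : K := (0, 1)

/-- The nonzero element `c` of `K`. -/
def c : K := (1, 1)

/-- The dot product on `K`: it is `1` on two distinct nonzero elements and `0` otherwise. -/
def dot (x y : K) : ZMod 2 := if x ≠ 0 ∧ y ≠ 0 ∧ x ≠ y then 1 else 0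

theorem dot_zero_left : ∀ y : K, dot 0 y = 0 := by decide

theorem dot_add_left : ∀ x x' y : K, dot (x + x') y = dot x y + dot x' y := by decide

/-- A (linear) code over `K` whose positions are indexed by `ι`: a subgroup of `K^ι`. A code of
length `n` is a `Code (Fin n)`; other index types are used for direct sums. -/
abbrev Code (ι : Type) : Type := AddSubgroup (ι → K)

section general

variable {ι κ μ : Type}

/-- The weight of a word: the number of its nonzero entries. -/
abbrev wt [Fintype ι] (x : ι → K) : ℕ := hammingNorm x

/-- The scalar product on `K^ι`. -/
def scalar [Fintype ι] (x y : ι → K) : ZMod 2 := ∑ i, dot (x i) (y i)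

/-- The dual code. -/
def dual [Fintype ι] (C : Code ι) : Code ι where
  carrier := {x | ∀ y ∈ C, scalar x y = 0}
  zero_mem' := by
    intro y _
    simp [scalar, dot_zero_left]
  add_mem' := by
    intro x x' hx hx' y hy
    have h1 := hx y hy
    have h2 := hx' y hy
    simp only [scalar] at h1 h2 ⊢
    simp [dot_add_left, Finset.sum_add_distrib, h1, h2]
  neg_mem' := by
    intro x hx y hy
    have h0 : ∀ k : K, -k = k := by decide
    have h : -x = x := funext fun i => h0 (x i)
    rw [h]
    exact hx y hy

/-- A code is self-dual if it equals its dual. -/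
def IsSelfDual [Fintype ι] (C : Code ι) : Prop := dual C = C

/-- A code is even if all its codewords have even weight. -/
def IsEven [Fintype ι] (C : Code ι) : Prop := ∀ x ∈ C, Even (wt x)

/-- The coefficient `A_i` of the weight enumerator: the number of codewords of weight `i`. -/
noncomputable def weightCount [Fintype ι] (C : Code ι) (i : ℕ) : ℕ := Nat.card {x : ι → K // x ∈ C ∧ wt x = i}

/-! ### Equivalence of codes, automorphisms -/

/-- Renumbering of the positions along `e`, followed by a permutation `σ j` of the symbols
`a`, `b`, `c` (that is, an automorphism of `K`) at each position `j`. -/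
def monomial (e : κ ≃ ι) (σ : κ → (K ≃+ K)) : (ι → K) ≃+ (κ → K) where
  toFun x := fun j => σ j (x (e j))
  invFun y := fun i => (σ (e.symm i)).symm (y (e.symm i))
  left_inv x := by
    funext i
    simp
  right_inv y := by
    funext j
    obtain ⟨i, rfl⟩ := e.symm.surjective j
    simp
  map_add' x y := by
    funext j
    simp

theorem monomial_refl :
    monomial (Equiv.refl ι) (fun _ => AddEquiv.refl K) = AddEquiv.refl (ι → K) := by
  ext x i <;> rfl

theorem monomial_trans (e : κ ≃ ι) (σ : κ → (K ≃+ K)) (f : μ ≃ κ) (τ : μ → (K ≃+ K)) :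
    (monomial e σ).trans (monomial f τ) =
      monomial (f.trans e) (fun j => (σ (f j)).trans (τ j)) := by
  ext x i <;> rfl

theorem monomial_symm (e : κ ≃ ι) (σ : κ → (K ≃+ K)) :
    (monomial e σ).symm = monomial e.symm (fun i => (σ (e.symm i)).symm) := by
  ext x i <;> rfl

/-- Equivalence of codes. -/
def Equivalent (C : Code ι) (D : Code κ) : Prop :=
  ∃ (e : κ ≃ ι) (σ : κ → (K ≃+ K)), C.map (monomial e σ).toAddMonoidHom = D

theorem Equivalent.refl (C : Code ι) : Equivalent C C := by
  refine ⟨Equiv.refl ι, fun _ => AddEquiv.refl K, ?_⟩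
  rw [monomial_refl]
  exact AddSubgroup.map_id C

theorem Equivalent.symm {C : Code ι} {D : Code κ} (h : Equivalent C D) : Equivalent D C := by
  obtain ⟨e, σ, rfl⟩ := h
  refine ⟨e.symm, fun i => (σ (e.symm i)).symm, ?_⟩
  rw [← monomial_symm, AddSubgroup.map_map]
  convert AddSubgroup.map_id C
  ext x : 1
  exact (monomial e σ).symm_apply_apply x

theorem Equivalent.trans {C : Code ι} {D : Code κ} {E : Code μ} (h : Equivalent C D)
    (h' : Equivalent D E) : Equivalent C E := by
  obtain ⟨e, σ, rfl⟩ := h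
  obtain ⟨f, τ, rfl⟩ := h'
  refine ⟨f.trans e, fun j => (σ (f j)).trans (τ j), ?_⟩
  rw [← monomial_trans, AddSubgroup.map_map]
  rfl

/-- Equivalence classes of codes with positions indexed by `ι`. -/
def codeSetoid (ι : Type) : Setoid (Code ι) where
  r C D := Equivalent C D
  iseqv := ⟨Equivalent.refl, Equivalent.symm, Equivalent.trans⟩

/-- The semidirect product `S_3^n : S_n` of the permutations of the positions together with
permutations of the symbols at each position, as a group of
bijections of `K^n`. -/
def isometries (ι : Type) : Subgroup (Equiv.Perm (ι → K)) where
  carrier := {g | ∃ (e : ι ≃ ι) (σ : ι → (K ≃+ K)), g = (monomial e σ).toEquiv}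
  one_mem' := ⟨Equiv.refl ι, fun _ => AddEquiv.refl K, rfl⟩
  mul_mem' := by
    rintro _ _ ⟨e, σ, rfl⟩ ⟨f, τ, rfl⟩
    exact ⟨_, _, congrArg AddEquiv.toEquiv (monomial_trans f τ e σ)⟩
  inv_mem' := by
    rintro _ ⟨e, σ, rfl⟩
    exact ⟨_, _, congrArg AddEquiv.toEquiv (monomial_symm e σ)⟩

/-- The automorphism group of a code: all `g` in `S_3^n : S_n` with `g C = C`. -/
def autGroup (C : Code ι) : Subgroup (Equiv.Perm (ι → K)) :=
  isometries ι ⊓ MulAction.stabilizer (Equiv.Perm (ι → K)) (C : Set (ι → K))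

/-! ### The subcode of weight at most two, and the groups `G_0`, `G_1`, `G_2` -/

/-- The subcode generated by the codewords of weight `1` and `2`. -/
def smallSubcode [Fintype ι] (C : Code ι) : Code ι :=
  AddSubgroup.closure {x | x ∈ C ∧ (wt x = 1 ∨ wt x = 2)}

/-- `D` is a direct summand of `B`: there is a set `S` of positions such that `B` is the direct sum
of its subcodes supported in `S` and in the complement of `S`, and `D` is the first of these. -/
def IsSummand (B D : Code ι) : Prop :=
  ∃ S : Set ι, (∀ x ∈ B, S.indicator x ∈ B) ∧ ∀ x, x ∈ D ↔ x ∈ B ∧ ∀ i ∉ S, x i = 0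

/-- The (nonzero, indecomposable) components of a code, as subcodes: its minimal nonzero direct
summands. -/
def components (B : Code ι) : Set (Code ι) :=
  {D | Minimal (fun D' => D' ≠ ⊥ ∧ IsSummand B D') D}

/-- The automorphisms of `C` which fix each component of `smallSubcode C`. -/
def fixComponents [Fintype ι] (C : Code ι) : Subgroup (Equiv.Perm (ι → K)) :=
  autGroup C ⊓ ⨅ D ∈ components (smallSubcode C), MulAction.stabilizer (Equiv.Perm (ι → K)) (D : Set (ι → K))

/-- The group `G_0`: the automorphisms of `C` which fix each component of `smallSubcode C` and each
coset of `smallSubcode C` in `C`. -/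
def G0 [Fintype ι] (C : Code ι) : Subgroup (Equiv.Perm (ι → K)) where
  carrier := {g | g ∈ fixComponents C ∧ ∀ x ∈ C, g x - x ∈ smallSubcode C}
  one_mem' := by
    refine ⟨one_mem _, fun x _ => ?_⟩
    simp
  mul_mem' := by
    rintro g h ⟨hg, hg'⟩ ⟨hh, hh'⟩
    refine ⟨mul_mem hg hh, fun x hx => ?_⟩
    have hC : h • (C : Set (ι → K)) = C := hh.1.2
    have hx' : h x ∈ (C : Set (ι → K)) := by
      rw [← hC]
      exact Set.smul_mem_smul_set hx
    have := add_mem (hg' (h x) hx') (hh' x hx)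
    simpa using this
  inv_mem' := by
    rintro g ⟨hg, hg'⟩
    refine ⟨inv_mem hg, fun x hx => ?_⟩
    have hC : g⁻¹ • (C : Set (ι → K)) = C := (inv_mem hg).1.2
    have hx' : g⁻¹ x ∈ (C : Set (ι → K)) := by
      rw [← hC]
      exact Set.smul_mem_smul_set hx
    have h1 := neg_mem (hg' _ hx')
    have h2 : g (g⁻¹ x) = x := Equiv.apply_symm_apply g x
    rw [h2] at h1
    simpa using h1

/-- The order of `G_1`, the group of automorphisms of `C` fixing the components of
`smallSubcode C`, modulo `G_0`. -/
noncomputable def orderG1 [Fintype ι] (C : Code ι) : ℕ := (G0 C).relIndex (fixComponents C)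

/-- The order of `G_2`, the group of permutations of the components of `smallSubcode C` induced by
the automorphisms of `C`. -/
noncomputable def orderG2 [Fintype ι] (C : Code ι) : ℕ :=
  Set.ncard {f : components (smallSubcode C) → Set (ι → K) |
    ∃ g ∈ autGroup C, ∀ D, f D = g • ((D : Code ι) : Set (ι → K))}

end general

/-! ### Direct sums and the codes `δ_l`, `ε_2` and `C_6` -/

/-- The direct sum of two codes. -/
def sum {ι κ : Type} (C : Code ι) (D : Code κ) : Code (ι ⊕ κ) where
  carrier := {z | (fun i => z (Sum.inl i)) ∈ C ∧ (fun j => z (Sum.inr j)) ∈ D}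
  zero_mem' := ⟨C.zero_mem, D.zero_mem⟩
  add_mem' h h' := ⟨C.add_mem h.1 h'.1, D.add_mem h.2 h'.2⟩
  neg_mem' h := ⟨C.neg_mem h.1, D.neg_mem h.2⟩

/-- The direct sum of a family of codes. -/
def directSum {J : Type} {ι : J → Type} (C : ∀ j, Code (ι j)) : Code (Σ j, ι j) where
  carrier := {z | ∀ j, (fun i => z ⟨j, i⟩) ∈ C j}
  zero_mem' := fun j => (C j).zero_mem
  add_mem' h h' := fun j => (C j).add_mem (h j) (h' j)
  neg_mem' h := fun j => (C j).neg_mem (h j)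

theorem zero_or_a_add : ∀ u v : K, (u = 0 ∨ u = a) → (v = 0 ∨ v = a) → u + v = 0 ∨ u + v = a := by
  decide

theorem even_hammingNorm_add {l : ℕ} {x y : Fin l → K} (hx : ∀ i, x i = 0 ∨ x i = a)
    (hy : ∀ i, y i = 0 ∨ y i = a) (hx' : Even (hammingNorm x)) (hy' : Even (hammingNorm y)) :
    Even (hammingNorm (x + y)) := by
  have key : ∀ z : Fin l → K, (∀ i, z i = 0 ∨ z i = a) →
      (hammingNorm z : ZMod 2) = ∑ i, (z i).1 := by
    intro z hz
    rw [hammingNorm, Finset.card_filter]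
    push_cast
    refine Finset.sum_congr rfl fun i _ => ?_
    rcases hz i with h | h <;> rw [h] <;> decide
  have hxy : ∀ i, (x + y) i = 0 ∨ (x + y) i = a :=
    fun i => zero_or_a_add _ _ (hx i) (hy i)
  rw [← ZMod.natCast_eq_zero_iff_even] at hx' hy' ⊢
  rw [key _ hx] at hx'
  rw [key _ hy] at hy'
  rw [key _ hxy]
  simp [Finset.sum_add_distrib, hx', hy']

/-- The code `δ_l`: the words with entries `0` and an even number of entries `a`. -/
def delta (l : ℕ) : Code (Fin l) where
  carrier := {x | (∀ i, x i = 0 ∨ x i = a) ∧ Even (wt x)}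
  zero_mem' := by simp
  add_mem' := by
    rintro x y ⟨hx, hx'⟩ ⟨hy, hy'⟩
    exact ⟨fun i => zero_or_a_add _ _ (hx i) (hy i), even_hammingNorm_add hx hy hx' hy'⟩
  neg_mem' := by
    intro x hx
    have h0 : ∀ k : K, -k = k := by decide
    have h : -x = x := funext fun i => h0 (x i)
    rw [h]
    exact hx

/-- The code `ε_2 = {00, aa, bb, cc}`. -/
def epsilon2 : Code (Fin 2) where
  carrier := {x | x 0 = x 1}
  zero_mem' := rfl
  add_mem' := by
    intro x y hx hy
    exact congrArg₂ (· + ·) hx hy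
  neg_mem' := by
    intro x hx
    exact congrArg (- ·) hx

/-- The Hexacode `C_6`. -/
def hexacode : Code (Fin 6) :=
  AddSubgroup.closure {![a, 0, a, 0, b, b], ![a, 0, b, b, a, 0], ![b, b, a, 0, a, 0],
    ![0, 0, a, a, a, a], ![a, a, 0, 0, a, a], ![b, 0, b, 0, c, a]}

/-- Names of the indecomposable codes generated by words of weight `2`. -/
inductive Component
  | δ (l : ℕ)
  | ε

/-- The length of a component. -/
def Component.length : Component → ℕ
  | .δ l => l
  | .ε => 2

/-- The code that a component stands for. -/
def Component.code : (s : Component) → Code (Fin s.length)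
  | .δ l => delta l
  | .ε => epsilon2

/-- `B` is, up to equivalence, the direct sum of the codes in the list `L`, filled up with
zero positions. -/
def HasType {n : ℕ} (B : Code (Fin n)) (L : List Component) : Prop :=
  ∃ r : ℕ, Equivalent B (sum (directSum fun j : Fin L.length => (L.get j).code) (⊥ : Code (Fin r)))

/-! ### Children -/

/-- The class of a word `y` modulo `δ_k`, where `k ≥ 1`. -/
def deltaCoset {k : ℕ} (y : Fin k → K) : Set (Fin k → K) := {z | z - y ∈ delta k}

/-- The word `(a, 0, …, 0)`. -/
def wordA (k : ℕ) : Fin k → K := fun i => if (i : ℕ) = 0 then a else 0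

/-- The word `(b, b, …, b)`. -/
def wordB (k : ℕ) : Fin k → K := fun _ => b

/-- `P` is the even code of length `m + k` assigned to the self-dual code `D` of length `m`.
If `D` is even, it is the direct sum of `D` and `δ_k ∪ ((b, …, b) + δ_k)`. Otherwise
let `D_0`, `D_1` be the sets of words of even and of odd weight in `D`, and let
`D_2 = w + D_0` and `D_3 = w + D_1` be the other two cosets of `D_0` in its dual; then
`P` is the union of the four sets `D_j ⊕ δ_k^j`, where `δ_k^j` are the cosets of
`0`, `(a, 0, …, 0)`, `(b, …, b)` and `(c, b, …, b)` modulo `δ_k`. -/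
def IsParentOf {m : ℕ} (D : Code (Fin m)) (k : ℕ) (P : Code (Fin m ⊕ Fin k)) : Prop :=
  (IsEven D ∧ ∀ z, z ∈ P ↔ (fun i => z (Sum.inl i)) ∈ D ∧
    (fun j => z (Sum.inr j)) ∈ deltaCoset (k := k) 0 ∪ deltaCoset (wordB k)) ∨
  (¬ IsEven D ∧ ∃ w : Fin m → K, w ∉ D ∧ (∀ x ∈ D, Even (wt x) → scalar w x = 0) ∧
    ∀ z, z ∈ P ↔
      (((fun i => z (Sum.inl i)) ∈ {x | x ∈ D ∧ Even (wt x)} ∧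
          (fun j => z (Sum.inr j)) ∈ deltaCoset (k := k) 0) ∨
        ((fun i => z (Sum.inl i)) ∈ {x | x ∈ D ∧ Odd (wt x)} ∧
          (fun j => z (Sum.inr j)) ∈ deltaCoset (wordA k)) ∨
        ((fun i => z (Sum.inl i)) ∈ {x | x - w ∈ D ∧ Even (wt (x - w))} ∧
          (fun j => z (Sum.inr j)) ∈ deltaCoset (wordB k)) ∨
        ((fun i => z (Sum.inl i)) ∈ {x | x - w ∈ D ∧ Odd (wt (x - w))} ∧
          (fun j => z (Sum.inr j)) ∈ deltaCoset (wordA k + wordB k))))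

/-- The self-dual code `D` of length `m` is a child of the code `C` of length `m + k`. -/
def IsChild {m n : ℕ} (k : ℕ) (D : Code (Fin m)) (C : Code (Fin n)) : Prop :=
  IsSelfDual D ∧ ∃ P : Code (Fin m ⊕ Fin k), IsParentOf D k P ∧ Equivalent P C

/-- The number `n_k` of inequivalent children of length `n - k` of a code of length `n`. -/
noncomputable def numChildren {n : ℕ} (C : Code (Fin n)) (k : ℕ) : ℕ :=
  Set.ncard {q : Quotient (codeSetoid (Fin (n - k))) |
    ∃ D : Code (Fin (n - k)), IsChild k D C ∧ q = Quotient.mk _ D}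

/-! ### The table -/

/-- A row of the table: the type of `smallSubcode C`, the order of `G_1.G_2`, the coefficients
`A_0, A_2, A_4, …` of the weight enumerator (`A_i` is zero for odd `i` and beyond the list), and the
numbers `n_1`, `n_2` of children. -/
structure Row where
  comps : List Component
  order : ℕ
  A : List ℕ
  n1 : ℕ
  n2 : ℕ

/-- The code `C` has the invariants listed in the row `r`. -/
def HasRow {n : ℕ} (C : Code (Fin n)) (r : Row) : Prop :=
  HasType (smallSubcode C) r.comps ∧
  orderG1 C * orderG2 C = r.order ∧
  (∀ j, weightCount C (2 * j) = r.A.getD j 0 ∧ weightCount C (2 * j + 1) = 0) ∧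
  numChildren C 1 = r.n1 ∧ numChildren C 2 = r.n2

/-- The row of the Hexacode. -/
def hexacodeRow : Row := ⟨[], 2160, [1, 0, 45, 18], 1, 0⟩

open Component in
/-- The rows of the table for codes of length `n`. -/
def table : ℕ → List Row
  | 2 => [⟨[ε], 1, [1, 3], 1, 1⟩]
  | 4 => [⟨[δ 4], 1, [1, 6, 9], 2, 1⟩,
      ⟨[ε, ε], 2, [1, 6, 9], 1, 1⟩]
  | 6 => [⟨[δ 6], 1, [1, 15, 15, 33], 2, 1⟩,
      ⟨[δ 4, ε], 1, [1, 9, 27, 27], 3, 2⟩,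
      ⟨[δ 3, δ 3], 2, [1, 6, 33, 24], 2, 1⟩,
      ⟨[ε, ε, ε], 6, [1, 9, 27, 27], 1, 1⟩,
      ⟨[δ 2, δ 2, δ 2], 6, [1, 3, 39, 21], 2, 1⟩,
      hexacodeRow]
  | 8 => [⟨[δ 8], 1, [1, 28, 70, 28, 129], 2, 1⟩,
      ⟨[δ 6, ε], 1, [1, 18, 60, 78, 99], 3, 2⟩,
      ⟨[δ 5, δ 3], 1, [1, 13, 55, 103, 84], 4, 2⟩,
      ⟨[δ 4, δ 4], 2, [1, 12, 54, 108, 81], 2, 1⟩,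
      ⟨[δ 4, ε, ε], 2, [1, 12, 54, 108, 81], 3, 2⟩,
      ⟨[δ 4, δ 2, δ 2], 2, [1, 8, 50, 128, 69], 4, 2⟩,
      ⟨[δ 3, δ 3, ε], 2, [1, 9, 51, 123, 72], 3, 2⟩,
      ⟨[δ 3, δ 3, δ 2], 2, [1, 7, 49, 133, 66], 4, 2⟩,
      ⟨[δ 3, δ 2, δ 2], 2, [1, 5, 47, 143, 60], 7, 2⟩,
      ⟨[δ 3], 120, [1, 3, 45, 153, 54], 3, 1⟩,
      ⟨[ε, ε, ε, ε], 24, [1, 12, 54, 108, 81], 1, 1⟩,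
      ⟨[ε, δ 2, δ 2, δ 2], 6, [1, 6, 48, 138, 63], 3, 2⟩,
      ⟨[ε], 2160, [1, 3, 45, 153, 54], 2, 1⟩,
      ⟨[δ 2, δ 2, δ 2, δ 2], 24, [1, 4, 46, 148, 57], 2, 1⟩,
      ⟨[δ 2, δ 2, δ 2, δ 2], 8, [1, 4, 46, 148, 57], 2, 1⟩,
      ⟨[δ 2, δ 2, δ 2], 6, [1, 3, 45, 153, 54], 3, 1⟩,
      ⟨[δ 2, δ 2], 16, [1, 2, 44, 158, 51], 4, 1⟩,
      ⟨[δ 2], 48, [1, 1, 43, 163, 48], 4, 1⟩,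
      ⟨[], 6 * 1344, [1, 0, 42, 168, 45], 1, 0⟩,
      ⟨[], 1152, [1, 0, 42, 168, 45], 1, 0⟩,
      ⟨[], 336, [1, 0, 42, 168, 45], 1, 0⟩]
  | _ => []

/-- The number of equivalence classes of even self-dual codes of length `n`. -/
noncomputable def numEvenSelfDual (n : ℕ) : ℕ :=
  Set.ncard {q : Quotient (codeSetoid (Fin n)) |
    ∃ C : Code (Fin n), (IsEven C ∧ IsSelfDual C) ∧ q = Quotient.mk _ C}

end Kleinian

/-! The classification rests on a mass formula. Modulo 2 one has x·y = wt x + wt y + wt(x+y)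
(`scalar_eq_wt`), so an even code C is self-orthogonal, and Poisson summation over C gives ∑
(-1)^{wt v} = (-2)^n, where v runs over the dual of C (`sum_chi_wt_dual`). If C is even and
self-dual, the left side is |C| > 0, hence n is even. For even n the identity also counts the even
words of the dual, that is, the ways to enlarge a basis of an even code by one word. The product of
these numbers (`card_admissible`), divided by the number of ordered bases of a single code, bounds
the number of even self-dual codes of length n; the bound is ∏_{j<n} (2^j + 1).

On the other side stands an explicit list of codes. By orbit-stabilizer the class of C has
|G|/|Aut(C)| members. The listed codes of one length are told apart by the pair (|Aut(C)|, A_2), and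
their classes together already reach the bound, so there are no other classes
(`exists_equivalent_of_mass`).

Group orders come from a stabilizer chain over the positions (`chain_eq`): for each generator one
keeps the set of codewords that are still possible as its image, encoded as a bit mask, and cuts it
down whenever the image of another position, with its permutation of symbols, is chosen. The same
backtracking decides whether one code can be carried into another (`embeds_iff`). The product
|G_1||G_2| is the index of G_0 in Aut(C) (`orderG1_mul_orderG2`), and G_0 is again described by
candidate sets for the images of finitely many words (`card_cosetFix`), once the components are
known to be the obvious blocks (`components_eq`).

Children of length n-k, for k = 1, 2, correspond to words w of weight k, which must lie in C if k =
2: take the codewords whose entries on the support of w are 0 or those of w, and delete the support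
(`IsChild.exists_word`, `isChild_childAt`). These finitely many children are sorted into classes by
the search.

What remains for each row is a finite evaluation (`Entry.check`); for its sake words and sets of
words are natural numbers and the algorithms use only arithmetic and bit operations and structural
recursion. -/

namespace Kleinian

/-! ### Words as natural numbers

A word is encoded by the natural number whose digits to the base `4` are `0`, `1`, `2`, `3` for the
symbols `0`, `a`, `b`, `c`. The sum of words becomes the bitwise exclusive or. -/

/-- The digit of the word `w` in position `i`. -/
def dig (w i : ℕ) : ℕ := Nat.land (Nat.shiftRight w (Nat.mul 2 i)) 3

/-- The symbol with a given digit. -/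
def sym : ℕ → K
  | 0 => 0
  | 1 => a
  | 2 => b
  | _ => c

/-- The digit of a symbol. -/
def num (k : K) : ℕ := k.1.val + 2 * k.2.val

theorem num_lt : ∀ k : K, num k < 4 := by decide

theorem sym_num : ∀ k : K, sym (num k) = k := by decide

theorem num_sym {d : ℕ} (h : d < 4) : num (sym d) = d := by
  interval_cases d <;> decide

theorem dig_eq (w i : ℕ) : dig w i = w / 4 ^ i % 4 := by
  have h : dig w i = (w >>> (2 * i)) &&& 3 := rfl
  rw [h, show (3 : ℕ) = 2 ^ 2 - 1 by norm_num, Nat.and_two_pow_sub_one_eq_mod,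
    Nat.shiftRight_eq_div_pow, pow_mul]
  norm_num

theorem dig_lt (w i : ℕ) : dig w i < 4 := by
  rw [dig_eq]
  exact Nat.mod_lt _ (by norm_num)

theorem dig_xor (w w' i : ℕ) : dig (Nat.xor w w') i = Nat.xor (dig w i) (dig w' i) := by
  change ((w ^^^ w') >>> (2 * i)) &&& 3 = ((w >>> (2 * i)) &&& 3) ^^^ ((w' >>> (2 * i)) &&& 3)
  rw [Nat.shiftRight_xor_distrib, Nat.and_xor_distrib_right]

theorem sym_xor {d d' : ℕ} (h : d < 4) (h' : d' < 4) : sym (Nat.xor d d') = sym d + sym d' := by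
  interval_cases d <;> interval_cases d' <;> decide

theorem sym_eq_zero {d : ℕ} (h : d < 4) : sym d = 0 ↔ d = 0 := by
  interval_cases d <;> decide

/-- The word of length `n` encoded by a natural number. -/
def dec (n w : ℕ) : Fin n → K := fun i => sym (dig w i)

theorem num_dec (n w : ℕ) (i : Fin n) : num (dec n w i) = dig w i := num_sym (dig_lt _ _)

theorem dec_xor (n w w' : ℕ) : dec n (Nat.xor w w') = dec n w + dec n w' := by
  funext i
  simp only [dec, Pi.add_apply, dig_xor]
  exact sym_xor (dig_lt _ _) (dig_lt _ _)

theorem dec_zero (n : ℕ) : dec n 0 = 0 := by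
  funext i
  simp [dec, dig_eq, sym]

theorem add_self_word {ι : Type} (x : ι → K) : x + x = 0 := by
  have h : ∀ k : K, k + k = 0 := by decide
  exact funext fun i => h (x i)

theorem neg_word {ι : Type} (x : ι → K) : -x = x := neg_eq_of_add_eq_zero_left (add_self_word x)

theorem sub_word {ι : Type} (x y : ι → K) : x - y = x + y := by
  rw [sub_eq_add_neg, neg_word]

theorem dec_injOn {n w w' : ℕ} (h : w < 4 ^ n) (h' : w' < 4 ^ n) (e : dec n w = dec n w') :
    w = w' := by
  induction n generalizing w w' with
  | zero => simp_all
  | succ n ih =>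
    have hd : ∀ i : ℕ, i < n + 1 → w / 4 ^ i % 4 = w' / 4 ^ i % 4 := by
      intro i hi
      have := congrArg num (congrFun e ⟨i, hi⟩)
      rwa [num_dec, num_dec, dig_eq, dig_eq] at this
    have h0 := hd 0 (Nat.succ_pos n)
    have h1 : w / 4 = w' / 4 := by
      refine ih ?_ ?_ ?_
      · rw [pow_succ] at h; omega
      · rw [pow_succ] at h'; omega
      · funext i
        have := hd (i + 1) (by omega)
        simp only [dec, dig_eq, Nat.div_div_eq_div_mul]
        rw [pow_succ, mul_comm] at this
        rw [this]
    simp only [pow_zero, Nat.div_one] at h0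
    omega

/-- All sums of the given words, where the position of a sum in the list is the binary number of
the set of its summands. -/
def words : List ℕ → List ℕ
  | [] => [0]
  | g :: gs => words gs ++ (words gs).map (Nat.xor g)

theorem length_words (gs : List ℕ) : (words gs).length = 2 ^ gs.length := by
  induction gs with
  | nil => rfl
  | cons g gs ih => simp [words, ih, pow_succ, mul_two]

/-- The code generated by the given words. -/
def codeOf (n : ℕ) (gens : List ℕ) : Code (Fin n) :=
  AddSubgroup.closure {x | ∃ g ∈ gens, dec n g = x}

/-- Every word is its own negative, so a sum involves `g` once or not at all, and the larger
subgroup is the union of two cosets. -/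
theorem mem_closure_insert_word {ι : Type} {S : Set (ι → K)} {g x : ι → K} :
    x ∈ AddSubgroup.closure (insert g S) ↔
      x ∈ AddSubgroup.closure S ∨ g + x ∈ AddSubgroup.closure S := by
  constructor
  · intro h
    refine AddSubgroup.closure_induction (p := fun x _ => x ∈ AddSubgroup.closure S ∨
      g + x ∈ AddSubgroup.closure S) ?_ ?_ ?_ ?_ h
    · rintro x (rfl | hx)
      · right
        rw [add_self_word]
        exact zero_mem _
      · exact Or.inl (AddSubgroup.subset_closure hx)
    · exact Or.inl (zero_mem _)
    · rintro x y - - (hx | hx) (hy | hy)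
      · exact Or.inl (add_mem hx hy)
      · right
        have := add_mem hx hy
        rwa [show g + (x + y) = x + (g + y) by abel]
      · right
        have := add_mem hx hy
        rwa [show g + (x + y) = (g + x) + y by abel]
      · left
        have := add_mem hx hy
        rwa [show g + x + (g + y) = (g + g) + (x + y) by abel, add_self_word, zero_add] at this
    · intro x _ hx
      rwa [neg_word]
  · have hS : AddSubgroup.closure S ≤ AddSubgroup.closure (insert g S) :=
      AddSubgroup.closure_mono (Set.subset_insert _ _)
    rintro (h | h)
    · exact hS h
    · have h1 : g ∈ AddSubgroup.closure (insert g S) :=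
        AddSubgroup.subset_closure (Set.mem_insert _ _)
      have := add_mem h1 (hS h)
      rwa [← add_assoc, add_self_word, zero_add] at this

theorem mem_codeOf_cons {n g : ℕ} {gs : List ℕ} {x : Fin n → K} :
    x ∈ codeOf n (g :: gs) ↔ x ∈ codeOf n gs ∨ dec n g + x ∈ codeOf n gs := by
  rw [codeOf, codeOf, ← mem_closure_insert_word]
  congr! 3
  ext y
  simp [eq_comm]

theorem mem_codeOf {n : ℕ} {gs : List ℕ} {x : Fin n → K} :
    x ∈ codeOf n gs ↔ ∃ w ∈ words gs, dec n w = x := by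
  induction gs generalizing x with
  | nil =>
    simp only [codeOf, words, List.not_mem_nil, false_and, exists_false, Set.ofPred_false,
      AddSubgroup.closure_empty, AddSubgroup.mem_bot, List.mem_singleton, exists_eq_left, dec_zero]
    exact eq_comm
  | cons g gs ih =>
    simp only [mem_codeOf_cons, ih, words, List.mem_append, List.mem_map]
    constructor
    · rintro (⟨w, hw, rfl⟩ | ⟨w, hw, h⟩)
      · exact ⟨w, Or.inl hw, rfl⟩
      · refine ⟨_, Or.inr ⟨w, hw, rfl⟩, ?_⟩
        rw [dec_xor, h, ← add_assoc, add_self_word, zero_add]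
    · rintro ⟨w, hw | ⟨w, hw, rfl⟩, rfl⟩
      · exact Or.inl ⟨w, hw, rfl⟩
      · refine Or.inr ⟨w, hw, ?_⟩
        rw [dec_xor, ← add_assoc, add_self_word, zero_add]

theorem dec_mem_codeOf {n g : ℕ} {gs : List ℕ} (h : g ∈ gs) : dec n g ∈ codeOf n gs :=
  AddSubgroup.subset_closure ⟨g, h, rfl⟩

theorem codeOf_le {n : ℕ} {gs : List ℕ} {C : Code (Fin n)} :
    codeOf n gs ≤ C ↔ ∀ g ∈ gs, dec n g ∈ C := by
  rw [codeOf, AddSubgroup.closure_le]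
  constructor
  · exact fun h g hg => h ⟨g, hg, rfl⟩
  · rintro h _ ⟨g, hg, rfl⟩
    exact h g hg

theorem xor_mem_words {gs : List ℕ} {v w : ℕ} (hv : v ∈ words gs) (hw : w ∈ words gs) :
    Nat.xor v w ∈ words gs := by
  induction gs generalizing v w with
  | nil => simp_all [words]
  | cons g gs ih =>
    simp only [words, List.mem_append, List.mem_map] at hv hw ⊢
    obtain hv | ⟨v, hv, rfl⟩ := hv <;> obtain hw | ⟨w, hw, rfl⟩ := hw
    · exact Or.inl (ih hv hw)
    · refine Or.inr ⟨_, ih hv hw, ?_⟩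
      change g ^^^ (v ^^^ w) = v ^^^ (g ^^^ w)
      rw [Nat.xor_left_comm]
    · refine Or.inr ⟨_, ih hv hw, ?_⟩
      change g ^^^ (v ^^^ w) = (g ^^^ v) ^^^ w
      rw [Nat.xor_assoc]
    · refine Or.inl ?_
      have := ih hv hw
      change (g ^^^ v) ^^^ (g ^^^ w) ∈ _
      rwa [show (g ^^^ v) ^^^ (g ^^^ w) = v ^^^ w by
        rw [Nat.xor_comm g v, Nat.xor_assoc, ← Nat.xor_assoc g g w, Nat.xor_self, Nat.zero_xor]]

theorem words_lt {n : ℕ} {gs : List ℕ} (h : ∀ g ∈ gs, g < 4 ^ n) : ∀ w ∈ words gs, w < 4 ^ n := by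
  induction gs with
  | nil => simp [words]
  | cons g gs ih =>
    have ih' := ih fun g' hg' => h g' (List.mem_cons_of_mem _ hg')
    simp only [words, List.mem_append, List.mem_map]
    rintro w (hw | ⟨w, hw, rfl⟩)
    · exact ih' w hw
    · have h1 := h g List.mem_cons_self
      have h2 := ih' w hw
      have e : (4 : ℕ) ^ n = 2 ^ (2 * n) := by rw [pow_mul]; norm_num
      rw [e] at h1 h2 ⊢
      exact Nat.xor_lt_two_pow h1 h2

/-! ### Sets of words as bit masks -/

/-- For one position, the sets of the words with symbol `0`, `a`, `b`, `c` in that position. Sets of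
words in a list are encoded as natural numbers, by the bits at their places in the list. -/
structure Masks where
  m0 : ℕ
  ma : ℕ
  mb : ℕ
  mc : ℕ

/-- The set of the words with the symbol with digit `d`. -/
def Masks.get (m : Masks) (d : ℕ) : ℕ :=
  Nat.rec m.m0 (fun d _ => Nat.rec m.ma (fun d _ => Nat.rec m.mb (fun _ _ => m.mc) d) d) d

/-- Union of a set of words of a list with a set of words of the next `N` places. -/
def glue (N x y : ℕ) : ℕ := Nat.lor x (Nat.shiftLeft y N)

theorem testBit_glue (N x y b : ℕ) :
    (glue N x y).testBit b = (x.testBit b || (decide (N ≤ b) && y.testBit (b - N))) := by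
  change (x ||| (y <<< N)).testBit b = _
  rw [Nat.testBit_or, Nat.testBit_shiftLeft]

/-- The masks for a list of words, followed by its translate by a word with digit `d`. -/
def Masks.double (N : ℕ) : Masks → ℕ → Masks
  | ⟨p, q, r, s⟩, 0 => ⟨glue N p p, glue N q q, glue N r r, glue N s s⟩
  | ⟨p, q, r, s⟩, 1 => ⟨glue N p q, glue N q p, glue N r s, glue N s r⟩
  | ⟨p, q, r, s⟩, 2 => ⟨glue N p r, glue N q s, glue N r p, glue N s q⟩
  | ⟨p, q, r, s⟩, _ => ⟨glue N p s, glue N q r, glue N r q, glue N s p⟩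

/-- The translate of a word by a word with digit `d` has the digit `e` exactly when the word itself
has the digit `d` xor `e`. So doubling permutes the four sets. -/
theorem Masks.get_double (N : ℕ) (m : Masks) {d e : ℕ} (hd : d < 4) (he : e < 4) :
    (m.double N d).get e = glue N (m.get e) (m.get (Nat.xor d e)) := by
  obtain ⟨p, q, r, s⟩ := m
  interval_cases d <;> interval_cases e <;> rfl

/-- The masks of position `i` for the list of all sums of the given words. -/
def rowMasks (i : ℕ) : List ℕ → Masks
  | [] => ⟨1, 0, 0, 0⟩
  | g :: gs => (rowMasks i gs).double (Nat.pow 2 gs.length) (dig g i)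

/-- The list for `g :: gs` is the list for `gs` followed by its translate by `g`, so the masks arise
by one doubling for each generator, without inspecting single words. -/
theorem testBit_rowMasks (i : ℕ) (gs : List ℕ) {d : ℕ} (hd : d < 4) (b : ℕ) :
    ((rowMasks i gs).get d).testBit b = true ↔ ∃ w, (words gs)[b]? = some w ∧ dig w i = d := by
  induction gs generalizing d b with
  | nil =>
    have h0 : dig 0 i = 0 := by simp [dig_eq]
    have h1 : ∀ b : ℕ, Nat.testBit 1 b = true ↔ b = 0 := by
      intro b
      rw [Nat.testBit_one_eq_true_iff_self_eq_zero]
    simp only [words, List.getElem?_singleton]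
    interval_cases d
    · change Nat.testBit 1 b = true ↔ _
      rw [h1]
      by_cases hb : b = 0 <;> simp [hb, h0]
    all_goals
      change Nat.testBit 0 b = true ↔ _
      by_cases hb : b = 0 <;> simp [hb, h0]
  | cons g gs ih =>
    have hx : Nat.xor (dig g i) d < 4 := Nat.xor_lt_two_pow (n := 2) (dig_lt g i) hd
    rw [rowMasks, Masks.get_double _ _ (dig_lt _ _) hd, testBit_glue, words, Bool.or_eq_true,
      Bool.and_eq_true, decide_eq_true_iff, ih hd, ih hx, List.getElem?_append, length_words]
    change _ ∨ 2 ^ gs.length ≤ b ∧ (∃ w, (words gs)[b - 2 ^ gs.length]? = _ ∧ _) ↔ _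
    split_ifs with hb
    · constructor
      · rintro (h | h)
        · exact h
        · omega
      · exact Or.inl
    · have hn : (words gs)[b]? = none := by
        rw [List.getElem?_eq_none_iff, length_words]; omega
      simp only [hn, reduceCtorEq, false_and, exists_false, false_or, List.getElem?_map,
        Option.map_eq_some_iff]
      have hxx : ∀ x y : ℕ, y = Nat.xor x d ↔ Nat.xor x y = d := by
        intro x y
        change y = x ^^^ d ↔ x ^^^ y = d
        constructor <;> rintro rfl <;> rw [← Nat.xor_assoc, Nat.xor_self, Nat.zero_xor]
      constructor
      · rintro ⟨-, w, hw, h⟩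
        exact ⟨_, ⟨w, hw, rfl⟩, by rw [dig_xor]; exact (hxx _ _).1 h⟩
      · rintro ⟨_, ⟨w, hw, rfl⟩, h⟩
        exact ⟨by omega, w, hw, (hxx _ _).2 (by rwa [dig_xor] at h)⟩

/-- The set of the words of a list with a given property. -/
def maskOf (p : ℕ → Bool) : List ℕ → ℕ
  | [] => 0
  | w :: ws => Nat.add (bif p w then 1 else 0) (Nat.mul 2 (maskOf p ws))

theorem testBit_maskOf (p : ℕ → Bool) (l : List ℕ) (b : ℕ) :
    (maskOf p l).testBit b = true ↔ ∃ w, l[b]? = some w ∧ p w = true := by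
  induction l generalizing b with
  | nil => simp [maskOf]
  | cons w ws ih =>
    have h : maskOf p (w :: ws) = 2 * maskOf p ws + (bif p w then 1 else 0) := Nat.add_comm _ _
    rw [h]
    cases b with
    | zero =>
      rw [Nat.testBit_zero]
      cases hp : p w <;> simp [hp]
    | succ b =>
      rw [Nat.testBit_add_one, List.getElem?_cons_succ, ← ih]
      have : (2 * maskOf p ws + (bif p w then 1 else 0)) / 2 = maskOf p ws := by
        cases p w <;> (simp; try omega)
      rw [this]

/-- The set of the words with a nonzero symbol. -/
def Masks.nonzero (m : Masks) : ℕ := Nat.lor m.ma (Nat.lor m.mb m.mc)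

/-- One more position in the computation of `weightMasks`. -/
def stepWeight (m : Masks) : List ℕ → ℕ → List ℕ
  | [], p => [Nat.land p m.nonzero]
  | c :: cs, p => Nat.lor (Nat.land c m.m0) (Nat.land p m.nonzero) :: stepWeight m cs c

/-- The sets of the words of weight `0`, `1`, `2`, … in a list of `N` words. -/
def weightMasks (N : ℕ) : List Masks → List ℕ
  | [] => [Nat.sub (Nat.pow 2 N) 1]
  | m :: ms => stepWeight m (weightMasks N ms) 0

/-- With one more position, weight `k` arises from weight `k` and symbol zero or from weight `k - 1`
and a nonzero symbol. The argument `p` carries the set for the preceding weight, which is empty at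
the start. -/
theorem testBit_stepWeight (m : Masks) (cs : List ℕ) (p k b : ℕ) :
    ((stepWeight m cs p).getD k 0).testBit b = true ↔
      (((cs.getD k 0).testBit b = true ∧ m.m0.testBit b = true) ∨
        (((p :: cs).getD k 0).testBit b = true ∧ m.nonzero.testBit b = true)) := by
  induction cs generalizing p k with
  | nil => cases k <;> simp [stepWeight]
  | cons c cs ih =>
    cases k with
    | zero => simp [stepWeight]
    | succ k =>
      have := ih c k
      rwa [stepWeight, List.getD_cons_succ, List.getD_cons_succ, List.getD_cons_succ]

theorem testBit_weightMasks (gs : List ℕ) (l : List ℕ) (k b : ℕ) :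
    ((weightMasks (words gs).length (l.map fun i => rowMasks i gs)).getD k 0).testBit b = true ↔
      ∃ w, (words gs)[b]? = some w ∧ l.countP (fun i => dig w i ≠ 0) = k := by
  induction l generalizing k with
  | nil =>
    have h : weightMasks (words gs).length ([].map fun i => rowMasks i gs) =
      [2 ^ (words gs).length - 1] := rfl
    rw [h]
    cases k with
    | zero =>
      rw [List.getD_cons_zero, Nat.testBit_two_pow_sub_one, decide_eq_true_iff]
      simp only [List.countP_nil, and_true]
      exact ⟨fun h => ⟨_, List.getElem?_eq_getElem h⟩, fun ⟨w, h⟩ =>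
        (List.getElem?_eq_some_iff.1 h).1⟩
    | succ k => simp
  | cons i l ih =>
    rw [List.map_cons, weightMasks, testBit_stepWeight, ih]
    have h0 : ((rowMasks i gs).m0).testBit b = true ↔ ∃ w, (words gs)[b]? = some w ∧ dig w i = 0 :=
      testBit_rowMasks i gs (d := 0) (by norm_num) b
    have h1 : ((rowMasks i gs).nonzero).testBit b = true ↔
        ∃ w, (words gs)[b]? = some w ∧ dig w i ≠ 0 := by
      have e : (rowMasks i gs).nonzero = (rowMasks i gs).get 1 |||
        ((rowMasks i gs).get 2 ||| (rowMasks i gs).get 3) := rfl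
      rw [e, Nat.testBit_or, Nat.testBit_or, Bool.or_eq_true, Bool.or_eq_true,
        testBit_rowMasks i gs (by norm_num), testBit_rowMasks i gs (by norm_num),
        testBit_rowMasks i gs (by norm_num)]
      constructor
      · rintro (⟨w, hw, h⟩ | ⟨w, hw, h⟩ | ⟨w, hw, h⟩) <;> exact ⟨w, hw, by omega⟩
      · rintro ⟨w, hw, h⟩
        have := dig_lt w i
        obtain h | h | h : dig w i = 1 ∨ dig w i = 2 ∨ dig w i = 3 := by omega
        · exact Or.inl ⟨w, hw, h⟩
        · exact Or.inr (Or.inl ⟨w, hw, h⟩)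
        · exact Or.inr (Or.inr ⟨w, hw, h⟩)
    rw [h0, h1]
    cases hw : (words gs)[b]? with
    | none =>
      have : ∀ k, ¬ ((0 :: weightMasks (words gs).length (l.map fun i => rowMasks i gs)).getD k
          0).testBit b = true := by
        intro k
        cases k with
        | zero => simp
        | succ k => rw [List.getD_cons_succ, ih, hw]; simp
      simp
    | some w =>
      simp only [Option.some.injEq, exists_eq_left', List.countP_cons, decide_eq_true_eq]
      cases k with
      | zero => by_cases hd : dig w i = 0 <;> simp [hd]
      | succ k =>
        rw [List.getD_cons_succ, ih, hw]
        by_cases hd : dig w i = 0 <;> simp [hd]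

/-! ### Evaluation of arguments -/

/-- Application of a function to a number that is evaluated first. -/
def force {α : Type} (n : ℕ) (f : ℕ → α) : α := Nat.rec (f 0) (fun n _ => f (Nat.succ n)) n

/-- The case distinction in `force` is what makes reduction evaluate the argument, so that a value
used many times is computed once; as a function it is plain application. -/
theorem force_eq {α : Type} (n : ℕ) (f : ℕ → α) : force n f = f n := by cases n <;> rfl

def forceList {α : Type} : List ℕ → (List ℕ → α) → α
  | [], f => f []
  | c :: l, f => force c fun c => forceList l fun l => f (c :: l)

theorem forceList_eq {α : Type} (l : List ℕ) (f : List ℕ → α) : forceList l f = f l := by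
  induction l generalizing f with
  | nil => rfl
  | cons c l ih => rw [forceList, force_eq, ih]

def forceLists {α : Type} : List (List ℕ) → (List (List ℕ) → α) → α
  | [], f => f []
  | c :: l, f => forceList c fun c => forceLists l fun l => f (c :: l)

theorem forceLists_eq {α : Type} (l : List (List ℕ)) (f : List (List ℕ) → α) :
    forceLists l f = f l := by
  induction l generalizing f with
  | nil => rfl
  | cons c l ih => rw [forceLists, forceList_eq, ih]

def forceMasks {α : Type} : List Masks → (List Masks → α) → α
  | [], f => f []
  | m :: ms, f => force m.m0 fun p => force m.ma fun q => force m.mb fun r => force m.mc fun s =>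
    forceMasks ms fun l => f (⟨p, q, r, s⟩ :: l)

theorem forceMasks_eq {α : Type} (l : List Masks) (f : List Masks → α) : forceMasks l f = f l := by
  induction l generalizing f with
  | nil => rfl
  | cons m l ih => rw [forceMasks, force_eq, force_eq, force_eq, force_eq, ih]

/-! ### Backtracking search for isometries -/

/-- Intersects a set of candidates for the image of each of several words, whose symbols in one
position are given, with the sets of the words having the image of that symbol in the new position.
Fails if one of the sets becomes empty. -/
noncomputable def step (m : Masks) : List ℕ → List ℕ → Option (List ℕ) :=
  @List.rec ℕ (fun _ => List ℕ → Option (List ℕ))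
    (fun cs => @List.rec ℕ (fun _ => Option (List ℕ)) (some []) (fun _ _ _ => none) cs)
    fun d _ ih cs => @List.rec ℕ (fun _ => Option (List ℕ)) none (fun c cs _ =>
      @Nat.rec (fun _ => Option (List ℕ)) none (fun c' _ =>
        @Option.rec (List ℕ) (fun _ => Option (List ℕ)) none (fun l => some (Nat.succ c' :: l))
          (ih cs)) (Nat.land c (m.get d))) cs

/-- Giving up at an empty candidate set loses nothing, because `P` fails for the empty set `0`.
Keeping `P` general lets the same fact serve the search and the stabilizer chain. -/
theorem step_spec {α : Type} (m : Masks) (D : α → ℕ) (P : ℕ → α → Prop) (hP : ∀ x, ¬ P 0 x)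
    (X : List α) (cs : List ℕ) :
    (∃ cs', step m (X.map D) cs = some cs' ∧ List.Forall₂ P cs' X) ↔
      List.Forall₂ (fun c x => P (c &&& m.get (D x)) x) cs X := by
  induction X generalizing cs with
  | nil =>
    cases cs with
    | nil =>
      simp only [List.map_nil, List.forall₂_nil_right_iff, iff_true]
      exact ⟨[], rfl, rfl⟩
    | cons c cs =>
      simp only [List.map_nil, List.forall₂_nil_right_iff, reduceCtorEq, iff_false]
      rintro ⟨cs', h, -⟩
      cases h
  | cons x X ih =>
    cases cs with
    | nil =>
      simp only [List.map_cons, List.forall₂_nil_left_iff, reduceCtorEq, iff_false]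
      rintro ⟨cs', h, -⟩
      cases h
    | cons c cs =>
      rw [List.forall₂_cons, ← ih]
      have e : step m ((x :: X).map D) (c :: cs) = @Nat.rec (fun _ => Option (List ℕ)) none
        (fun c' _ => @Option.rec (List ℕ) (fun _ => Option (List ℕ)) none
          (fun l => some (Nat.succ c' :: l)) (step m (X.map D) cs)) (c &&& m.get (D x)) := rfl
      rw [e]
      cases hc : c &&& m.get (D x) with
      | zero => simp [hP]
      | succ c' =>
        cases step m (X.map D) cs with
        | none => simp
        | some l => simp

theorem step_length {m : Masks} {ds cs cs' : List ℕ} (h : step m ds cs = some cs') :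
    cs'.length = ds.length := by
  induction ds generalizing cs cs' with
  | nil =>
    cases cs with
    | nil => cases h; rfl
    | cons c cs => cases h
  | cons d ds ih =>
    cases cs with
    | nil => cases h
    | cons c cs =>
      have e : step m (d :: ds) (c :: cs) = @Nat.rec (fun _ => Option (List ℕ)) none
        (fun c' _ => @Option.rec (List ℕ) (fun _ => Option (List ℕ)) none
          (fun l => some (Nat.succ c' :: l)) (step m ds cs)) (c &&& m.get d) := rfl
      rw [e] at h
      cases hc : c &&& m.get d with
      | zero => rw [hc] at h; cases h
      | succ c' =>
        cases hs : step m ds cs with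
        | none => rw [hc, hs] at h; cases h
        | some l =>
          rw [hc, hs] at h
          cases h
          rw [List.length_cons, List.length_cons, ih hs]

/-- The masks after the six permutations of the symbols `a`, `b`, `c`. -/
def Masks.variants : Masks → List Masks
  | ⟨p, q, r, s⟩ =>
    [⟨p, q, r, s⟩, ⟨p, q, s, r⟩, ⟨p, r, q, s⟩, ⟨p, r, s, q⟩, ⟨p, s, q, r⟩, ⟨p, s, r, q⟩]

/-- The automorphism of `K` with given images of `a` and `b`. -/
noncomputable def autK (u v : K) (h : Function.Injective fun k : K => (k.1.val • u + k.2.val • v : K))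
    (h' : ∀ k l : K, ((k + l).1.val • u + (k + l).2.val • v : K) =
      (k.1.val • u + k.2.val • v) + (l.1.val • u + l.2.val • v)) : K ≃+ K :=
  AddEquiv.ofBijective (AddMonoidHom.mk' (fun k : K => (k.1.val • u + k.2.val • v : K)) h')
    (Finite.injective_iff_bijective.1 h)

/-- The six automorphisms of `K`. -/
noncomputable def autsK : List (K ≃+ K) :=
  [autK a b (by decide) (by decide), autK a c (by decide) (by decide),
    autK b a (by decide) (by decide), autK b c (by decide) (by decide),
    autK c a (by decide) (by decide), autK c b (by decide) (by decide)]

theorem autsK_nodup : autsK.Nodup := by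
  refine List.Nodup.of_map (fun ρ => (ρ a, ρ b)) ?_
  change [(a, b), (a, c), (b, a), (b, c), (c, a), (c, b)].Nodup
  decide

/-- An automorphism is determined by the images of `a` and `b`, which are two distinct nonzero
elements. -/
theorem mem_autsK (ρ : K ≃+ K) : ρ ∈ autsK := by
  have h1 : ρ a ≠ 0 := by rw [Ne, EmbeddingLike.map_eq_zero_iff]; decide
  have h2 : ρ b ≠ 0 := by rw [Ne, EmbeddingLike.map_eq_zero_iff]; decide
  have h3 : ρ a ≠ ρ b := by rw [Ne, EmbeddingLike.apply_eq_iff_eq]; decide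
  have h4 : ∀ k l : K, k ≠ 0 → l ≠ 0 → k ≠ l → (k, l) ∈ autsK.map fun ρ => (ρ a, ρ b) := by
    change ∀ k l : K, k ≠ 0 → l ≠ 0 → k ≠ l →
      (k, l) ∈ [(a, b), (a, c), (b, a), (b, c), (c, a), (c, b)]
    decide
  obtain ⟨τ, hτ, h⟩ := List.mem_map.1 (h4 _ _ h1 h2 h3)
  have h5 : τ a = ρ a := congrArg Prod.fst h
  have h6 : τ b = ρ b := congrArg Prod.snd h
  have : τ = ρ := by
    ext1 k
    have h7 : ∀ k : K, k = 0 ∨ k = a ∨ k = b ∨ k = a + b := by decide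
    obtain rfl | rfl | rfl | rfl := h7 k <;> simp [h5, h6]
  rwa [← this]

/-- The masks after the permutation `ρ` of the symbols. -/
noncomputable def Masks.permute (m : Masks) (ρ : K ≃+ K) : Masks :=
  ⟨m.get (num (ρ 0)), m.get (num (ρ a)), m.get (num (ρ b)), m.get (num (ρ c))⟩

theorem Masks.get_permute (m : Masks) (ρ : K ≃+ K) (k : K) :
    (m.permute ρ).get (num k) = m.get (num (ρ k)) := by
  have h7 : ∀ k : K, k = 0 ∨ k = a ∨ k = b ∨ k = c := by decide
  obtain rfl | rfl | rfl | rfl := h7 k <;> rfl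

/-- The six variants are listed in the order of `autsK`, which makes this a definitional equality.
-/
theorem Masks.variants_eq (m : Masks) : m.variants = autsK.map m.permute := rfl

/-- The ways to choose an element of a list, with the remaining list. -/
def splits {α : Type} : List α → List (α × List α)
  | [] => []
  | r :: rs => (r, rs) :: (splits rs).map fun p => (p.1, r :: p.2)

theorem splits_map {α β : Type} (f : α → β) (l : List α) :
    splits (l.map f) = (splits l).map fun p => (f p.1, p.2.map f) := by
  induction l with
  | nil => rfl
  | cons r l ih => simp [splits, ih]

theorem perm_of_mem_splits {α : Type} {l : List α} {p : α × List α} (h : p ∈ splits l) :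
    (p.1 :: p.2).Perm l := by
  induction l generalizing p with
  | nil => simp [splits] at h
  | cons r l ih =>
    simp only [splits, List.mem_cons, List.mem_map] at h
    obtain rfl | ⟨q, hq, rfl⟩ := h
    · rfl
    · exact (List.Perm.swap _ _ _).trans ((ih hq).cons r)

theorem map_fst_splits {α : Type} (l : List α) : (splits l).map Prod.fst = l := by
  induction l with
  | nil => rfl
  | cons r l ih =>
    rw [splits, List.map_cons, List.map_map]
    conv_rhs => rw [← ih]
    rfl

/-- Decides whether the positions, for which the symbols of several words are listed in `levels`,
have an injective assignment to the positions with masks `rows`, together with permutations of the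
symbols, such that each of the words is mapped to one of its candidates. -/
noncomputable def search : List (List ℕ) → List Masks → List ℕ → Bool :=
  @List.rec (List ℕ) (fun _ => List Masks → List ℕ → Bool)
    (fun _ cs => cs.all fun c => !(Nat.beq c 0))
    fun ds _ ih rows cs => (splits rows).any fun p => p.1.variants.any fun m =>
      @Option.rec (List ℕ) (fun _ => Bool) false (fun cs' => ih p.2 cs') (step m ds cs)

/-- The result of a search in which the image of the first position is fixed. -/
noncomputable def continues (lv : List (List ℕ)) (ds : List ℕ) (m : Masks) (rows : List Masks)
    (cs : List ℕ) : Bool :=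
  @Option.rec (List ℕ) (fun _ => Bool) false (fun cs' => search lv rows cs') (step m ds cs)

theorem continues_iff {lv : List (List ℕ)} {ds : List ℕ} {m : Masks} {rows : List Masks}
    {cs : List ℕ} : continues lv ds m rows cs = true ↔
      ∃ cs', step m ds cs = some cs' ∧ search lv rows cs' = true := by
  rw [continues]
  cases step m ds cs <;> simp

/-- The number of possible images of the first position. -/
noncomputable def count (lv : List (List ℕ)) (ds : List ℕ) (rows : List Masks) (cs : List ℕ) : ℕ :=
  ((splits rows).map fun p => p.1.variants.countP fun m => continues lv ds m p.2 cs).sum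

/-- The product of the numbers of images of each position under the maps that fix all
positions before it. -/
noncomputable def chain : List (List ℕ) → List Masks → List ℕ → ℕ
  | ds :: lv, r :: rows, cs => count lv ds (r :: rows) cs *
      @Option.rec (List ℕ) (fun _ => ℕ) 0 (fun cs' => chain lv rows cs') (step r ds cs)
  | _, _, _ => 1

/-! ### Correctness of the backtracking search -/

section spec

variable {n : ℕ}

/-- `b` is the place of a word with the images of the symbols of `x` in the positions of `ts`. -/
def Matches (Wd : ℕ → Option (Fin n → K)) (ts : List (Fin n)) (e : Fin n → Fin n)
    (σ : Fin n → (K ≃+ K)) (c : ℕ) (x : Fin n → K) : Prop :=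
  ∃ b, c.testBit b = true ∧ ∀ t ∈ ts, ∃ v, Wd b = some v ∧ v (e t) = σ t (x t)

/-- The inductive step of `search_spec`, isolated because `count` needs it too. Once the target
`p.1` and the permutation `ρ` for position `t` are chosen, `step` moves the condition at `t` from
the matching into the candidate sets, and `ih` handles the remaining positions. -/
theorem continues_spec_aux {Wd : ℕ → Option (Fin n → K)} {R : Fin n → Masks}
    (hR : ∀ j k b, ((R j).get (num k)).testBit b = true ↔ ∃ v, Wd b = some v ∧ v j = k)
    {ts : List (Fin n)} {t : Fin n} (hts : (t :: ts).Nodup) (X : List (Fin n → K))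
    (ih : ∀ (J : List (Fin n)) (cs : List ℕ), J.length = ts.length → cs.length = X.length →
      (search (ts.map fun t => X.map fun x => num (x t)) (J.map R) cs = true ↔
        ∃ e σ, (ts.map e).Perm J ∧ List.Forall₂ (Matches Wd ts e σ) cs X))
    (J : List (Fin n)) (cs : List ℕ) (hJ : J.length = (t :: ts).length) {p : Fin n × List (Fin n)}
    (hp : p ∈ splits J) (ρ : K ≃+ K) :
    continues (ts.map fun t => X.map fun x => num (x t)) (X.map fun x => num (x t))
        ((R p.1).permute ρ) (p.2.map R) cs = true ↔
      ∃ e σ, e t = p.1 ∧ σ t = ρ ∧ ((t :: ts).map e).Perm J ∧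
        List.Forall₂ (Matches Wd (t :: ts) e σ) cs X := by
  have hpJ := perm_of_mem_splits hp
  have htn : t ∉ ts := (List.nodup_cons.1 hts).1
  have hl : p.2.length = ts.length := by
    have := hpJ.length_eq
    simp only [List.length_cons] at this hJ
    omega
  have key : ∀ e σ, (∃ cs', step ((R p.1).permute ρ) (X.map fun x => num (x t)) cs = some cs' ∧
      List.Forall₂ (Matches Wd ts e σ) cs' X) ↔ List.Forall₂ (fun c x => ∃ b, c.testBit b = true ∧
        (∃ v, Wd b = some v ∧ v p.1 = ρ (x t)) ∧
        ∀ t ∈ ts, ∃ v, Wd b = some v ∧ v (e t) = σ t (x t)) cs X := by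
    intro e σ
    rw [step_spec _ _ _ (by rintro x ⟨b, hb, -⟩; simp at hb)]
    refine iff_of_eq (congrArg (fun P => List.Forall₂ P cs X) ?_)
    funext c x
    simp only [Matches, Masks.get_permute, Nat.testBit_and, Bool.and_eq_true, hR, and_assoc]
  rw [continues_iff]
  constructor
  · rintro ⟨cs', h1, h2⟩
    obtain ⟨e, σ, he, h3⟩ := (ih p.2 cs' hl (by rw [step_length h1, List.length_map])).1 h2
    have h4 := (key e σ).1 ⟨cs', h1, h3⟩
    have hne : ∀ t' ∈ ts, t' ≠ t := fun t' ht' h => htn (h ▸ ht')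
    -- The maps found for `ts` are arbitrary at `t`, so they may be overwritten there.
    refine ⟨Function.update e t p.1, Function.update σ t ρ, by simp, by simp, ?_, ?_⟩
    · rw [List.map_cons, Function.update_self]
      refine List.Perm.trans ?_ hpJ
      refine List.Perm.cons _ ?_
      rwa [List.map_congr_left fun t' ht' => Function.update_of_ne (hne t' ht') _ _]
    · refine List.Forall₂.imp ?_ h4
      rintro c x ⟨b, hb, hb1, hb2⟩
      refine ⟨b, hb, ?_⟩
      intro t' ht'
      rcases List.mem_cons.1 ht' with rfl | ht'
      · simpa using hb1
      · simpa [Function.update_of_ne (hne t' ht')] using hb2 t' ht'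
  · obtain ⟨j, J'⟩ := p
    rintro ⟨e, σ, rfl, rfl, he, h⟩
    obtain ⟨cs', h1, h2⟩ := (key e σ).2 (h.imp fun c x ⟨b, hb, hb'⟩ =>
      ⟨b, hb, hb' t List.mem_cons_self, fun t' ht' => hb' t' (List.mem_cons_of_mem _ ht')⟩)
    refine ⟨cs', h1, (ih J' cs' hl (by rw [step_length h1, List.length_map])).2 ⟨e, σ, ?_, h2⟩⟩
    exact (List.perm_cons _).1 (he.trans hpJ.symm)

/-- The words interact only through the common `e` and `σ`. For a fixed choice of these, the
candidates of each word are filtered independently, position by position. -/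
theorem search_spec {Wd : ℕ → Option (Fin n → K)} {R : Fin n → Masks}
    (hR : ∀ j k b, ((R j).get (num k)).testBit b = true ↔ ∃ v, Wd b = some v ∧ v j = k)
    {ts : List (Fin n)} (hts : ts.Nodup) (X : List (Fin n → K))
    (J : List (Fin n)) (cs : List ℕ) (hJ : J.length = ts.length) (hcs : cs.length = X.length) :
    search (ts.map fun t => X.map fun x => num (x t)) (J.map R) cs = true ↔
      ∃ e σ, (ts.map e).Perm J ∧ List.Forall₂ (Matches Wd ts e σ) cs X := by
  induction ts generalizing J cs with
  | nil =>
    obtain rfl : J = [] := List.length_eq_zero_iff.1 hJ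
    have h1 : search [] [] cs = cs.all fun c => !(Nat.beq c 0) := rfl
    have h2 : ∀ c : ℕ, (∃ b, c.testBit b = true) ↔ c ≠ 0 :=
      fun c => ⟨by rintro ⟨b, hb⟩ rfl; simp at hb, Nat.exists_testBit_of_ne_zero⟩
    -- With no positions left, a matching only asks for a nonempty candidate set.
    have h5 : ∀ e σ, Matches Wd [] e σ = fun c _ => c ≠ 0 := by
      intro e σ
      funext c x
      simp [Matches, ← h2]
    have h6 : ∀ c : ℕ, (!(Nat.beq c 0)) = true ↔ c ≠ 0 := by
      intro c
      cases c <;> simp [Nat.beq]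
    have h3 : (cs.all fun c => !(Nat.beq c 0)) = true ↔ ∀ c ∈ cs, c ≠ 0 := by
      simp only [List.all_eq_true, h6]
    simp only [List.map_nil, h1, h3, h5, List.Perm.refl, true_and]
    have h4 : List.Forall₂ (fun c (_ : Fin n → K) => c ≠ 0) cs X ↔ ∀ c ∈ cs, c ≠ 0 := by
      clear h1 h3 h5
      induction cs generalizing X with
      | nil =>
        obtain rfl : X = [] := List.length_eq_zero_iff.1 hcs.symm
        simp
      | cons c cs ih =>
        cases X with
        | nil => simp at hcs
        | cons x X => simp [ih X (by simpa using hcs)]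
    rw [h4]
    exact ⟨fun h => ⟨id, fun _ => AddEquiv.refl K, h⟩, fun ⟨_, _, h⟩ => h⟩
  | cons t ts ih =>
    have ih' := fun J cs => ih (List.nodup_cons.1 hts).2 J cs
    have h1 : search ((t :: ts).map fun t => X.map fun x => num (x t)) (J.map R) cs =
      (splits (J.map R)).any fun p => p.1.variants.any fun m =>
        continues (ts.map fun t => X.map fun x => num (x t)) (X.map fun x => num (x t)) m p.2 cs :=
      rfl
    rw [h1]
    simp only [splits_map, List.any_map, Masks.variants_eq, List.any_eq_true, Function.comp_apply]
    constructor
    · rintro ⟨p, hp, ρ, -, h⟩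
      obtain ⟨e, σ, -, -, h2, h3⟩ := (continues_spec_aux hR hts X ih' J cs hJ hp ρ).1 h
      exact ⟨e, σ, h2, h3⟩
    · rintro ⟨e, σ, h2, h3⟩
      have h4 : e t ∈ (splits J).map Prod.fst := by
        rw [map_fst_splits]
        exact h2.subset (by simp)
      obtain ⟨p, hp, hpt⟩ := List.mem_map.1 h4
      exact ⟨p, hp, σ t, mem_autsK _,
        (continues_spec_aux hR hts X ih' J cs hJ hp _).2 ⟨e, σ, hpt.symm, rfl, h2, h3⟩⟩

theorem continues_spec {Wd : ℕ → Option (Fin n → K)} {R : Fin n → Masks}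
    (hR : ∀ j k b, ((R j).get (num k)).testBit b = true ↔ ∃ v, Wd b = some v ∧ v j = k)
    {ts : List (Fin n)} {t : Fin n} (hts : (t :: ts).Nodup) (X : List (Fin n → K))
    (J : List (Fin n)) (cs : List ℕ) (hJ : J.length = (t :: ts).length) {p : Fin n × List (Fin n)}
    (hp : p ∈ splits J) (ρ : K ≃+ K) :
    continues (ts.map fun t => X.map fun x => num (x t)) (X.map fun x => num (x t))
        ((R p.1).permute ρ) (p.2.map R) cs = true ↔
      ∃ e σ, e t = p.1 ∧ σ t = ρ ∧ ((t :: ts).map e).Perm J ∧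
        List.Forall₂ (Matches Wd (t :: ts) e σ) cs X :=
  continues_spec_aux hR hts X (fun J cs => search_spec hR (List.nodup_cons.1 hts).2 X J cs) J cs hJ
    hp ρ

end spec

/-! ### Orders of groups of isometries -/

/-- Orbit-stabilizer: a map which is constant exactly on the left cosets identifies the cosets with
its values. It is used for images of positions, for permutations of components and for classes of
codes. -/
theorem relIndex_eq_ncard_image {G A : Type*} [Group G] {H L : Subgroup G} (φ : G → A)
    (hφ : ∀ g ∈ H, ∀ h ∈ H, φ g = φ h ↔ g⁻¹ * h ∈ L) : L.relIndex H = (φ '' H).ncard := by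
  rw [Subgroup.relIndex, Subgroup.index, ← Nat.card_coe_set_eq]
  have h1 : ∀ g h : H, (QuotientGroup.leftRel (L.subgroupOf H)) g h ↔ φ g = φ h := by
    intro g h
    rw [QuotientGroup.leftRel_apply, hφ g g.2 h h.2, Subgroup.mem_subgroupOf]
    rfl
  refine Nat.card_congr (Equiv.ofBijective (fun q => Quotient.liftOn' q
    (fun g : H => (⟨φ g, g, g.2, rfl⟩ : φ '' (H : Set G))) ?_) ⟨?_, ?_⟩)
  · intro g h hgh
    exact Subtype.ext ((h1 g h).1 hgh)
  · intro q q'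
    induction q using Quotient.inductionOn'
    induction q' using Quotient.inductionOn'
    intro h
    exact Quotient.sound' ((h1 _ _).2 (congrArg Subtype.val h))
  · rintro ⟨_, g, hg, rfl⟩
    exact ⟨Quotient.mk'' ⟨g, hg⟩, rfl⟩

theorem card_mul_relIndex {G : Type*} [Group G] {H L : Subgroup G} (h : L ≤ H) :
    Nat.card L * L.relIndex H = Nat.card H := by
  rw [← Subgroup.relIndex_bot_left, ← Subgroup.relIndex_bot_left]
  exact Subgroup.relIndex_mul_relIndex _ _ _ bot_le h

/-! ### Images of positions under isometries -/

section sends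

variable {ι : Type}

/-- The isometry `g` carries position `t` to position `j`, with the permutation `ρ` of symbols. -/
def Sends (g : Equiv.Perm (ι → K)) (t j : ι) (ρ : K ≃+ K) : Prop := ∀ x, g x j = ρ (x t)

theorem exists_sends {g : Equiv.Perm (ι → K)} (hg : g ∈ isometries ι) :
    ∃ (e : ι ≃ ι) (σ : ι → (K ≃+ K)), ∀ t, Sends g t (e t) (σ t) := by
  obtain ⟨e, σ, rfl⟩ := hg
  refine ⟨e.symm, fun t => σ (e.symm t), fun t x => ?_⟩
  change σ (e.symm t) (x (e (e.symm t))) = _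
  rw [Equiv.apply_symm_apply]

theorem isometry_of_equiv (e : ι ≃ ι) (σ : ι → (K ≃+ K)) :
    ∃ g ∈ isometries ι, ∀ t, Sends g t (e t) (σ t) := by
  refine ⟨(monomial e.symm fun j => σ (e.symm j)).toEquiv, ⟨_, _, rfl⟩, fun t x => ?_⟩
  change σ (e.symm (e t)) (x (e.symm (e t))) = _
  rw [Equiv.symm_apply_apply]

variable [DecidableEq ι]

/-- Words with a single nonzero entry detect first the position and then the permutation of the
symbols. -/
theorem frame_unique {t t' : ι} {ρ ρ' : K ≃+ K} (h : ∀ x : ι → K, ρ (x t) = ρ' (x t')) :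
    t = t' ∧ ρ = ρ' := by
  have ht : t = t' := by
    by_contra hne
    have := h (Pi.single t a)
    rw [Pi.single_eq_same, Pi.single_eq_of_ne (Ne.symm hne), map_zero,
      EmbeddingLike.map_eq_zero_iff] at this
    exact absurd this (by decide)
  subst ht
  refine ⟨rfl, AddEquiv.ext fun k => ?_⟩
  simpa using h (Pi.single t k)

theorem Sends.unique_target {g : Equiv.Perm (ι → K)} (hg : g ∈ isometries ι) {t j j' : ι}
    {ρ ρ' : K ≃+ K} (h : Sends g t j ρ) (h' : Sends g t j' ρ') : j = j' ∧ ρ = ρ' := by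
  obtain ⟨e, σ, he⟩ := exists_sends hg
  have key : ∀ j ρ, Sends g t j ρ → j = e t ∧ ρ = σ t := by
    intro j ρ h
    obtain ⟨s, rfl⟩ := e.surjective j
    obtain ⟨rfl, h1⟩ := frame_unique fun x => (h x).symm.trans (he s x)
    exact ⟨rfl, h1⟩
  exact ⟨(key _ _ h).1.trans (key _ _ h').1.symm, (key _ _ h).2.trans (key _ _ h').2.symm⟩

/-- The maps that fix the symbols in all positions outside `ts`. -/
def fixOutside (ts : List ι) : Subgroup (Equiv.Perm (ι → K)) where
  carrier := {g | ∀ i ∉ ts, ∀ x, g x i = x i}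
  one_mem' := fun _ _ _ => rfl
  mul_mem' := fun {g h} hg hh i hi x => (hg i hi (h x)).trans (hh i hi x)
  inv_mem' := fun {g} hg i hi x => by
    have := hg i hi (g⁻¹ x)
    rw [← this]
    exact congrFun (Equiv.apply_symm_apply g x) i

end sends

/-! ### The stabilizer chain -/

section chain

variable {n : ℕ}

/-- The elements `g` and `h` lie in one coset of the stabilizer of position `t` when they agree on
where `t` goes and how its symbols are permuted. -/
theorem isometry_inv_mul {g h : Equiv.Perm (Fin n → K)} {t : Fin n} {j : Fin n} {ρ : K ≃+ K}
    (hg : Sends g t j ρ) : (∀ x, (g⁻¹ * h) x t = x t) ↔ Sends h t j ρ := by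
  have h1 : ∀ y, (g⁻¹ y) t = ρ.symm (y j) := by
    intro y
    have h2 := hg (g⁻¹ y)
    rw [show g (g⁻¹ y) = y from Equiv.apply_symm_apply g y] at h2
    rw [h2, AddEquiv.symm_apply_apply]
  refine forall_congr' fun x => ?_
  rw [Equiv.Perm.mul_apply, h1]
  exact (AddEquiv.symm_apply_eq ρ)

/-- Orbit-stabilizer for position `t` with its symbols: `H` moves nothing outside `t :: ts`, so
fixing the symbols at `t` as well means moving nothing outside `ts`. -/
theorem relIndex_fix {H : Subgroup (Equiv.Perm (Fin n → K))} (hH : H ≤ isometries (Fin n))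
    {t : Fin n} {ts : List (Fin n)} (ht : t ∉ ts) (hHt : H ≤ fixOutside (t :: ts)) :
    (H ⊓ fixOutside ts).relIndex H =
      {p : (_ : Fin n) × (K ≃+ K) | ∃ h ∈ H, Sends h t p.1 p.2}.ncard := by
  classical
  have hex : ∀ g : Equiv.Perm (Fin n → K), ∃ p : (_ : Fin n) × (K ≃+ K), g ∈ H → Sends g t p.1 p.2 := by
    intro g
    by_cases hg : g ∈ H
    · obtain ⟨e, σ, h⟩ := exists_sends (hH hg)
      exact ⟨⟨e t, σ t⟩, fun _ => h t⟩
    · exact ⟨⟨t, AddEquiv.refl K⟩, fun h => absurd h hg⟩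
  choose φ hφ using hex
  rw [relIndex_eq_ncard_image φ]
  · congr 1
    ext p
    constructor
    · rintro ⟨h, hh, rfl⟩
      exact ⟨h, hh, hφ h hh⟩
    · rintro ⟨h, hh, hp⟩
      refine ⟨h, hh, ?_⟩
      obtain ⟨h1, h2⟩ := (hφ h hh).unique_target (hH hh) hp
      exact Sigma.ext h1 (heq_of_eq h2)
  · intro g hg h hh
    have h1 : (φ g = φ h) ↔ Sends h t (φ g).1 (φ g).2 := by
      constructor
      · intro e
        rw [e]
        exact hφ h hh
      · intro hs
        obtain ⟨h1, h2⟩ := hs.unique_target (hH hh) (hφ h hh)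
        exact Sigma.ext h1 (heq_of_eq h2)
    rw [h1, ← isometry_inv_mul (hφ g hg)]
    have hgh : g⁻¹ * h ∈ H := mul_mem (inv_mem hg) hh
    constructor
    · intro hx
      refine ⟨hgh, fun i hi x => ?_⟩
      by_cases hit : i = t
      · subst hit
        exact hx x
      · exact hHt hgh i (by simp [hit, hi]) x
    · exact fun hx x => hx.2 t ht x

/-- `g` carries `x` to one of the words in the set `c`. -/
def MapsInto (Wd : ℕ → Option (Fin n → K)) (g : Equiv.Perm (Fin n → K)) (c : ℕ) (x : Fin n → K) :
    Prop :=
  ∃ b, c.testBit b = true ∧ Wd b = some (g x)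

/-- The words in the set `c` agree with `x` outside `ts`. -/
def Agree (Wd : ℕ → Option (Fin n → K)) (ts : List (Fin n)) (c : ℕ) (x : Fin n → K) : Prop :=
  ∀ b, c.testBit b = true → ∃ v, Wd b = some v ∧ ∀ i ∉ ts, v i = x i

theorem forall₂_and {α β : Type} {P Q : α → β → Prop} {l : List α} {l' : List β}
    (h : List.Forall₂ P l l') (h' : List.Forall₂ Q l l') :
    List.Forall₂ (fun x y => P x y ∧ Q x y) l l' := by
  induction h with
  | nil => exact List.Forall₂.nil
  | cons h1 _ ih =>
    cases h'
    exact List.Forall₂.cons ⟨h1, ‹_›⟩ (ih ‹_›)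

/-- An isometry whose restriction to the positions of `ts` is given. -/
theorem exists_isometry_of_perm {ts : List (Fin n)} (hts : ts.Nodup) {e : Fin n → Fin n}
    (he : (ts.map e).Perm ts) (σ : Fin n → (K ≃+ K)) :
    ∃ g ∈ isometries (Fin n), g ∈ fixOutside ts ∧ ∀ t ∈ ts, Sends g t (e t) (σ t) := by
  classical
  have hmem : ∀ t ∈ ts, e t ∈ ts := fun t ht => he.subset (List.mem_map_of_mem ht)
  have hnd : (ts.map e).Nodup := he.nodup_iff.2 hts
  have hinj : Function.Injective fun i => if i ∈ ts then e i else i := by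
    intro i j hij
    by_cases hi : i ∈ ts <;> by_cases hj : j ∈ ts
    · simp only [hi, hj, if_true] at hij
      exact List.inj_on_of_nodup_map hnd hi hj hij
    · simp only [hi, hj, if_true, if_false] at hij
      exact absurd (hij ▸ hmem i hi) hj
    · simp only [hi, hj, if_true, if_false] at hij
      exact absurd (hij ▸ hmem j hj) hi
    · simpa only [hi, hj, if_false] using hij
  obtain ⟨g, hg, h⟩ := isometry_of_equiv
    (Equiv.ofBijective _ (Finite.injective_iff_bijective.1 hinj))
    fun t => if t ∈ ts then σ t else AddEquiv.refl K
  refine ⟨g, hg, fun i hi x => ?_, fun t ht x => ?_⟩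
  · simpa [hi] using h i x
  · simpa [ht] using h t x

/-- The positions outside `ts` are mapped to themselves, so injectivity leaves only `ts` for the
images of `ts`. -/
theorem perm_of_fixOutside {ts : List (Fin n)} (hts : ts.Nodup) {g : Equiv.Perm (Fin n → K)}
    (hg : g ∈ fixOutside ts) {e : Fin n ≃ Fin n} {σ : Fin n → (K ≃+ K)}
    (h : ∀ t, Sends g t (e t) (σ t)) : (ts.map e).Perm ts := by
  have hfix : ∀ i ∉ ts, e i = i := by
    intro i hi
    obtain ⟨s, hs⟩ := e.surjective i
    have : s = i := (frame_unique (ρ := σ s) (ρ' := AddEquiv.refl K) fun x => by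
      rw [← h s x, hs, hg i hi x]; rfl).1
    rw [← this, hs, this]
  refine ((List.subperm_of_subset (hts.map e.injective) ?_).perm_of_length_le (by simp))
  intro j hj
  obtain ⟨t, ht, rfl⟩ := List.mem_map.1 hj
  by_contra hjt
  exact hjt ((e.injective (hfix _ hjt)).symm ▸ ht)

/-- A matching controls a word only on `t :: ts`. By `hA` every candidate already agrees with `x`
elsewhere, so a matched candidate is the whole image of `x`; by `hB` such images characterize the
elements of `H`. -/
theorem continues_iff_exists {Wd : ℕ → Option (Fin n → K)} {R : Fin n → Masks}
    (hR : ∀ j k b, ((R j).get (num k)).testBit b = true ↔ ∃ v, Wd b = some v ∧ v j = k)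
    {H : Subgroup (Equiv.Perm (Fin n → K))} {t : Fin n} {ts : List (Fin n)}
    (hts : (t :: ts).Nodup) (hH : H ≤ isometries (Fin n)) (hHt : H ≤ fixOutside (t :: ts))
    {X : List (Fin n → K)} {cs : List ℕ} (hA : List.Forall₂ (Agree Wd (t :: ts)) cs X)
    (hB : ∀ g ∈ isometries (Fin n), g ∈ fixOutside (t :: ts) →
      (g ∈ H ↔ List.Forall₂ (MapsInto Wd g) cs X))
    {p : Fin n × List (Fin n)} (hp : p ∈ splits (t :: ts)) (ρ : K ≃+ K) :
    continues (ts.map fun t => X.map fun x => num (x t)) (X.map fun x => num (x t))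
        ((R p.1).permute ρ) (p.2.map R) cs = true ↔ ∃ h ∈ H, Sends h t p.1 ρ := by
  rw [continues_spec hR hts X (t :: ts) cs rfl hp]
  constructor
  · rintro ⟨e, σ, het, hσ, he, h⟩
    obtain ⟨g, hg, hgf, hgs⟩ := exists_isometry_of_perm hts he σ
    refine ⟨g, (hB g hg hgf).2 ((forall₂_and hA h).imp ?_), ?_⟩
    · rintro c x ⟨h1, b, hb, h2⟩
      refine ⟨b, hb, ?_⟩
      obtain ⟨v, hv, hvx⟩ := h1 b hb
      rw [hv, Option.some.injEq]
      funext i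
      by_cases hi : i ∈ t :: ts
      · obtain ⟨s, hs, rfl⟩ := List.mem_map.1 (he.symm.subset hi)
        obtain ⟨v', hv', h3⟩ := h2 s hs
        rw [hv, Option.some.injEq] at hv'
        rw [hv', h3, hgs s hs x]
      · rw [hvx i hi, hgf i hi x]
    · rw [← het, ← hσ]
      exact hgs t List.mem_cons_self
  · rintro ⟨g, hg, hgt⟩
    obtain ⟨e, σ, h⟩ := exists_sends (hH hg)
    obtain ⟨h1, h2⟩ := (h t).unique_target (hH hg) hgt
    refine ⟨e, σ, h1, h2, perm_of_fixOutside hts (hHt hg) h, ?_⟩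
    refine ((hB g (hH hg) (hHt hg)).1 hg).imp ?_
    rintro c x ⟨b, hb, hbx⟩
    exact ⟨b, hb, fun s _ => ⟨_, hbx, h s x⟩⟩

theorem count_eq {Wd : ℕ → Option (Fin n → K)} {R : Fin n → Masks}
    (hR : ∀ j k b, ((R j).get (num k)).testBit b = true ↔ ∃ v, Wd b = some v ∧ v j = k)
    {H : Subgroup (Equiv.Perm (Fin n → K))} {t : Fin n} {ts : List (Fin n)}
    (hts : (t :: ts).Nodup) (hH : H ≤ isometries (Fin n)) (hHt : H ≤ fixOutside (t :: ts))
    {X : List (Fin n → K)} {cs : List ℕ} (hA : List.Forall₂ (Agree Wd (t :: ts)) cs X)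
    (hB : ∀ g ∈ isometries (Fin n), g ∈ fixOutside (t :: ts) →
      (g ∈ H ↔ List.Forall₂ (MapsInto Wd g) cs X)) :
    count (ts.map fun t => X.map fun x => num (x t)) (X.map fun x => num (x t))
      ((t :: ts).map R) cs = (H ⊓ fixOutside ts).relIndex H := by
  classical
  rw [relIndex_fix hH (List.nodup_cons.1 hts).1 hHt, count, splits_map, List.map_map]
  have h1 : (splits (t :: ts)).map ((fun p => p.1.variants.countP fun m =>
      continues (ts.map fun t => X.map fun x => num (x t)) (X.map fun x => num (x t)) m p.2 cs) ∘
        fun p => (R p.1, p.2.map R)) = (splits (t :: ts)).map ((fun j => autsK.countP fun ρ =>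
          decide (∃ h ∈ H, Sends h t j ρ)) ∘ Prod.fst) := by
    refine List.map_congr_left fun p hp => ?_
    simp only [Function.comp_apply, Masks.variants_eq, List.countP_map]
    refine List.countP_congr fun ρ _ => ?_
    rw [Function.comp_apply, continues_iff_exists hR hts hH hHt hA hB hp, decide_eq_true_iff]
  rw [h1, ← List.map_map, map_fst_splits, ← List.sum_toFinset _ hts]
  have h2 : {p : (_ : Fin n) × (K ≃+ K) | ∃ h ∈ H, Sends h t p.1 p.2} =
      ((t :: ts).toFinset.sigma fun j => autsK.toFinset.filter fun ρ => ∃ h ∈ H, Sends h t j ρ :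
        Finset ((_ : Fin n) × (K ≃+ K))) := by
    ext p
    simp only [Set.mem_ofPred_eq, Finset.coe_sigma, Set.mem_sigma_iff, Finset.mem_coe,
      List.mem_toFinset, Finset.mem_filter, mem_autsK, true_and]
    refine ⟨fun h => ⟨?_, h⟩, fun h => h.2⟩
    obtain ⟨g, hg, hs⟩ := h
    obtain ⟨e, σ, h⟩ := exists_sends (hH hg)
    rw [← ((h t).unique_target (hH hg) hs).1]
    exact (perm_of_fixOutside hts (hHt hg) h).subset (by simp)
  rw [h2, Set.ncard_coe_finset, Finset.card_sigma]
  refine Finset.sum_congr rfl fun j _ => ?_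
  rw [List.countP_eq_length_filter, ← List.toFinset_card_of_nodup (autsK_nodup.filter _)]
  congr 1
  ext ρ
  simp

/-- Induction along the chain of subgroups fixing more and more positions. The number of images of
the first position is an index by `count_eq`, and filtering the candidates by the unchanged symbols
at that position describes the next subgroup. -/
theorem chain_eq {Wd : ℕ → Option (Fin n → K)} {R : Fin n → Masks}
    (hR : ∀ j k b, ((R j).get (num k)).testBit b = true ↔ ∃ v, Wd b = some v ∧ v j = k)
    {H : Subgroup (Equiv.Perm (Fin n → K))} {ts : List (Fin n)}
    (hts : ts.Nodup) (hH : H ≤ isometries (Fin n)) (hHt : H ≤ fixOutside ts)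
    {X : List (Fin n → K)} {cs : List ℕ} (hA : List.Forall₂ (Agree Wd ts) cs X)
    (hB : ∀ g ∈ isometries (Fin n), g ∈ fixOutside ts →
      (g ∈ H ↔ List.Forall₂ (MapsInto Wd g) cs X)) :
    chain (ts.map fun t => X.map fun x => num (x t)) (ts.map R) cs = Nat.card H := by
  induction ts generalizing H cs with
  | nil =>
    have : H = ⊥ := by
      refine (Subgroup.eq_bot_iff_forall _).2 fun g hg => ?_
      ext x : 1
      funext i
      exact hHt hg i (by simp) x
    rw [this, Subgroup.card_bot]
    rfl
  | cons t ts ih =>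
    have hle : fixOutside ts ≤ fixOutside (t :: ts) := fun g hg i hi x =>
      hg i (fun h => hi (List.mem_cons_of_mem _ h)) x
    rw [← card_mul_relIndex (inf_le_left : H ⊓ fixOutside ts ≤ H),
      ← count_eq hR hts hH hHt hA hB, mul_comm]
    -- Each `x` is a candidate for itself, since the identity lies in `H`. So no set becomes empty,
    -- and the default value `0` in `chain` is never taken. The same application shows that the new
    -- candidates agree with `x` at `t` too.
    have h1 := (step_spec (R t) (fun x : Fin n → K => num (x t)) (fun c x => Agree Wd ts c x ∧
      c ≠ 0) (fun x => by simp) X cs).2 ?_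
    · obtain ⟨cs', h2, h3⟩ := h1
      rw [List.map_cons, List.map_cons, chain, h2]
      congr 1
      refine ih (List.nodup_cons.1 hts).2 (inf_le_left.trans hH) inf_le_right
        (h3.imp fun c x h => h.1) ?_
      intro g hg hgf
      rw [Subgroup.mem_inf, and_iff_left hgf, hB g hg (hle hgf)]
      have h4 := step_spec (R t) (fun x : Fin n → K => num (x t)) (MapsInto Wd g)
        (fun x => by rintro ⟨b, hb, -⟩; simp at hb) X cs
      rw [h2] at h4
      simp only [Option.some.injEq, exists_eq_left'] at h4
      rw [h4]
      refine iff_of_eq (congrArg (fun P => List.Forall₂ P cs X) ?_)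
      funext c x
      simp only [MapsInto, Nat.testBit_and, Bool.and_eq_true, hR, eq_iff_iff]
      refine exists_congr fun b => ?_
      constructor
      · rintro ⟨h5, h6⟩
        exact ⟨⟨h5, _, h6, hgf t (List.nodup_cons.1 hts).1 x⟩, h6⟩
      · exact fun h => ⟨h.1.1, h.2⟩
    · have h1 := (hB 1 (one_mem _) (one_mem _)).1 (one_mem _)
      refine (forall₂_and hA h1).imp ?_
      rintro c x ⟨h2, b, hb, h3⟩
      have hbt : (c &&& (R t).get (num (x t))).testBit b = true := by
        rw [Nat.testBit_and, Bool.and_eq_true, hR]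
        exact ⟨hb, _, h3, rfl⟩
      refine ⟨?_, fun h => by rw [h] at hbt; simp at hbt⟩
      intro b' hb'
      rw [Nat.testBit_and, Bool.and_eq_true, hR] at hb'
      obtain ⟨h4, v, hv, hvt⟩ := hb'
      obtain ⟨v', hv', h5⟩ := h2 b' h4
      rw [hv, Option.some.injEq] at hv'
      subst hv'
      refine ⟨v, hv, fun i hi => ?_⟩
      by_cases hit : i = t
      · rw [hit, hvt]
      · exact h5 i (by simp [hit, hi])

end chain

/-! ### Weights and isometries -/

/-- The number of nonzero digits among the first `n` digits. -/
noncomputable def weight : ℕ → ℕ → ℕ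
  | 0, _ => 0
  | Nat.succ n, w => Nat.add (weight n w) (Nat.rec 0 (fun _ _ => 1) (dig w n))

theorem weight_succ (n w : ℕ) : weight (n + 1) w = weight n w + if dig w n ≠ 0 then 1 else 0 := by
  have h : weight (n + 1) w = weight n w + Nat.rec 0 (fun _ _ => 1) (dig w n) := rfl
  rw [h]
  cases dig w n <;> simp

theorem weight_eq_countP (n w : ℕ) : weight n w = (List.range n).countP fun i => dig w i ≠ 0 := by
  induction n with
  | zero => rfl
  | succ n ih => simp [weight_succ, ih, List.range_succ, List.countP_cons]

theorem wt_dec (n w : ℕ) : wt (dec n w) = weight n w := by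
  induction n with
  | zero => rfl
  | succ n ih =>
    rw [weight_succ, ← ih]
    simp only [hammingNorm, Finset.card_filter, Fin.sum_univ_castSucc]
    congr 1
    simp [dec, sym_eq_zero (dig_lt w n)]

theorem wt_monomial {ι κ : Type} [Fintype ι] [Fintype κ] (e : κ ≃ ι) (σ : κ → (K ≃+ K))
    (x : ι → K) : wt (monomial e σ x) = wt x := by
  simp only [hammingNorm]
  refine Finset.card_bij (fun j _ => e j) ?_ ?_ ?_
  · intro j hj
    simpa [monomial] using hj
  · intro i _ j _ h
    exact e.injective h
  · intro i hi
    exact ⟨e.symm i, by simpa [monomial] using hi, by simp⟩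

theorem wt_isometry {n : ℕ} {g : Equiv.Perm (Fin n → K)} (hg : g ∈ isometries (Fin n))
    (x : Fin n → K) : wt (g x) = wt x := by
  obtain ⟨e, σ, rfl⟩ := hg
  exact wt_monomial e σ x

theorem isometry_add {ι : Type} {g : Equiv.Perm (ι → K)} (hg : g ∈ isometries ι) (x y : ι → K) :
    g (x + y) = g x + g y := by
  obtain ⟨e, σ, rfl⟩ := hg
  exact map_add (monomial e σ) x y

theorem isometry_zero {ι : Type} {g : Equiv.Perm (ι → K)} (hg : g ∈ isometries ι) :
    g 0 = 0 := by
  obtain ⟨e, σ, rfl⟩ := hg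
  exact map_zero (monomial e σ)

/-- The homomorphism given by an isometry. -/
def isometryHom {ι : Type} {g : Equiv.Perm (ι → K)} (hg : g ∈ isometries ι) :
    (ι → K) →+ (ι → K) where
  toFun := g
  map_zero' := isometry_zero hg
  map_add' := isometry_add hg

/-- Isometries are additive, so only the generators need to be tested. -/
theorem isometry_maps_codeOf {n : ℕ} {g : Equiv.Perm (Fin n → K)} (hg : g ∈ isometries (Fin n))
    {gens : List ℕ} {C : Code (Fin n)} (h : ∀ w ∈ gens, g (dec n w) ∈ C) :
    ∀ x ∈ codeOf n gens, g x ∈ C := by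
  have : codeOf n gens ≤ C.comap (isometryHom hg) := codeOf_le.2 h
  exact this

/-- An injective map of a finite set into itself is onto. -/
theorem smul_set_eq_iff {n : ℕ} {g : Equiv.Perm (Fin n → K)} {C : Set (Fin n → K)} :
    g • C = C ↔ ∀ x ∈ C, g x ∈ C := by
  constructor
  · intro h x hx
    rw [← h]
    exact Set.smul_mem_smul_set hx
  · intro h
    refine Set.eq_of_subset_of_ncard_le ?_ ?_ (Set.toFinite _)
    · rintro _ ⟨x, hx, rfl⟩
      exact h x hx
    · exact (Set.ncard_image_of_injective C g.injective).ge

theorem mem_autGroup {n : ℕ} {g : Equiv.Perm (Fin n → K)} {C : Code (Fin n)} :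
    g ∈ autGroup C ↔ g ∈ isometries (Fin n) ∧ ∀ x ∈ C, g x ∈ C := by
  rw [autGroup, Subgroup.mem_inf, MulAction.mem_stabilizer_iff, smul_set_eq_iff]
  rfl

/-! ### Searching in the sums of a list of words -/

/-- The word at a given place in the list of the sums of the given words. -/
def wordAt (n : ℕ) (gens : List ℕ) (b : ℕ) : Option (Fin n → K) := ((words gens)[b]?).map (dec n)

theorem wordAt_rowMasks (n : ℕ) (gens : List ℕ) (j : Fin n) (k : K) (b : ℕ) :
    ((rowMasks j gens).get (num k)).testBit b = true ↔
      ∃ v, wordAt n gens b = some v ∧ v j = k := by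
  rw [testBit_rowMasks _ _ (num_lt k)]
  simp only [wordAt, Option.map_eq_some_iff]
  constructor
  · rintro ⟨w, hw, h⟩
    exact ⟨_, ⟨w, hw, rfl⟩, by rw [dec, h, sym_num]⟩
  · rintro ⟨_, ⟨w, hw, rfl⟩, rfl⟩
    exact ⟨w, hw, (num_dec n w j).symm⟩

theorem map_range_eq {α : Type} (n : ℕ) (f : ℕ → α) :
    (List.range n).map f = (List.finRange n).map fun i : Fin n => f i := by
  rw [← List.map_coe_finRange_eq_range, List.map_map]
  rfl

/-- The symbols of the given words, for each position. -/
def levels (n : ℕ) (xs : List ℕ) : List (List ℕ) :=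
  (List.range n).map fun t => xs.map fun x => dig x t

theorem levels_eq (n : ℕ) (xs : List ℕ) :
    levels n xs = (List.finRange n).map fun t => (xs.map (dec n)).map fun x => num (x t) := by
  rw [levels, map_range_eq]
  simp [num_dec, Function.comp_def]

/-- The sets of the sums of the given words which have the same weight as one of the words `xs`. -/
noncomputable def weightCandidates (n : ℕ) (gens xs : List ℕ) (rows : List Masks) : List ℕ :=
  xs.map fun x => (weightMasks (Nat.pow 2 gens.length) rows).getD (weight n x) 0

theorem testBit_weightCandidates (n : ℕ) (gens : List ℕ) (x b : ℕ) :
    ((weightMasks (Nat.pow 2 gens.length) ((List.range n).map fun i => rowMasks i gens)).getD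
      (weight n x) 0).testBit b = true ↔
      ∃ v, wordAt n gens b = some v ∧ wt v = wt (dec n x) := by
  have h : Nat.pow 2 gens.length = (words gens).length := (length_words gens).symm
  rw [h, testBit_weightMasks]
  simp only [wordAt, Option.map_eq_some_iff]
  constructor
  · rintro ⟨w, hw, h⟩
    exact ⟨_, ⟨w, hw, rfl⟩, by rw [wt_dec, wt_dec, ← h, weight_eq_countP]⟩
  · rintro ⟨_, ⟨w, hw, rfl⟩, h⟩
    exact ⟨w, hw, by rw [← weight_eq_countP, ← wt_dec, ← wt_dec, h]⟩

theorem exists_wordAt {n : ℕ} {gens : List ℕ} {x : Fin n → K} :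
    x ∈ codeOf n gens ↔ ∃ b, wordAt n gens b = some x := by
  simp only [mem_codeOf, wordAt, Option.map_eq_some_iff]
  constructor
  · rintro ⟨w, hw, h⟩
    obtain ⟨b, hb⟩ := List.getElem?_of_mem hw
    exact ⟨b, w, hb, h⟩
  · rintro ⟨b, w, hb, h⟩
    exact ⟨w, List.mem_of_getElem? hb, h⟩

/-- Evaluates a search for isometries which carry the words `xs` to sums of the words `gens`. -/
def withData {α : Type} (n : ℕ) (gens xs : List ℕ) (cands : List Masks → List ℕ)
    (f : List (List ℕ) → List Masks → List ℕ → α) : α :=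
  forceMasks ((List.range n).map fun i => rowMasks i gens) fun rows =>
    forceLists (levels n xs) fun lv => forceList (cands rows) fun cs => f lv rows cs

theorem withData_eq {α : Type} (n : ℕ) (gens xs : List ℕ) (cands : List Masks → List ℕ)
    (f : List (List ℕ) → List Masks → List ℕ → α) : withData n gens xs cands f =
      f ((List.finRange n).map fun t => (xs.map (dec n)).map fun x => num (x t))
        ((List.finRange n).map fun i : Fin n => rowMasks i gens)
        (cands ((List.range n).map fun i => rowMasks i gens)) := by
  rw [withData, forceMasks_eq, forceLists_eq, forceList_eq, levels_eq, map_range_eq]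

/-- Isometries preserve weights, so admitting only candidates of the weight of `x` excludes no
image; it serves to prune the search. -/
theorem mapsInto_weightCandidates {n : ℕ} {gens xs : List ℕ} {g : Equiv.Perm (Fin n → K)}
    (hg : g ∈ isometries (Fin n)) :
    List.Forall₂ (MapsInto (wordAt n gens) g)
      (weightCandidates n gens xs ((List.range n).map fun i => rowMasks i gens))
      (xs.map (dec n)) ↔ ∀ x ∈ xs, g (dec n x) ∈ codeOf n gens := by
  rw [weightCandidates, List.forall₂_map_left_iff, List.forall₂_map_right_iff, List.forall₂_same]
  refine forall₂_congr fun x _ => ?_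
  simp only [MapsInto, testBit_weightCandidates, exists_wordAt]
  refine exists_congr fun b => ⟨fun h => h.2, fun h => ⟨⟨_, h, wt_isometry hg _⟩, h⟩⟩

/-- The order of the automorphism group of the code generated by the given words. -/
noncomputable def autOrder (n : ℕ) (gens : List ℕ) : ℕ :=
  withData n gens gens (weightCandidates n gens gens) chain

/-- The chain starts with all positions free, so the conditions on positions outside the list are
vacuous. -/
theorem card_autGroup (n : ℕ) (gens : List ℕ) :
    Nat.card (autGroup (codeOf n gens)) = autOrder n gens := by
  rw [autOrder, withData_eq]
  refine (chain_eq (wordAt_rowMasks n gens) (List.nodup_finRange n)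
    (fun g hg => (mem_autGroup.1 hg).1) (fun g _ i hi => absurd (List.mem_finRange i) hi)
    ?_ ?_).symm
  · rw [weightCandidates, List.forall₂_map_left_iff, List.forall₂_map_right_iff, List.forall₂_same]
    intro x _ b hb
    obtain ⟨v, hv, -⟩ := (testBit_weightCandidates n gens x b).1 hb
    exact ⟨v, hv, fun i hi => absurd (List.mem_finRange i) hi⟩
  · intro g hg _
    rw [mapsInto_weightCandidates hg, mem_autGroup]
    exact ⟨fun h x hx => h.2 _ (dec_mem_codeOf hx), fun h => ⟨hg, isometry_maps_codeOf hg h⟩⟩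

/-- Decides whether an isometry carries the code generated by `gens` into the one generated by
`gens'`. -/
noncomputable def embeds (n : ℕ) (gens gens' : List ℕ) : Bool :=
  withData n gens' gens (weightCandidates n gens' gens) search

theorem embeds_iff (n : ℕ) (gens gens' : List ℕ) : embeds n gens gens' = true ↔
    ∃ g ∈ isometries (Fin n), ∀ x ∈ codeOf n gens, g x ∈ codeOf n gens' := by
  rw [embeds, withData_eq, search_spec (wordAt_rowMasks n gens') (List.nodup_finRange n) _ _ _ rfl
    (by simp [weightCandidates])]
  constructor
  · rintro ⟨e, σ, he, h⟩
    obtain ⟨g, hg, -, hs⟩ := exists_isometry_of_perm (List.nodup_finRange n) he σ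
    refine ⟨g, hg, isometry_maps_codeOf hg ((mapsInto_weightCandidates hg).1 ?_)⟩
    rw [weightCandidates, List.forall₂_map_left_iff, List.forall₂_map_right_iff,
      List.forall₂_same] at h ⊢
    intro x hx
    obtain ⟨b, hb, hb'⟩ := h x hx
    refine ⟨b, hb, ?_⟩
    obtain ⟨v, hv, -⟩ := (testBit_weightCandidates n gens' x b).1 hb
    rw [hv, Option.some.injEq]
    funext j
    obtain ⟨t, -, rfl⟩ := List.mem_map.1 (he.symm.subset (List.mem_finRange j))
    obtain ⟨v', hv', h1⟩ := hb' t (List.mem_finRange t)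
    rw [hv, Option.some.injEq] at hv'
    rw [hv', h1, hs t (List.mem_finRange t)]
  · rintro ⟨g, hg, h⟩
    obtain ⟨e, σ, hs⟩ := exists_sends hg
    refine ⟨e, σ, perm_of_fixOutside (List.nodup_finRange n)
      (fun i hi => absurd (List.mem_finRange i) hi) hs, ?_⟩
    refine ((mapsInto_weightCandidates hg).2 fun x hx => h _ (dec_mem_codeOf hx)).imp ?_
    rintro c x ⟨b, hb, hb'⟩
    exact ⟨b, hb, fun t _ => ⟨_, hb', hs t x⟩⟩

/-- The order of the group of all isometries of `K^n`. -/
noncomputable def isometriesOrder (n : ℕ) : ℕ := withData n [] [] (fun _ => []) chain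

/-- With no words to carry along, every choice survives the search. -/
theorem card_isometries (n : ℕ) : Nat.card (isometries (Fin n)) = isometriesOrder n := by
  rw [isometriesOrder, withData_eq]
  exact (chain_eq (wordAt_rowMasks n []) (List.nodup_finRange n) le_rfl
    (fun g _ i hi => absurd (List.mem_finRange i) hi) List.Forall₂.nil
    fun g hg _ => ⟨fun _ => List.Forall₂.nil, fun _ => hg⟩).symm

/-! ### Membership tests -/

/-- The set of the numbers in a list. -/
def bitmap : List ℕ → ℕ
  | [] => 0
  | w :: ws => Nat.lor (Nat.shiftLeft 1 w) (bitmap ws)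

/-- Membership in a set of numbers. -/
def inSet (B w : ℕ) : Bool := Nat.beq (Nat.land (Nat.shiftRight B w) 1) 1

theorem inSet_bitmap (l : List ℕ) (w : ℕ) : inSet (bitmap l) w = true ↔ w ∈ l := by
  have h : ∀ B, inSet B w = true ↔ B.testBit w = true := by
    intro B
    have e : inSet B w = Nat.beq ((B >>> w) &&& 1) 1 := rfl
    rw [e, Nat.testBit_eq_decide_div_mod_eq, Nat.and_one_is_mod, Nat.shiftRight_eq_div_pow,
      decide_eq_true_iff]
    exact Nat.beq_eq ▸ Iff.rfl
  rw [h]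
  induction l with
  | nil => simp [bitmap]
  | cons v l ih =>
    have e : bitmap (v :: l) = (1 <<< v) ||| bitmap l := rfl
    have h1 : (1 <<< v).testBit w = true ↔ w = v := by
      rw [Nat.testBit_shiftLeft, Bool.and_eq_true, decide_eq_true_iff,
        Nat.testBit_one_eq_true_iff_self_eq_zero]
      omega
    rw [e, Nat.testBit_or, Bool.or_eq_true, h1, List.mem_cons]
    exact or_congr_right ih

theorem dec_mem_iff {n : ℕ} {gens : List ℕ} (hg : ∀ g ∈ gens, g < 4 ^ n) {w : ℕ} (hw : w < 4 ^ n) :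
    dec n w ∈ codeOf n gens ↔ inSet (bitmap (words gens)) w = true := by
  rw [inSet_bitmap, mem_codeOf]
  refine ⟨?_, fun h => ⟨w, h, rfl⟩⟩
  rintro ⟨v, hv, h⟩
  rwa [← dec_injOn (words_lt hg v hv) hw h]

/-- The candidates for the images of words under automorphisms which fix the codes generated by
`parts` and their cosets. -/
noncomputable def cosetCandidates (gens : List ℕ) (parts : List (List ℕ)) : List ℕ :=
  force (bitmap (words parts.flatten)) (fun B =>
    gens.map fun x => maskOf (fun w => inSet B (Nat.xor w x)) (words gens)) ++
  parts.flatMap fun p => force (bitmap (words p)) fun B =>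
    p.map fun _ => maskOf (fun w => inSet B w) (words gens)

/-- The order of the group of isometries which fix the codes generated by `parts` and all the
cosets of their sum in the code generated by `gens`. -/
noncomputable def cosetFixOrder (n : ℕ) (gens : List ℕ) (parts : List (List ℕ)) : ℕ :=
  withData n gens (gens ++ parts.flatten) (fun _ => cosetCandidates gens parts) chain

theorem xor_lt {n v w : ℕ} (hv : v < 4 ^ n) (hw : w < 4 ^ n) : Nat.xor v w < 4 ^ n := by
  have e : (4 : ℕ) ^ n = 2 ^ (2 * n) := by rw [pow_mul]; norm_num
  rw [e] at hv hw ⊢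
  exact Nat.xor_lt_two_pow hv hw

theorem forall₂_append_iff {α β : Type} {P : α → β → Prop} {l l' : List α} {m m' : List β}
    (h : l.length = m.length) : List.Forall₂ P (l ++ l') (m ++ m') ↔
      List.Forall₂ P l m ∧ List.Forall₂ P l' m' := by
  induction l generalizing m with
  | nil =>
    obtain rfl : m = [] := List.length_eq_zero_iff.1 h.symm
    simp
  | cons x l ih =>
    cases m with
    | nil => simp at h
    | cons y m => simp [ih (m := m) (by simpa using h), and_assoc]

/-- Each condition on `g` says that the image of one given word lies in a given set of codewords: a
coset of the sum of the parts for a generator, a part for a generator of that part. This is the form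
of group that `chain_eq` counts; `hle` ensures that all these sets consist of words of the code. -/
theorem card_cosetFix {n : ℕ} {gens : List ℕ} {parts : List (List ℕ)}
    (hgens : ∀ g ∈ gens, g < 4 ^ n) (hparts : ∀ p ∈ parts, ∀ g ∈ p, g < 4 ^ n)
    (hle : ∀ p ∈ parts, codeOf n p ≤ codeOf n gens) {H : Subgroup (Equiv.Perm (Fin n → K))}
    (hH : H ≤ isometries (Fin n)) (hHg : ∀ g ∈ isometries (Fin n), g ∈ H ↔
      (∀ x ∈ gens, g (dec n x) + dec n x ∈ codeOf n parts.flatten) ∧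
        ∀ p ∈ parts, ∀ x ∈ p, g (dec n x) ∈ codeOf n p) :
    Nat.card H = cosetFixOrder n gens parts := by
  have hpf : ∀ g ∈ parts.flatten, g < 4 ^ n := by
    intro g hg
    obtain ⟨p, hp, hgp⟩ := List.mem_flatten.1 hg
    exact hparts p hp g hgp
  have hfl : codeOf n parts.flatten ≤ codeOf n gens := by
    refine codeOf_le.2 fun g hg => ?_
    obtain ⟨p, hp, hgp⟩ := List.mem_flatten.1 hg
    exact hle p hp (dec_mem_codeOf hgp)
  have h1 : ∀ x < 4 ^ n, ∀ b, (maskOf (fun w => inSet (bitmap (words parts.flatten)) (Nat.xor w x))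
      (words gens)).testBit b = true ↔
        ∃ v, wordAt n gens b = some v ∧ v + dec n x ∈ codeOf n parts.flatten := by
    intro x hx b
    rw [testBit_maskOf]
    simp only [wordAt, Option.map_eq_some_iff]
    constructor
    · rintro ⟨w, hw, h⟩
      refine ⟨_, ⟨w, hw, rfl⟩, ?_⟩
      rw [← dec_xor, dec_mem_iff hpf (xor_lt (words_lt hgens w (List.mem_of_getElem? hw)) hx)]
      exact h
    · rintro ⟨_, ⟨w, hw, rfl⟩, h⟩
      refine ⟨w, hw, ?_⟩
      rwa [← dec_xor, dec_mem_iff hpf (xor_lt (words_lt hgens w (List.mem_of_getElem? hw)) hx)] at h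
  have h2 : ∀ p ∈ parts, ∀ b, (maskOf (fun w => inSet (bitmap (words p)) w)
      (words gens)).testBit b = true ↔ ∃ v, wordAt n gens b = some v ∧ v ∈ codeOf n p := by
    intro p hp b
    rw [testBit_maskOf]
    simp only [wordAt, Option.map_eq_some_iff]
    constructor
    · rintro ⟨w, hw, h⟩
      refine ⟨_, ⟨w, hw, rfl⟩, ?_⟩
      rwa [dec_mem_iff (hparts p hp) (words_lt hgens w (List.mem_of_getElem? hw))]
    · rintro ⟨_, ⟨w, hw, rfl⟩, h⟩
      refine ⟨w, hw, ?_⟩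
      rwa [dec_mem_iff (hparts p hp) (words_lt hgens w (List.mem_of_getElem? hw))] at h
  have key : ∀ P : ℕ → (Fin n → K) → Prop, List.Forall₂ P (cosetCandidates gens parts)
      ((gens ++ parts.flatten).map (dec n)) ↔
      (∀ x ∈ gens, P (maskOf (fun w => inSet (bitmap (words parts.flatten)) (Nat.xor w x))
        (words gens)) (dec n x)) ∧
      ∀ p ∈ parts, ∀ x ∈ p, P (maskOf (fun w => inSet (bitmap (words p)) w) (words gens))
        (dec n x) := by
    intro P
    rw [cosetCandidates, force_eq, List.map_append, forall₂_append_iff (by simp),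
      List.forall₂_map_left_iff, List.forall₂_map_right_iff, List.forall₂_same]
    refine and_congr Iff.rfl ?_
    clear hle hHg hpf hfl h1 h2 hparts
    induction parts with
    | nil => simp
    | cons p parts ih =>
      rw [List.flatMap_cons, List.flatten_cons, List.map_append, force_eq,
        forall₂_append_iff (by simp), ih, List.forall₂_map_left_iff, List.forall₂_map_right_iff,
        List.forall₂_same]
      simp
  rw [cosetFixOrder, withData_eq]
  refine (chain_eq (wordAt_rowMasks n gens) (List.nodup_finRange n) hH
    (fun g _ i hi => absurd (List.mem_finRange i) hi) ?_ ?_).symm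
  · rw [key]
    constructor
    · intro x hx b hb
      obtain ⟨v, hv, -⟩ := (h1 x (hgens x hx) b).1 hb
      exact ⟨v, hv, fun i hi => absurd (List.mem_finRange i) hi⟩
    · intro p hp x _ b hb
      obtain ⟨v, hv, -⟩ := (h2 p hp b).1 hb
      exact ⟨v, hv, fun i hi => absurd (List.mem_finRange i) hi⟩
  · intro g hg _
    rw [key, hHg g hg]
    refine and_congr (forall₂_congr fun x hx => ?_) (forall₂_congr fun p hp => forall₂_congr
      fun x hx => ?_)
    · simp only [MapsInto, h1 x (hgens x hx)]
      constructor
      · intro h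
        -- The image differs from a codeword by a word of the parts, hence is a codeword and appears
        -- in the list.
        have h3 : g (dec n x) ∈ codeOf n gens := by
          have := add_mem (hfl h) (dec_mem_codeOf hx)
          rwa [add_assoc, add_self_word, add_zero] at this
        obtain ⟨b, hb⟩ := exists_wordAt.1 h3
        exact ⟨b, ⟨_, hb, h⟩, hb⟩
      · rintro ⟨b, ⟨v, hv, hvx⟩, hb⟩
        rw [hv, Option.some.injEq] at hb
        rwa [← hb]
    · simp only [MapsInto, h2 p hp]
      constructor
      · intro h
        obtain ⟨b, hb⟩ := exists_wordAt.1 (hle p hp h)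
        exact ⟨b, ⟨_, hb, h⟩, hb⟩
      · rintro ⟨b, ⟨v, hv, hvx⟩, hb⟩
        rw [hv, Option.some.injEq] at hb
        rwa [← hb]

/-! ### Duality -/

section duality

variable {ι : Type} [Fintype ι]

theorem wt_cast (x : ι → K) : (wt x : ZMod 2) = ∑ i, if x i ≠ 0 then 1 else 0 := by
  rw [wt, hammingNorm, Finset.card_filter]
  push_cast
  rfl

/-- This holds entry by entry. It makes the scalar product a function of weights, so that isometries
preserve it and even codes are self-orthogonal. -/
theorem scalar_eq_wt (x y : ι → K) :
    scalar x y = (wt x : ZMod 2) + (wt y : ZMod 2) + (wt (x + y) : ZMod 2) := by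
  have h : ∀ k l : K, dot k l = (if k ≠ 0 then 1 else 0) + (if l ≠ 0 then 1 else 0) +
    (if k + l ≠ 0 then 1 else 0) := by decide
  simp only [scalar, wt_cast, h, Finset.sum_add_distrib, Pi.add_apply]

theorem scalar_comm (x y : ι → K) : scalar x y = scalar y x := by
  rw [scalar_eq_wt, scalar_eq_wt, add_comm x y]
  ring

theorem scalar_add_left (x x' y : ι → K) : scalar (x + x') y = scalar x y + scalar x' y := by
  simp [scalar, dot_add_left, Finset.sum_add_distrib]

theorem scalar_add_right (x y y' : ι → K) : scalar x (y + y') = scalar x y + scalar x y' := by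
  rw [scalar_comm, scalar_add_left, scalar_comm y, scalar_comm y']

theorem scalar_zero_left (y : ι → K) : scalar 0 y = 0 := by
  simp [scalar, dot_zero_left]

theorem mem_dual {C : Code ι} {x : ι → K} : x ∈ dual C ↔ ∀ y ∈ C, scalar x y = 0 := Iff.rfl

theorem even_wt_iff (x : ι → K) : Even (wt x) ↔ (wt x : ZMod 2) = 0 :=
  (ZMod.natCast_eq_zero_iff_even).symm

theorem IsEven.le_dual {C : Code ι} (h : IsEven C) : C ≤ dual C := by
  intro x hx y hy
  rw [scalar_eq_wt, (even_wt_iff _).1 (h x hx), (even_wt_iff _).1 (h y hy),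
    (even_wt_iff _).1 (h _ (add_mem hx hy))]
  rfl

/-- The nontrivial character of the group of order two. -/
def chi (z : ZMod 2) : ℤ := if z = 0 then 1 else -1

theorem chi_add : ∀ y z : ZMod 2, chi (y + z) = chi y * chi z := by decide

theorem chi_ne_zero {z : ZMod 2} (h : z ≠ 0) : chi z = -1 := if_neg h

-- Orthogonality of characters: if some `u` in `C` is not orthogonal to `v`, translation by `u`
-- reverses the sign of the sum.
open Classical in
theorem sum_chi_scalar (C : Code ι) (v : ι → K) :
    ∑ u : C, chi (scalar (u : ι → K) v) = if v ∈ dual C then (Nat.card C : ℤ) else 0 := by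
  split_ifs with h
  · have : ∀ u : C, chi (scalar (u : ι → K) v) = 1 := by
      intro u
      rw [scalar_comm, h u u.2]
      rfl
    simp [this]
  · rw [mem_dual] at h
    push Not at h
    obtain ⟨u, hu, hvu⟩ := h
    have h1 := Fintype.sum_equiv (Equiv.addLeft (⟨u, hu⟩ : C))
      (fun w : C => chi (scalar (u + (w : ι → K)) v)) (fun w : C => chi (scalar (w : ι → K) v))
      (fun w => rfl)
    simp only [scalar_add_left, chi_add, ← Finset.mul_sum] at h1
    rw [scalar_comm, chi_ne_zero hvu] at h1
    linarith

theorem eq_zero_of_scalar [DecidableEq ι] {x : ι → K} (h : ∀ y, scalar x y = 0) : x = 0 := by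
  funext i
  have h1 : ∀ k : K, (∀ l, dot k l = 0) → k = 0 := by decide
  refine h1 _ fun l => ?_
  have := h (Pi.single i l)
  rw [scalar, Finset.sum_eq_single i] at this
  · simpa using this
  · intro j _ hj
    rw [Pi.single_eq_of_ne hj]
    revert j
    have : ∀ k : K, dot k 0 = 0 := by decide
    exact fun j _ _ => this _
  · simp

-- Evaluate the double sum of (-1)^{u·v} in both orders. Summation over `u` first leaves |C| for
-- each `v` in the dual; summation over `v` first leaves only `u = 0`, because the form is
-- nondegenerate.
open Classical in
theorem card_mul_card_dual (C : Code ι) :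
    Nat.card C * Nat.card (dual C) = 4 ^ Fintype.card ι := by
  have h1 : ∑ v : ι → K, ∑ u : C, chi (scalar (u : ι → K) v) =
      (Nat.card C * Nat.card (dual C) : ℤ) := by
    simp only [sum_chi_scalar, Finset.sum_ite, Finset.sum_const_zero, add_zero, Finset.sum_const,
      nsmul_eq_mul]
    rw [mul_comm]
    congr 2
    rw [← Fintype.card_subtype, Nat.card_eq_fintype_card]
  have h2 : ∀ u : C, ∑ v : ι → K, chi (scalar (u : ι → K) v) =
      if u = 0 then (4 ^ Fintype.card ι : ℤ) else 0 := by
    intro u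
    have h3 := sum_chi_scalar (⊤ : Code ι) (u : ι → K)
    have h4 : ∑ v : ι → K, chi (scalar (u : ι → K) v) =
        ∑ v : (⊤ : Code ι), chi (scalar (v : ι → K) u) := by
      refine Fintype.sum_equiv (AddSubgroup.topEquiv.symm.toEquiv) _ _ fun v => ?_
      rw [scalar_comm]
      rfl
    rw [h4, h3]
    have h5 : (u : ι → K) ∈ dual (⊤ : Code ι) ↔ u = 0 := by
      constructor
      · intro h
        exact Subtype.ext (eq_zero_of_scalar fun y => h y trivial)
      · rintro rfl
        exact zero_mem _
    simp only [h5]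
    congr 1
    rw [Nat.card_congr AddSubgroup.topEquiv.toEquiv, Nat.card_eq_fintype_card]
    simp [K]
  rw [Finset.sum_comm] at h1
  simp only [h2, Finset.sum_ite_eq', Finset.mem_univ, if_true] at h1
  exact_mod_cast h1.symm

/-- One inclusion is symmetry of the form, and the orders agree by applying `card_mul_card_dual`
twice. -/
theorem dual_dual (C : Code ι) : dual (dual C) = C := by
  have h1 := card_mul_card_dual C
  have h2 := card_mul_card_dual (dual C)
  have hpos : 0 < Nat.card (dual C) := Nat.card_pos
  have h3 : Nat.card (dual (dual C)) = Nat.card C := by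
    refine Nat.eq_of_mul_eq_mul_left hpos ?_
    rw [h2, ← h1, mul_comm]
  symm
  refine AddSubgroup.eq_of_le_of_card_ge (fun x hx y hy => ?_) h3.le
  rw [scalar_comm]
  exact hy x hx

theorem IsSelfDual.card {C : Code ι} (h : IsSelfDual C) : Nat.card C = 2 ^ Fintype.card ι := by
  have h1 := card_mul_card_dual C
  rw [show dual C = C from h, ← sq, show (4 : ℕ) = 2 ^ 2 by norm_num, ← pow_mul, mul_comm 2,
    pow_mul] at h1
  exact Nat.pow_left_injective (n := 2) (by norm_num) h1

theorem isSelfDual_of_card {C : Code ι} (h : C ≤ dual C) (hc : 2 ^ Fintype.card ι ≤ Nat.card C) :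
    IsSelfDual C := by
  refine (AddSubgroup.eq_of_le_of_card_ge h ?_).symm
  have h1 := card_mul_card_dual C
  have hpos : 0 < 2 ^ Fintype.card ι := by positivity
  refine Nat.le_of_mul_le_mul_left (c := 2 ^ Fintype.card ι) ?_ hpos
  calc 2 ^ Fintype.card ι * Nat.card (dual C) ≤ Nat.card C * Nat.card (dual C) :=
        Nat.mul_le_mul_right _ hc
    _ = 2 ^ Fintype.card ι * 2 ^ Fintype.card ι := by
        rw [h1, ← mul_pow]; norm_num
    _ ≤ 2 ^ Fintype.card ι * Nat.card C := Nat.mul_le_mul_left _ hc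

/-- The sum factors over the positions. Each contributes 1 - 3 = -2, from one zero and three nonzero
symbols. -/
theorem sum_chi_wt [DecidableEq ι] : ∑ v : ι → K, chi (wt v) = (-2) ^ Fintype.card ι := by
  have h1 : ∀ v : ι → K, chi (wt v) = ∏ i, chi (if v i ≠ 0 then 1 else 0) := by
    intro v
    rw [wt_cast]
    have : ∀ s : Finset ι, chi (∑ i ∈ s, if v i ≠ 0 then 1 else 0) =
        ∏ i ∈ s, chi (if v i ≠ 0 then 1 else 0) := by
      intro s
      induction s using Finset.induction_on with
      | empty => rfl
      | insert i s hi ih => rw [Finset.sum_insert hi, Finset.prod_insert hi, chi_add, ih]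
    exact this _
  simp only [h1]
  have h2 := Finset.prod_univ_sum (fun _ : ι => (Finset.univ : Finset K))
    fun _ k => chi (if k ≠ 0 then 1 else 0)
  rw [Fintype.piFinset_univ] at h2
  rw [← h2, Finset.prod_const, Finset.card_univ]
  congr 1

-- Poisson summation. For `u` of even weight, (-1)^{u·v} (-1)^{wt v} = (-1)^{wt(u+v)}, so each `u`
-- in `C` contributes the full sum (-2)^n; summing over `u` first gives |C| times the sum over the
-- dual.
open Classical in
theorem sum_chi_wt_dual {C : Code ι} (h : IsEven C) :
    ∑ v : dual C, chi (wt (v : ι → K)) = (-2) ^ Fintype.card ι := by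
  have h1 : ∑ v : ι → K, ∑ u : C, chi (scalar (u : ι → K) v) * chi (wt v) =
      Nat.card C * ∑ v : dual C, chi (wt (v : ι → K)) := by
    simp only [← Finset.sum_mul, sum_chi_scalar, ite_mul, zero_mul, Finset.sum_ite,
      Finset.sum_const_zero, add_zero, ← Finset.mul_sum]
    congr 1
    exact (Finset.sum_subtype _ (by simp) _)
  have h2 : ∀ u : C, ∑ v : ι → K, chi (scalar (u : ι → K) v) * chi (wt v) =
      (-2) ^ Fintype.card ι := by
    intro u
    rw [← sum_chi_wt]
    refine Fintype.sum_equiv (Equiv.addLeft (u : ι → K)) _ _ fun v => ?_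
    rw [← chi_add, scalar_eq_wt, (even_wt_iff _).1 (h u u.2)]
    have : ∀ y z : ZMod 2, 0 + y + z + y = z := by decide
    rw [this]
    rfl
  rw [Finset.sum_comm] at h1
  simp only [h2, Finset.sum_const, Finset.card_univ, nsmul_eq_mul, Nat.card_eq_fintype_card] at h1
  have hpos : (Fintype.card C : ℤ) ≠ 0 := by
    exact_mod_cast Fintype.card_ne_zero
  exact (mul_left_cancel₀ hpos h1).symm

/-- For a self-dual even code every term of the sum over the dual is 1, so the sum cannot be
negative, whereas (-2)^n is negative for odd n. -/
theorem even_card_of_isEven_isSelfDual {C : Code ι} (h : IsEven C) (h' : IsSelfDual C) :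
    Even (Fintype.card ι) := by
  classical
  have h1 := sum_chi_wt_dual h
  by_contra hodd
  rw [Nat.not_even_iff_odd] at hodd
  have h2 : ∀ v : dual C, chi (wt (v : ι → K)) = 1 := by
    intro v
    have hv : (v : ι → K) ∈ C := (show dual C = C from h').le v.2
    rw [(even_wt_iff _).1 (h v hv)]
    rfl
  simp only [h2, hodd.neg_pow, Finset.sum_const, nsmul_eq_mul, mul_one] at h1
  have h3 : (0 : ℤ) ≤ (Finset.univ : Finset (dual C)).card := by positivity
  have h4 : (0 : ℤ) < 2 ^ Fintype.card ι := by positivity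
  linarith

end duality

/-! ### The number of even self-dual codes -/

section mass

variable {n : ℕ}

/-- The code spanned by a family of words. -/
def spanCode {k : ℕ} (f : Fin k → (Fin n → K)) : Code (Fin n) :=
  (Submodule.span (ZMod 2) (Set.range f)).toAddSubgroup

theorem card_spanCode {k : ℕ} {f : Fin k → (Fin n → K)} (hf : LinearIndependent (ZMod 2) f) :
    Nat.card (spanCode f) = 2 ^ k := by
  have h1 : Nat.card (Submodule.span (ZMod 2) (Set.range f)) =
      Nat.card (ZMod 2) ^ Module.finrank (ZMod 2) (Submodule.span (ZMod 2) (Set.range f)) :=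
    Module.natCard_eq_pow_finrank
  rw [finrank_span_eq_card hf, Fintype.card_fin, Nat.card_zmod] at h1
  exact h1

/-- A family of words is admissible if it is a basis of an even code. -/
def Admissible {k : ℕ} (f : Fin k → (Fin n → K)) : Prop :=
  LinearIndependent (ZMod 2) f ∧ IsEven (spanCode f)

theorem mem_spanCode_cons {k : ℕ} {f : Fin k → (Fin n → K)} {v x : Fin n → K} :
    x ∈ spanCode (Fin.cons v f : Fin (k + 1) → (Fin n → K)) ↔
      x ∈ spanCode f ∨ v + x ∈ spanCode f := by
  change x ∈ Submodule.span (ZMod 2) (Set.range (Fin.cons v f : Fin (k + 1) → (Fin n → K))) ↔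
    x ∈ Submodule.span (ZMod 2) (Set.range f) ∨ v + x ∈ Submodule.span (ZMod 2) (Set.range f)
  rw [Fin.range_cons, Submodule.mem_span_insert]
  constructor
  · rintro ⟨z, y, hy, rfl⟩
    have hz : ∀ z : ZMod 2, z = 0 ∨ z = 1 := by decide
    obtain rfl | rfl := hz z
    · left
      simpa using hy
    · right
      rw [one_smul, ← add_assoc, add_self_word, zero_add]
      exact hy
  · rintro (h | h)
    · exact ⟨0, x, h, by simp⟩
    · exact ⟨1, v + x, h, by rw [one_smul, ← add_assoc, add_self_word, zero_add]⟩

/-- By `scalar_eq_wt`, adjoining `v` to an even code keeps it even exactly when `v` has even weight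
and is orthogonal to the code. -/
theorem admissible_cons {k : ℕ} {f : Fin k → (Fin n → K)} {v : Fin n → K} :
    Admissible (Fin.cons v f : Fin (k + 1) → (Fin n → K)) ↔
      Admissible f ∧ v ∈ dual (spanCode f) ∧ Even (wt v) ∧ v ∉ spanCode f := by
  rw [Admissible, Admissible, linearIndependent_finCons]
  have hspan : v ∈ spanCode f ↔ v ∈ Submodule.span (ZMod 2) (Set.range f) := Iff.rfl
  rw [← hspan]
  constructor
  · rintro ⟨⟨h1, h2⟩, h3⟩
    have h4 : IsEven (spanCode f) := fun x hx => h3 x (mem_spanCode_cons.2 (Or.inl hx))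
    have h5 : v ∈ spanCode (Fin.cons v f : Fin (k + 1) → (Fin n → K)) := by
      rw [mem_spanCode_cons, add_self_word]
      exact Or.inr (zero_mem _)
    exact ⟨⟨h1, h4⟩, fun y hy => h3.le_dual h5 y (mem_spanCode_cons.2 (Or.inl hy)), h3 v h5, h2⟩
  · rintro ⟨⟨h1, h2⟩, h3, h4, h5⟩
    refine ⟨⟨h1, h5⟩, fun x hx => ?_⟩
    rcases mem_spanCode_cons.1 hx with hx | hx
    · exact h2 x hx
    · have h6 := h3 _ hx
      rw [scalar_eq_wt, (even_wt_iff _).1 h4, (even_wt_iff _).1 (h2 _ hx), ← add_assoc,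
        add_self_word, zero_add, zero_add, zero_add] at h6
      exact (even_wt_iff _).2 h6

-- The even and the odd words of the dual together number |C^⊥|, and their difference is 2^n by
-- `sum_chi_wt_dual`.
open Classical in
theorem card_even_dual {C : Code (Fin n)} (h : IsEven C) (hn : Even n) :
    2 * (Finset.univ.filter fun v : Fin n → K => v ∈ dual C ∧ Even (wt v)).card =
      Nat.card (dual C) + 2 ^ n := by
  have h1 := sum_chi_wt_dual h
  rw [Fintype.card_fin, hn.neg_pow] at h1
  have h2 : ∑ v : dual C, chi (wt (v : Fin n → K)) =
      ∑ v ∈ Finset.univ.filter (fun v : Fin n → K => v ∈ dual C), chi (wt v) :=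
    (Finset.sum_subtype (F := inferInstance) _ (fun v => by
      rw [Finset.mem_filter, and_iff_right (Finset.mem_univ v)]) fun v => chi (wt v)).symm
  have h3 : ∀ v : Fin n → K, chi (wt v) = 2 * (if Even (wt v) then 1 else 0) - 1 := by
    intro v
    by_cases hv : Even (wt v)
    · rw [if_pos hv, (even_wt_iff _).1 hv]
      rfl
    · rw [if_neg hv, chi_ne_zero fun h => hv ((even_wt_iff _).2 h)]
      rfl
  replace h1 : ∑ v ∈ Finset.univ.filter (fun v : Fin n → K => v ∈ dual C), chi (wt v) = 2 ^ n := by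
    rw [← h2, ← h1]
    congr!
  simp only [h3, Finset.sum_sub_distrib, ← Finset.mul_sum, Finset.sum_boole, Finset.filter_filter,
    Finset.sum_const, nsmul_eq_mul, mul_one] at h1
  have h4 : Nat.card (dual C) = (Finset.univ.filter fun v : Fin n → K => v ∈ dual C).card := by
    rw [← Fintype.card_subtype, Nat.card_eq_fintype_card]
  rw [h4]
  zify
  linarith

/-- The number of ways to extend a basis of an even code of dimension `k` by one word. -/
def extensions (n k : ℕ) : ℕ := (2 ^ (2 * n - k) + 2 ^ n) / 2 - 2 ^ k

-- A basis is built by prepending words. The fibre of `Fin.tail` over `f` consists of the even words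
-- in the dual of the span that are not in the span, and its size depends only on the dimension.
open Classical in
theorem card_admissible (hn : Even n) {k : ℕ} (hk : k ≤ n) :
    (Finset.univ.filter fun f : Fin k → (Fin n → K) => Admissible f).card =
      ∏ i ∈ Finset.range k, extensions n i := by
  induction k with
  | zero =>
    rw [Finset.range_zero, Finset.prod_empty, Finset.card_eq_one]
    refine ⟨Fin.elim0, Finset.eq_singleton_iff_unique_mem.2 ⟨?_, fun f _ => Subsingleton.elim _ _⟩⟩
    simp only [Finset.mem_filter, Finset.mem_univ, true_and]
    refine ⟨linearIndependent_empty_type, fun x hx => ?_⟩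
    have h1 : x ∈ Submodule.span (ZMod 2) (Set.range (Fin.elim0 : Fin 0 → (Fin n → K))) := hx
    rw [Set.range_eq_empty, Submodule.span_empty, Submodule.mem_bot] at h1
    simp [h1]
  | succ k ih =>
    rw [Finset.prod_range_succ, ← ih (by omega), ← smul_eq_mul, ← Finset.sum_const]
    rw [Finset.card_eq_sum_card_fiberwise (f := Fin.tail)
      (t := Finset.univ.filter fun f : Fin k → (Fin n → K) => Admissible f)]
    · refine Finset.sum_congr rfl fun f hf => ?_
      simp only [Finset.mem_filter, Finset.mem_univ, true_and] at hf
      have h1 : (Finset.filter (fun g => Fin.tail g = f) (Finset.univ.filter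
          fun g : Fin (k + 1) → (Fin n → K) => Admissible g)).card =
          ((Finset.univ.filter fun v : Fin n → K => v ∈ dual (spanCode f) ∧ Even (wt v)) \
            (Finset.univ.filter fun v : Fin n → K => v ∈ spanCode f)).card := by
        symm
        refine Finset.card_bij (fun v _ => (Fin.cons v f : Fin (k + 1) → (Fin n → K))) ?_ ?_ ?_
        · intro v hv
          simp only [Finset.mem_sdiff, Finset.mem_filter, Finset.mem_univ, true_and] at hv
          simp only [Finset.mem_filter, Finset.mem_univ, true_and, Fin.tail_cons, and_true]
          exact admissible_cons.2 ⟨hf, hv.1.1, hv.1.2, hv.2⟩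
        · intro v _ v' _ h
          exact (Fin.cons_injective2 h).1
        · intro g hg
          simp only [Finset.mem_filter, Finset.mem_univ, true_and] at hg
          obtain ⟨hg, rfl⟩ := hg
          rw [← Fin.cons_self_tail g, admissible_cons] at hg
          refine ⟨g 0, ?_, Fin.cons_self_tail g⟩
          simp only [Finset.mem_sdiff, Finset.mem_filter, Finset.mem_univ, true_and]
          exact ⟨⟨hg.2.1, hg.2.2.1⟩, hg.2.2.2⟩
      rw [h1, Finset.card_sdiff_of_subset]
      · have h2 := card_even_dual hf.2 hn
        have h3 : (Finset.univ.filter fun v : Fin n → K => v ∈ spanCode f).card = 2 ^ k := by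
          rw [← card_spanCode hf.1, ← Fintype.card_subtype, Nat.card_eq_fintype_card]
        have h4 : Nat.card (dual (spanCode f)) = 2 ^ (2 * n - k) := by
          have h5 := card_mul_card_dual (spanCode f)
          rw [card_spanCode hf.1, Fintype.card_fin] at h5
          refine Nat.eq_of_mul_eq_mul_left (n := 2 ^ k) (by positivity) ?_
          rw [h5, ← pow_add, show k + (2 * n - k) = 2 * n by omega, pow_mul]
          norm_num
        rw [h3, extensions]
        rw [h4] at h2
        omega
      · intro v hv
        simp only [Finset.mem_filter, Finset.mem_univ, true_and] at hv ⊢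
        exact ⟨hf.2.le_dual hv, hf.2 v hv⟩
    · intro g hg
      simp only [Finset.coe_filter, Finset.mem_univ, true_and, Set.mem_ofPred_eq] at hg ⊢
      rw [← Fin.cons_self_tail g, admissible_cons] at hg
      exact hg.1

/-- The set of even self-dual codes of length `n`. -/
def evenSelfDual (n : ℕ) : Set (Code (Fin n)) := {C | IsEven C ∧ IsSelfDual C}

/-- An ordered basis of an even self-dual code is admissible and determines the code, so pairs of a
code and a basis inject into the admissible families. The inequality suffices, because the listed
codes attain it. -/
theorem ncard_evenSelfDual_mul_le (hn : Even n) :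
    (evenSelfDual n).ncard * ∏ i : Fin n, (2 ^ n - 2 ^ (i : ℕ)) ≤
      ∏ i ∈ Finset.range n, extensions n i := by
  classical
  rw [← card_admissible hn le_rfl]
  have h1 : ∀ C : evenSelfDual n, Nat.card {f : Fin n → AddSubgroup.toZModSubmodule 2 C.1 //
      LinearIndependent (ZMod 2) f} = ∏ i : Fin n, (2 ^ n - 2 ^ (i : ℕ)) := by
    intro C
    have h2 : Nat.card (AddSubgroup.toZModSubmodule 2 C.1) = Nat.card (ZMod 2) ^
        Module.finrank (ZMod 2) (AddSubgroup.toZModSubmodule 2 C.1) :=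
      Module.natCard_eq_pow_finrank
    have h3 : Nat.card (AddSubgroup.toZModSubmodule 2 C.1) = 2 ^ n := by
      have := C.2.2.card
      rwa [Fintype.card_fin] at this
    rw [h3, Nat.card_zmod] at h2
    -- The dimension is read off from the order 2^n.
    have h4 := Nat.pow_right_injective (le_refl 2) h2
    have h5 := card_linearIndependent (K := ZMod 2) (V := AddSubgroup.toZModSubmodule 2 C.1)
      (k := n) h4.le
    rw [h5, ← h4]
    simp
  have h6 : (evenSelfDual n).ncard * ∏ i : Fin n, (2 ^ n - 2 ^ (i : ℕ)) =
      Nat.card (Σ C : evenSelfDual n, {f : Fin n → AddSubgroup.toZModSubmodule 2 C.1 //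
        LinearIndependent (ZMod 2) f}) := by
    rw [Nat.card_sigma]
    simp only [h1]
    rw [Finset.sum_const, Finset.card_univ, smul_eq_mul, ← Nat.card_eq_fintype_card,
      Nat.card_coe_set_eq]
  rw [h6, ← Fintype.card_subtype, ← Nat.card_eq_fintype_card]
  have hle : ∀ C : Code (Fin n), ∀ f : Fin n → AddSubgroup.toZModSubmodule 2 C,
      spanCode (fun i => (f i : Fin n → K)) ≤ C := by
    intro C f x hx
    have : Submodule.span (ZMod 2) (Set.range fun i => (f i : Fin n → K)) ≤
        AddSubgroup.toZModSubmodule 2 C := by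
      rw [Submodule.span_le]
      rintro _ ⟨i, rfl⟩
      exact (f i).2
    exact this hx
  have hli : ∀ C : Code (Fin n), ∀ f : Fin n → AddSubgroup.toZModSubmodule 2 C,
      LinearIndependent (ZMod 2) f → LinearIndependent (ZMod 2) fun i => (f i : Fin n → K) :=
    fun C f hf => hf.map' (Submodule.subtype _) (Submodule.ker_subtype _)
  have heq : ∀ (C : evenSelfDual n) (f : Fin n → AddSubgroup.toZModSubmodule 2 C.1),
      LinearIndependent (ZMod 2) f → spanCode (fun i => (f i : Fin n → K)) = C.1 := by
    intro C f hf
    refine AddSubgroup.eq_of_le_of_card_ge (hle C.1 f) ?_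
    rw [card_spanCode (hli _ f hf), C.2.2.card, Fintype.card_fin]
  refine Nat.card_le_card_of_injective (fun p => ⟨fun i => (p.2.1 i : Fin n → K),
    hli _ _ p.2.2, fun x hx => p.1.2.1 x (hle _ _ hx)⟩) ?_
  rintro ⟨⟨C, hC⟩, f, hf⟩ ⟨⟨D, hD⟩, g, hg⟩ h
  have h7 : (fun i => (f i : Fin n → K)) = fun i => (g i : Fin n → K) := congrArg Subtype.val h
  have h8 : C = D := by
    exact (heq ⟨C, hC⟩ f hf).symm.trans ((congrArg spanCode h7).trans (heq ⟨D, hD⟩ g hg))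
  subst h8
  have h9 : f = g := by
    funext i
    exact Subtype.ext (congrFun h7 i)
  subst h9
  rfl

end mass

/-! ### The classification by the mass formula -/

section invariance

variable {ι κ : Type} [Fintype ι] [Fintype κ]

theorem scalar_monomial (e : κ ≃ ι) (σ : κ → (K ≃+ K)) (x y : ι → K) :
    scalar (monomial e σ x) (monomial e σ y) = scalar x y := by
  rw [scalar_eq_wt, scalar_eq_wt, ← map_add, wt_monomial, wt_monomial, wt_monomial]

theorem Equivalent.isEven {C : Code ι} {D : Code κ} (h : Equivalent C D) (hC : IsEven C) :
    IsEven D := by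
  obtain ⟨e, σ, rfl⟩ := h
  rintro _ ⟨x, hx, rfl⟩
  change Even (wt (monomial e σ x))
  rw [wt_monomial]
  exact hC x hx

theorem Equivalent.isSelfDual {C : Code ι} {D : Code κ} (h : Equivalent C D)
    (hC : IsSelfDual C) : IsSelfDual D := by
  obtain ⟨e, σ, rfl⟩ := h
  refine isSelfDual_of_card ?_ ?_
  · rintro _ ⟨x, hx, rfl⟩ _ ⟨y, hy, rfl⟩
    have hx' : x ∈ dual C := (show dual C = C from hC).ge hx
    exact (scalar_monomial e σ x y).trans (hx' y hy)
  · rw [Fintype.card_congr e, ← hC.card]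
    exact (Nat.card_congr (C.equivMapOfInjective _ (monomial e σ).injective).toEquiv).le

end invariance

section classification

variable {n : ℕ}

theorem equivalent_iff_smul {C D : Code (Fin n)} :
    Equivalent C D ↔ ∃ g ∈ isometries (Fin n), g • (C : Set (Fin n → K)) = D := by
  constructor
  · rintro ⟨e, σ, rfl⟩
    exact ⟨_, ⟨e, σ, rfl⟩, rfl⟩
  · rintro ⟨_, ⟨e, σ, rfl⟩, h⟩
    exact ⟨e, σ, SetLike.coe_injective h⟩

theorem equivalent_of_maps {C D : Code (Fin n)} {g : Equiv.Perm (Fin n → K)}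
    (hg : g ∈ isometries (Fin n)) (h : ∀ x ∈ C, g x ∈ D) (hc : Nat.card D ≤ Nat.card C) :
    Equivalent C D := by
  refine equivalent_iff_smul.2 ⟨g, hg, Set.eq_of_subset_of_ncard_le ?_ ?_ (Set.toFinite _)⟩
  · rintro _ ⟨x, hx, rfl⟩
    exact h x hx
  · change _ ≤ (g '' (C : Set (Fin n → K))).ncard
    rw [Set.ncard_image_of_injective _ g.injective]
    exact hc

theorem not_equivalent_of_embeds {gens gens' : List ℕ} (h : embeds n gens gens' = false) :
    ¬ Equivalent (codeOf n gens) (codeOf n gens') := by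
  intro he
  obtain ⟨g, hg, hC⟩ := equivalent_iff_smul.1 he
  have : embeds n gens gens' = true := by
    refine (embeds_iff n gens gens').2 ⟨g, hg, fun x hx => ?_⟩
    have := Set.smul_mem_smul_set (a := g) hx
    rwa [hC] at this
  rw [h] at this
  cases this

theorem equivalent_of_embeds {gens gens' : List ℕ} (h : embeds n gens gens' = true)
    (hc : Nat.card (codeOf n gens') ≤ Nat.card (codeOf n gens)) :
    Equivalent (codeOf n gens) (codeOf n gens') := by
  obtain ⟨g, hg, hC⟩ := (embeds_iff n gens gens').1 h
  exact equivalent_of_maps hg hC hc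

theorem Equivalent.weightCount_eq {C D : Code (Fin n)} (h : Equivalent C D) (i : ℕ) :
    weightCount C i = weightCount D i := by
  obtain ⟨g, hg, hC⟩ := equivalent_iff_smul.1 h
  refine Nat.card_congr (g.subtypeEquiv fun x => ?_)
  rw [wt_isometry hg]
  refine and_congr_left fun _ => ?_
  change x ∈ (C : Set (Fin n → K)) ↔ g x ∈ (D : Set (Fin n → K))
  rw [← hC]
  exact (Set.smul_mem_smul_set_iff (a := g)).symm

/-- Orbit-stabilizer for the action of the isometries on codes. -/
theorem ncard_equivalent_mul_card_autGroup (C : Code (Fin n)) :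
    {D : Code (Fin n) | Equivalent C D}.ncard * Nat.card (autGroup C) = Nat.card (isometries (Fin n)) := by
  rw [← card_mul_relIndex (inf_le_left : autGroup C ≤ isometries (Fin n)),
    relIndex_eq_ncard_image fun g => g • (C : Set (Fin n → K)), mul_comm,
    ← Set.ncard_image_of_injective _ (SetLike.coe_injective (A := Code (Fin n)))]
  · congr 2
    ext S
    constructor
    · rintro ⟨D, hD, rfl⟩
      obtain ⟨g, hg, h⟩ := equivalent_iff_smul.1 hD
      exact ⟨g, hg, h⟩
    · rintro ⟨_, ⟨e, σ, rfl⟩, rfl⟩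
      exact ⟨C.map (monomial e σ).toAddMonoidHom, ⟨e, σ, rfl⟩, rfl⟩
  · intro g hg h hh
    rw [Subgroup.mem_inf, and_iff_right (mul_mem (inv_mem hg) hh), MulAction.mem_stabilizer_iff, mul_smul, inv_smul_eq_iff]
    exact eq_comm

variable {m : ℕ} {rep : Fin m → Code (Fin n)}

/-- Inequivalent codes whose classes exhaust the mass represent all classes. -/
theorem exists_equivalent_of_mass (hn : Even n) (hrep : ∀ i, IsEven (rep i) ∧ IsSelfDual (rep i))
    (hne : ∀ i j, Equivalent (rep i) (rep j) → i = j)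
    (hmass : ∏ i ∈ Finset.range n, extensions n i ≤
      (∑ i, Nat.card (isometries (Fin n)) / Nat.card (autGroup (rep i))) *
        ∏ i : Fin n, (2 ^ n - 2 ^ (i : ℕ)))
    {C : Code (Fin n)} (hC : IsEven C) (hC' : IsSelfDual C) : ∃ i, Equivalent (rep i) C := by
  classical
  have h1 : ∀ i, {D : Code (Fin n) | Equivalent (rep i) D}.ncard =
      Nat.card (isometries (Fin n)) / Nat.card (autGroup (rep i)) := fun i => by
    rw [← ncard_equivalent_mul_card_autGroup (rep i), Nat.mul_div_cancel _ Nat.card_pos]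
  have hpos : 0 < ∏ i : Fin n, (2 ^ n - 2 ^ (i : ℕ)) :=
    Finset.prod_pos fun i _ => Nat.sub_pos_of_lt (Nat.pow_lt_pow_right (by norm_num) i.2)
  have h2 : (evenSelfDual n).ncard ≤ ∑ i, {D : Code (Fin n) | Equivalent (rep i) D}.ncard := by
    simp only [h1]
    exact Nat.le_of_mul_le_mul_right ((ncard_evenSelfDual_mul_le hn).trans hmass) hpos
  have h3 : ∑ i, {D : Code (Fin n) | Equivalent (rep i) D}.ncard = (⋃ i, {D : Code (Fin n) | Equivalent (rep i) D}).ncard := by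
    have e : (⋃ i, {D : Code (Fin n) | Equivalent (rep i) D}) =
        (Finset.univ.biUnion fun i => (Set.toFinite {D : Code (Fin n) | Equivalent (rep i) D}).toFinset :
          Finset (Code (Fin n))) := by
      ext D
      simp
    rw [e, Set.ncard_coe_finset, Finset.card_biUnion]
    · exact Finset.sum_congr rfl fun i _ => Set.ncard_eq_toFinset_card _
    · intro i _ j _ hij
      refine Finset.disjoint_left.2 fun D hi hj => ?_
      rw [Set.Finite.mem_toFinset] at hi hj
      exact hij (hne i j (Equivalent.trans hi (Equivalent.symm hj)))
  -- The union of the classes lies in the finite set of all even self-dual codes and is at least as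
  -- large.
  have h4 : (⋃ i, {D : Code (Fin n) | Equivalent (rep i) D}) = evenSelfDual n := by
    refine Set.eq_of_subset_of_ncard_le ?_ (h2.trans h3.le) (Set.toFinite _)
    intro D hD
    obtain ⟨i, hi⟩ := Set.mem_iUnion.1 hD
    exact ⟨Equivalent.isEven hi (hrep i).1, Equivalent.isSelfDual hi (hrep i).2⟩
  have h5 : C ∈ ⋃ i, {D : Code (Fin n) | Equivalent (rep i) D} := by
    rw [h4]
    exact ⟨hC, hC'⟩
  exact Set.mem_iUnion.1 h5

theorem ncard_classes {p : Code (Fin n) → Prop} (hp : ∀ i, p (rep i))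
    (hne : ∀ i j, Equivalent (rep i) (rep j) → i = j)
    (hex : ∀ C, p C → ∃ i, Equivalent (rep i) C) :
    {q : Quotient (codeSetoid (Fin n)) | ∃ C, p C ∧ q = Quotient.mk _ C}.ncard = m := by
  have h1 : {q : Quotient (codeSetoid (Fin n)) | ∃ C, p C ∧ q = Quotient.mk _ C} =
      (fun i => Quotient.mk (codeSetoid (Fin n)) (rep i)) '' Set.univ := by
    ext q
    constructor
    · rintro ⟨C, hC, rfl⟩
      obtain ⟨i, hi⟩ := hex C hC
      exact ⟨i, trivial, Quotient.sound hi⟩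
    · rintro ⟨i, -, rfl⟩
      exact ⟨rep i, hp i, rfl⟩
  rw [h1, Set.ncard_image_of_injective, Set.ncard_univ, Nat.card_fin]
  intro i j h
  exact hne i j (Quotient.exact h)

end classification

/-! ### Weights of the words of a code -/

/-- No word in the list is a sum of later ones. -/
def independent : List ℕ → Bool
  | [] => true
  | g :: gs => force (bitmap (words gs)) (fun B => !inSet B g) && independent gs

/-- A coincidence g + v = w with `v`, `w` sums of later words would make `g` such a sum itself. -/
theorem nodup_words {gs : List ℕ} (h : independent gs = true) : (words gs).Nodup := by
  induction gs with
  | nil => simp [words]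
  | cons g gs ih =>
    simp only [independent, force_eq, Bool.and_eq_true, Bool.not_eq_true',
      Bool.eq_false_iff, Ne, inSet_bitmap] at h
    have hx : ∀ v w, Nat.xor g v = w → Nat.xor w v = g := by
      rintro v _ rfl
      change (g ^^^ v) ^^^ v = g
      rw [Nat.xor_assoc, Nat.xor_self, Nat.xor_zero]
    refine List.nodup_append'.2 ⟨ih h.2, (ih h.2).map ?_, ?_⟩
    · exact fun v w (hvw : g ^^^ v = g ^^^ w) => Nat.xor_right_injective hvw
    · intro w hw hw'
      obtain ⟨v, hv, hvw⟩ := List.mem_map.1 hw'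
      exact h.1 (hx v w hvw ▸ xor_mem_words hw hv)

section weights

variable {n : ℕ} {gens : List ℕ}

theorem card_filter_codeOf (hg : ∀ g ∈ gens, g < 4 ^ n) (hi : independent gens = true)
    (p : (Fin n → K) → Prop) (q : ℕ → Bool) (hpq : ∀ w, p (dec n w) ↔ q w = true) :
    Nat.card {x : Fin n → K // x ∈ codeOf n gens ∧ p x} = (words gens).countP q := by
  classical
  have h1 : {x : Fin n → K | x ∈ codeOf n gens ∧ p x} =
      dec n '' ((words gens).filter q).toFinset := by
    ext x
    simp only [Set.mem_ofPred_eq, mem_codeOf, Set.mem_image, Finset.mem_coe, List.mem_toFinset,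
      List.mem_filter]
    constructor
    · rintro ⟨⟨w, hw, rfl⟩, hx⟩
      exact ⟨w, ⟨hw, (hpq w).1 hx⟩, rfl⟩
    · rintro ⟨w, ⟨hw, hq⟩, rfl⟩
      exact ⟨⟨w, hw, rfl⟩, (hpq w).2 hq⟩
  change {x : Fin n → K | x ∈ codeOf n gens ∧ p x}.ncard = _
  rw [h1, Set.InjOn.ncard_image, Set.ncard_coe_finset,
    List.toFinset_card_of_nodup ((nodup_words hi).filter _), List.countP_eq_length_filter]
  intro v hv w hw h
  simp only [Finset.mem_coe, List.mem_toFinset, List.mem_filter] at hv hw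
  exact dec_injOn (words_lt hg v hv.1) (words_lt hg w hw.1) h

theorem card_codeOf (hg : ∀ g ∈ gens, g < 4 ^ n) (hi : independent gens = true) :
    Nat.card (codeOf n gens) = 2 ^ gens.length := by
  have h := card_filter_codeOf hg hi (fun _ => True) (fun _ => true) (by simp)
  simp only [and_true] at h
  exact h.trans (by simp [length_words])

/-- All words are less than `4 ^ n`. -/
def bounded (n : ℕ) (gens : List ℕ) : Bool := gens.all fun g => Nat.blt g (Nat.pow 4 n)

theorem lt_of_bounded (h : bounded n gens = true) : ∀ g ∈ gens, g < 4 ^ n := by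
  intro g hg
  have := List.all_eq_true.1 h g hg
  exact Nat.blt_eq ▸ this

/-- The coefficients `A_0`, `A_1`, …, `A_n` of the weight enumerator are `A 0`, `0`, `A 1`, `0`, …. -/
noncomputable def weightsAre (n : ℕ) (gens A : List ℕ) : Bool :=
  forceList ((words gens).map (weight n)) fun l => (List.range (n + 1)).all fun k =>
    Nat.beq (l.countP fun w => Nat.beq w k) (bif Nat.beq (k % 2) 0 then A.getD (k / 2) 0 else 0)

theorem weightCount_codeOf (hg : ∀ g ∈ gens, g < 4 ^ n) (hi : independent gens = true)
    {A : List ℕ} (hA : A.length ≤ n / 2 + 1) (hw : weightsAre n gens A = true) (j : ℕ) :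
    weightCount (codeOf n gens) (2 * j) = A.getD j 0 ∧
      weightCount (codeOf n gens) (2 * j + 1) = 0 := by
  have h1 : ∀ k ≤ n, weightCount (codeOf n gens) k = if k % 2 = 0 then A.getD (k / 2) 0 else 0 := by
    intro k hk
    rw [weightsAre, forceList_eq, List.all_eq_true] at hw
    have h2 := Nat.eq_of_beq_eq_true (hw k (List.mem_range.2 (by omega)))
    rw [weightCount, card_filter_codeOf hg hi (fun x => wt x = k) (fun w => Nat.beq (weight n w) k),
      ← Function.comp_def (fun w => Nat.beq w k) (weight n), ← List.countP_map, h2]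
    · by_cases hk : k % 2 = 0
      · rw [if_pos hk, hk]; rfl
      · rw [if_neg hk, show k % 2 = 1 by omega]; rfl
    · intro w
      rw [wt_dec, Nat.beq_eq]
  -- No word is heavier than `n`. Together with `hA`, which leaves only default zeros in `A` there,
  -- this settles all weights not tested.
  have h2 : ∀ k, n < k → weightCount (codeOf n gens) k = 0 := by
    intro k hk
    rw [weightCount, Nat.card_eq_zero]
    left
    refine ⟨fun x => ?_⟩
    have := hammingNorm_le_card_fintype (x := x.1)
    rw [Fintype.card_fin] at this
    have hx : hammingNorm x.1 = k := x.2.2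
    omega
  constructor
  · by_cases hk : 2 * j ≤ n
    · rw [h1 _ hk, if_pos (by omega), Nat.mul_div_cancel_left _ (by norm_num)]
    · rw [h2 _ (by omega), List.getD_eq_default _ _ (by omega)]
  · by_cases hk : 2 * j + 1 ≤ n
    · rw [h1 _ hk, if_neg (by omega)]
    · exact h2 _ (by omega)

theorem isEven_of_weightCount {C : Code (Fin n)} (h : ∀ j, weightCount C (2 * j + 1) = 0) :
    IsEven C := by
  intro x hx
  by_contra hodd
  obtain ⟨j, hj⟩ := Nat.not_even_iff_odd.1 hodd
  have h1 := h j
  rw [weightCount, Nat.card_eq_zero] at h1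
  obtain h1 | h1 := h1
  · exact h1.false ⟨x, hx, hj⟩
  · exact h1.not_finite inferInstance

/-- An even code is self-orthogonal, and `n` independent generators give it the order 2^n of a
self-dual code. -/
theorem isSelfDual_codeOf (hg : ∀ g ∈ gens, g < 4 ^ n) (hi : independent gens = true)
    (hl : gens.length = n) (h : IsEven (codeOf n gens)) : IsSelfDual (codeOf n gens) := by
  refine isSelfDual_of_card h.le_dual ?_
  rw [card_codeOf hg hi, hl, Fintype.card_fin]

end weights

/-! ### The components of a code generated by words of weight two -/

theorem exists_ne_zero {ι : Type} {D : Code ι} (h : D ≠ ⊥) : ∃ x ∈ D, ∃ i, x i ≠ 0 := by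
  by_contra hc
  push Not at hc
  exact h ((AddSubgroup.eq_bot_iff_forall D).2 fun x hx => funext (hc x hx))

/-- The blocks `S j` are connected: any two positions of a block form the support of a word of `B`.
A summand given by a set `T` that contains part of a block must contain all of it, since otherwise
`T` would cut such a word to weight one, which `hone` forbids. So each nonzero summand contains some
`D j`, and no `D j` contains another. -/
theorem components_eq {ι J : Type} {B : Code ι} {D : J → Code ι} {S : J → Set ι}
    (hne : ∀ j, D j ≠ ⊥) (hS : ∀ j, ∀ x ∈ B, (S j).indicator x ∈ B)
    (hD : ∀ j x, x ∈ D j ↔ x ∈ B ∧ ∀ i ∉ S j, x i = 0)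
    (hcover : ∀ x ∈ B, ∀ i, x i ≠ 0 → ∃ j, i ∈ S j)
    (hdisj : ∀ j k i, i ∈ S j → i ∈ S k → j = k)
    (hconn : ∀ j, ∀ i ∈ S j, ∀ i' ∈ S j, i ≠ i' →
      ∃ x ∈ B, x i ≠ 0 ∧ x i' ≠ 0 ∧ ∀ k, k ≠ i → k ≠ i' → x k = 0)
    (hone : ∀ x ∈ B, ∀ i, (∀ k, k ≠ i → x k = 0) → x i = 0) :
    components B = Set.range D := by
  classical
  have h1 : ∀ D', IsSummand B D' → D' ≠ ⊥ → ∃ j, D j ≤ D' := by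
    rintro D' ⟨T, hT, hD'⟩ hbot
    obtain ⟨x, hx, i, hi⟩ := exists_ne_zero hbot
    obtain ⟨hxB, hxT⟩ := (hD' _).1 hx
    have hiT : i ∈ T := by
      by_contra h
      exact hi (hxT i h)
    obtain ⟨j, hj⟩ := hcover _ hxB i hi
    refine ⟨j, fun y hy => (hD' y).2 ⟨((hD j y).1 hy).1, fun k hk => ((hD j y).1 hy).2 k ?_⟩⟩
    intro hkj
    have hik : i ≠ k := fun h => hk (h ▸ hiT)
    obtain ⟨z, hz, hzi, -, hz'⟩ := hconn j i hj k hkj hik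
    refine hzi ?_
    -- The restriction of `z` to `T` is a word of `B` with `i` as its only possible nonzero
    -- position.
    have h2 := hone _ (hT z hz) i ?_
    · rwa [Set.indicator_of_mem hiT] at h2
    · intro l hl
      by_cases hlk : l = k
      · rw [hlk, Set.indicator_of_notMem hk]
      · by_cases hlT : l ∈ T
        · rw [Set.indicator_of_mem hlT, hz' l hl hlk]
        · rw [Set.indicator_of_notMem hlT]
  have h2 : ∀ j, IsSummand B (D j) := fun j => ⟨S j, hS j, hD j⟩
  have h3 : ∀ j k, D j ≤ D k → j = k := by
    intro j k hjk
    obtain ⟨x, hx, i, hi⟩ := exists_ne_zero (hne j)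
    have hij : i ∈ S j := by
      by_contra h
      exact hi (((hD j _).1 hx).2 i h)
    have hik : i ∈ S k := by
      by_contra h
      exact hi (((hD k _).1 (hjk hx)).2 i h)
    exact hdisj j k i hij hik
  ext D'
  constructor
  · intro (h : Minimal (fun D' => D' ≠ ⊥ ∧ IsSummand B D') D')
    obtain ⟨j, hj⟩ := h1 D' h.prop.2 h.prop.1
    exact ⟨j, le_antisymm hj (h.le_of_le ⟨hne j, h2 j⟩ hj)⟩
  · rintro ⟨j, rfl⟩
    refine ⟨⟨hne j, h2 j⟩, fun D' hD' hle => ?_⟩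
    obtain ⟨k, hk⟩ := h1 D' hD'.2 hD'.1
    rw [← h3 k j (hk.trans hle)]
    exact hk

/-- The word with the digit `d` in position `o` and no other nonzero digit. -/
def unitWord (d o : ℕ) : ℕ := Nat.mul d (Nat.pow 4 o)

theorem dig_unitWord {d : ℕ} (hd : d < 4) (o i : ℕ) :
    dig (unitWord d o) i = if i = o then d else 0 := by
  have h : unitWord d o = d * 4 ^ o := rfl
  rw [dig_eq, h]
  rcases lt_trichotomy i o with hi | rfl | hi
  · rw [if_neg hi.ne, show o = i + (o - i - 1 + 1) by omega, pow_add, pow_succ, mul_left_comm,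
      Nat.mul_div_cancel_left _ (by positivity), ← mul_assoc, Nat.mul_mod_left]
  · rw [if_pos rfl, Nat.mul_div_cancel _ (by positivity), Nat.mod_eq_of_lt hd]
  · rw [if_neg hi.ne', Nat.div_eq_of_lt, Nat.zero_mod]
    calc d * 4 ^ o < 4 * 4 ^ o := Nat.mul_lt_mul_of_pos_right hd (by positivity)
      _ = 4 ^ (o + 1) := by rw [pow_succ, mul_comm]
      _ ≤ 4 ^ i := Nat.pow_le_pow_right (by norm_num) hi

/-- The word with the digit `d` in the positions `o` and `p`. -/
def pairWord (d o p : ℕ) : ℕ := Nat.xor (unitWord d o) (unitWord d p)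

theorem dec_pairWord {n d : ℕ} (hd : d < 4) {o p : ℕ} (hop : o ≠ p) (i : Fin n) :
    dec n (pairWord d o p) i = if (i : ℕ) = o ∨ (i : ℕ) = p then sym d else 0 := by
  have h0 : sym 0 = 0 := rfl
  rw [pairWord, dec_xor, Pi.add_apply, dec, dec, dig_unitWord hd, dig_unitWord hd]
  by_cases h1 : (i : ℕ) = o
  · simp [h1, h0, hop]
  · by_cases h2 : (i : ℕ) = p
    · simp [h2, h0, hop.symm]
    · simp [h1, h2, h0]

/-- Generators of a component which starts in position `o`. -/
def Component.gens (o : ℕ) : Component → List ℕ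
  | .δ l => (List.range (l - 1)).map fun i => pairWord 1 o (o + (i + 1))
  | .ε => [pairWord 1 o (o + 1), pairWord 2 o (o + 1)]

/-- The words which are zero outside a component, starting in position `o`, and belong to it. -/
def Component.shift (n o : ℕ) (s : Component) : Code (Fin n) where
  carrier := {x | (∀ i : Fin n, ((i : ℕ) < o ∨ o + s.length ≤ i) → x i = 0) ∧
    ∃ y ∈ s.code, ∀ (i : Fin n) (j : Fin s.length), (i : ℕ) = o + j → x i = y j}
  zero_mem' := ⟨fun _ _ => rfl, 0, zero_mem _, fun _ _ _ => rfl⟩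
  add_mem' := by
    rintro x x' ⟨h, y, hy, hxy⟩ ⟨h', y', hy', hxy'⟩
    refine ⟨fun i hi => ?_, y + y', add_mem hy hy', fun i j hij => ?_⟩
    · rw [Pi.add_apply, h i hi, h' i hi, add_zero]
    · rw [Pi.add_apply, Pi.add_apply, hxy i j hij, hxy' i j hij]
  neg_mem' := by
    intro x hx
    rwa [neg_word]

theorem mem_shift {n o : ℕ} {s : Component} {x : Fin n → K} (h : o + s.length ≤ n) :
    x ∈ s.shift n o ↔ (∀ i : Fin n, ((i : ℕ) < o ∨ o + s.length ≤ i) → x i = 0) ∧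
      (fun j : Fin s.length => x ⟨o + j, by omega⟩) ∈ s.code := by
  refine and_congr_right fun _ => ?_
  constructor
  · rintro ⟨y, hy, hxy⟩
    convert hy using 1
    funext j
    exact hxy _ j rfl
  · intro hx
    refine ⟨_, hx, fun i j hij => ?_⟩
    congr 1
    exact Fin.ext hij

theorem mem_shift_δ {n o l : ℕ} {x : Fin n → K} (h : o + l ≤ n) :
    x ∈ (Component.δ l).shift n o ↔ (∀ i : Fin n, ((i : ℕ) < o ∨ o + l ≤ i) → x i = 0) ∧
      (∀ i, x i = 0 ∨ x i = a) ∧ Even (wt x) := by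
  rw [mem_shift h]
  change (_ ∧ (∀ j : Fin l, x ⟨o + j, by omega⟩ = 0 ∨ x ⟨o + j, by omega⟩ = a) ∧
    Even (wt fun j : Fin l => x ⟨o + j, by omega⟩)) ↔ _
  refine and_congr_right fun h0 => ?_
  have h1 : wt (fun j : Fin l => x ⟨o + j, by omega⟩) = wt x := by
    refine Finset.card_bij (fun j _ => ⟨o + j, by omega⟩) ?_ ?_ ?_
    · intro j hj
      simpa using hj
    · intro j _ k _ hjk
      simp only [Fin.mk.injEq] at hjk
      exact Fin.ext (by omega)
    · intro i hi
      rw [Finset.mem_filter] at hi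
      have h2 : ¬ ((i : ℕ) < o ∨ o + l ≤ i) := fun h => hi.2 (h0 i h)
      refine ⟨⟨i - o, by omega⟩, ?_, Fin.ext (by simp; omega)⟩
      rw [Finset.mem_filter]
      refine ⟨Finset.mem_univ _, ?_⟩
      convert hi.2
      simp only
      omega
  rw [h1]
  refine and_congr_left fun _ => ⟨fun h2 i => ?_, fun h2 j => h2 _⟩
  by_cases hi : (i : ℕ) < o ∨ o + l ≤ i
  · exact Or.inl (h0 i hi)
  · have := h2 ⟨i - o, by omega⟩
    have e : (⟨o + (i - o), by omega⟩ : Fin n) = i := Fin.ext (by simp only; omega)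
    rwa [e] at this

theorem mem_shift_ε {n o : ℕ} {x : Fin n → K} (h : o + 2 ≤ n) :
    x ∈ Component.ε.shift n o ↔ (∀ i : Fin n, ((i : ℕ) < o ∨ o + 2 ≤ i) → x i = 0) ∧
      x ⟨o, by omega⟩ = x ⟨o + 1, by omega⟩ := by
  rw [mem_shift h]
  rfl

theorem wt_pair {n : ℕ} {x : Fin n → K} {i j : Fin n} (hij : i ≠ j) (hi : x i ≠ 0) (hj : x j ≠ 0)
    (h : ∀ k, k ≠ i → k ≠ j → x k = 0) : wt x = 2 := by
  refine Eq.trans (congrArg Finset.card ?_) (Finset.card_pair hij)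
  ext k
  simp only [Finset.mem_filter, Finset.mem_univ, true_and, Finset.mem_insert,
    Finset.mem_singleton]
  constructor
  · intro hk
    by_contra hc
    push Not at hc
    exact hk (h k hc.1 hc.2)
  · rintro (rfl | rfl) <;> assumption

theorem pairWord_mem_shift_δ {n o l i : ℕ} (h : o + l ≤ n) (hi : i + 1 < l) :
    dec n (pairWord 1 o (o + (i + 1))) ∈ (Component.δ l).shift n o := by
  rw [mem_shift_δ h]
  have h1 : ∀ k, dec n (pairWord 1 o (o + (i + 1))) k =
      if (k : ℕ) = o ∨ (k : ℕ) = o + (i + 1) then a else 0 := dec_pairWord (by norm_num) (by omega)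
  refine ⟨fun k hk => ?_, fun k => ?_, ?_⟩
  · rw [h1, if_neg (by omega)]
  · rw [h1]
    split_ifs
    · exact Or.inr rfl
    · exact Or.inl rfl
  · rw [wt_pair (i := ⟨o, by omega⟩) (j := ⟨o + (i + 1), by omega⟩)]
    · decide
    · intro h
      simp at h
    · rw [h1, if_pos (Or.inl rfl)]; decide
    · rw [h1, if_pos (Or.inr rfl)]; decide
    · intro k hk hk'
      rw [h1, if_neg]
      rintro (h | h)
      · exact hk (Fin.ext h)
      · exact hk' (Fin.ext h)

/-- For δ, adding the generator supported at `o` and `i` clears position `i`, so one inducts on the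
number of nonzero positions other than `o`; when none is left, even weight forces the entry at `o`
to vanish. For ε, a word is a sum of the two generators according to its common symbol. -/
theorem codeOf_gens (n o : ℕ) (s : Component) (h : o + s.length ≤ n) :
    codeOf n (s.gens o) = s.shift n o := by
  refine le_antisymm (codeOf_le.2 fun g hg => ?_) fun x hx => ?_
  · cases s with
    | δ l =>
      obtain ⟨i, hi, rfl⟩ := List.mem_map.1 hg
      rw [List.mem_range] at hi
      exact pairWord_mem_shift_δ h (by omega)
    | ε =>
      rw [mem_shift_ε h]
      have h1 : ∀ d, d < 4 → (∀ i : Fin n, ((i : ℕ) < o ∨ o + 2 ≤ i) →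
          dec n (pairWord d o (o + 1)) i = 0) ∧ dec n (pairWord d o (o + 1)) ⟨o, by
            have : o + 2 ≤ n := h
            omega⟩ = dec n (pairWord d o (o + 1)) ⟨o + 1, by
            have : o + 2 ≤ n := h
            omega⟩ := by
        intro d hd
        refine ⟨fun i hi => ?_, ?_⟩
        · rw [dec_pairWord hd (by omega), if_neg (by omega)]
        · rw [dec_pairWord hd (by omega), dec_pairWord hd (by omega), if_pos (Or.inl rfl),
            if_pos (Or.inr rfl)]
      simp only [Component.gens, List.mem_cons, List.not_mem_nil, or_false] at hg
      obtain rfl | rfl := hg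
      · exact h1 1 (by norm_num)
      · exact h1 2 (by norm_num)
  · cases s with
    | δ l =>
      have h' : o + l ≤ n := h
      induction hm : (Finset.univ.filter fun i : Fin n => (i : ℕ) ≠ o ∧ x i ≠ 0).card using
        Nat.strong_induction_on generalizing x with
      | _ m ih =>
        by_cases hex : ∃ i : Fin n, (i : ℕ) ≠ o ∧ x i ≠ 0
        · obtain ⟨i, hio, hi⟩ := hex
          obtain ⟨h0, h01, -⟩ := (mem_shift_δ h').1 hx
          have hir : ¬ ((i : ℕ) < o ∨ o + l ≤ i) := fun h => hi (h0 i h)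
          have hp : o + (((i : ℕ) - o - 1) + 1) = i := by omega
          have hg : dec n (pairWord 1 o i) ∈ codeOf n ((Component.δ l).gens o) := by
            refine dec_mem_codeOf (List.mem_map.2 ⟨i - o - 1, List.mem_range.2 (by omega), ?_⟩)
            rw [hp]
          have hg' : dec n (pairWord 1 o i) ∈ (Component.δ l).shift n o := by
            rw [← hp]
            exact pairWord_mem_shift_δ h' (by omega)
          have hd : ∀ k : Fin n, (k : ℕ) ≠ o → (x + dec n (pairWord 1 o i)) k =
              if k = i then 0 else x k := by
            intro k hk
            rw [Pi.add_apply, dec_pairWord (by norm_num) hio.symm]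
            by_cases hki : k = i
            · rw [if_pos (Or.inr (congrArg Fin.val hki)), if_pos hki, hki,
                (h01 i).resolve_left hi]
              decide
            · rw [if_neg, if_neg hki, add_zero]
              rintro (h | h)
              · exact hk h
              · exact hki (Fin.ext h)
          have hlt : (Finset.univ.filter fun k : Fin n => (k : ℕ) ≠ o ∧
              (x + dec n (pairWord 1 o i)) k ≠ 0).card < m := by
            rw [← hm]
            refine Finset.card_lt_card (Finset.ssubset_iff_of_subset ?_ |>.2 ⟨i, ?_, ?_⟩)
            · intro k hk
              rw [Finset.mem_filter] at hk ⊢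
              refine ⟨Finset.mem_univ _, hk.2.1, ?_⟩
              have h2 := hk.2.2
              rw [hd k hk.2.1] at h2
              split_ifs at h2 with hki
              · exact absurd rfl h2
              · exact h2
            · simp [hio, hi]
            · rw [Finset.mem_filter, hd i hio, if_pos rfl]
              simp
          have h2 := add_mem (ih _ hlt _ (add_mem hx hg') rfl) hg
          rwa [add_assoc, add_self_word, add_zero] at h2
        · push Not at hex
          obtain ⟨h0, h01, hev⟩ := (mem_shift_δ h').1 hx
          have : x = 0 := by
            funext i
            by_cases hio : (i : ℕ) = o
            · by_contra hi
              have h3 : wt x = 1 := by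
                rw [wt, hammingNorm, Finset.card_eq_one]
                refine ⟨i, Finset.eq_singleton_iff_unique_mem.2 ⟨by simpa using hi, ?_⟩⟩
                intro k hk
                rw [Finset.mem_filter] at hk
                by_contra hki
                refine hk.2 (hex k fun h => hki (Fin.ext (h.trans hio.symm)))
              rw [h3] at hev
              exact absurd hev (by decide)
            · exact hex i hio
          rw [this]
          exact zero_mem _
    | ε =>
      have h' : o + 2 ≤ n := h
      obtain ⟨h0, h1⟩ := (mem_shift_ε h').1 hx
      have ha : dec n (pairWord 1 o (o + 1)) ∈ codeOf n (Component.ε.gens o) :=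
        dec_mem_codeOf List.mem_cons_self
      have hb : dec n (pairWord 2 o (o + 1)) ∈ codeOf n (Component.ε.gens o) :=
        dec_mem_codeOf (List.mem_cons_of_mem _ List.mem_cons_self)
      have key : ∀ y ∈ codeOf n (Component.ε.gens o), (∀ i : Fin n, y i =
          if (i : ℕ) = o ∨ (i : ℕ) = o + 1 then x ⟨o, by omega⟩ else 0) →
          x ∈ codeOf n (Component.ε.gens o) := by
        intro y hy hxy
        convert hy
        funext i
        rw [hxy]
        split_ifs with hi
        · obtain hi | hi := hi
          · exact congrArg x (Fin.ext hi)
          · rw [h1]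
            exact congrArg x (Fin.ext hi)
        · exact h0 i (by omega)
      have h7 : ∀ k : K, k = 0 ∨ k = a ∨ k = b ∨ k = a + b := by decide
      have h8 : o ≠ o + 1 := by omega
      obtain e | e | e | e := h7 (x ⟨o, by omega⟩)
      · refine key 0 (zero_mem _) fun i => ?_
        rw [e, ite_self]; rfl
      · refine key _ ha fun i => ?_
        rw [dec_pairWord (by norm_num) h8, e]; rfl
      · refine key _ hb fun i => ?_
        rw [dec_pairWord (by norm_num) h8, e]; rfl
      · refine key _ (add_mem ha hb) fun i => ?_
        rw [Pi.add_apply, dec_pairWord (by norm_num) h8, dec_pairWord (by norm_num) h8, e]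
        split_ifs
        · rfl
        · rfl

/-! ### Sums of components -/

/-- The first position of the component with number `j`. -/
def offset (L : List Component) (j : ℕ) : ℕ := ((L.take j).map Component.length).sum

/-- The generators of the components in a list, placed one after the other. -/
def parts (L : List Component) : List (List ℕ) :=
  (List.finRange L.length).map fun j => (L.get j).gens (offset L j)

/-- The positions of a component. -/
def block (n : ℕ) (L : List Component) (j : Fin L.length) : Set (Fin n) :=
  {i | offset L j ≤ i ∧ (i : ℕ) < offset L j + (L.get j).length}

section sums

variable {n : ℕ} {L : List Component}

theorem offset_succ (j : Fin L.length) :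
    offset L (j + 1) = offset L j + (L.get j).length := by
  rw [offset, offset, List.take_add_one, List.map_append, List.sum_append]
  simp

theorem offset_mono (L : List Component) : Monotone (offset L) := by
  refine monotone_nat_of_le_succ fun j => ?_
  by_cases hj : j < L.length
  · rw [offset_succ ⟨j, hj⟩]
    exact Nat.le_add_right _ _
  · rw [offset, offset, List.take_of_length_le (by omega), List.take_of_length_le (by omega)]

theorem offset_add_le {j k : Fin L.length} (h : j < k) :
    offset L j + (L.get j).length ≤ offset L k := by
  rw [← offset_succ]
  exact offset_mono L h

theorem offset_add_le_length (j : Fin L.length) :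
    offset L j + (L.get j).length ≤ offset L L.length := by
  rw [← offset_succ]
  exact offset_mono L j.2

theorem offset_disjoint {j k : Fin L.length} {i : ℕ}
    (hj : offset L j ≤ i ∧ i < offset L j + (L.get j).length)
    (hk : offset L k ≤ i ∧ i < offset L k + (L.get k).length) : j = k := by
  rcases lt_trichotomy j k with h | h | h
  · have := offset_add_le h
    omega
  · exact h
  · have := offset_add_le h
    omega

theorem block_disjoint (j k : Fin L.length) (i : Fin n) (hj : i ∈ block n L j)
    (hk : i ∈ block n L k) : j = k :=
  offset_disjoint hj hk

/-- Blocks are disjoint, so cutting a word of one component to a block leaves it unchanged or gives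
zero. -/
theorem indicator_mem_shift {j k : Fin L.length} {x : Fin n → K}
    (hx : x ∈ (L.get k).shift n (offset L k)) :
    (block n L j).indicator x ∈ (L.get j).shift n (offset L j) := by
  by_cases hjk : j = k
  · subst hjk
    rwa [Set.indicator_eq_self.2]
    intro i hi
    by_contra h
    refine hi (hx.1 i ?_)
    by_contra hc
    exact h (by simp only [block, Set.mem_ofPred_eq]; omega)
  · have : (block n L j).indicator x = 0 := by
      funext i
      by_cases hi : i ∈ block n L j
      · rw [Set.indicator_of_mem hi]
        refine hx.1 i ?_
        by_contra hc
        exact hjk (block_disjoint j k i hi (by simp only [block, Set.mem_ofPred_eq]; omega))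
      · rw [Set.indicator_of_notMem hi]
        rfl
    rw [this]
    exact zero_mem _

theorem gens_mem_parts (j : Fin L.length) : (L.get j).gens (offset L j) ∈ parts L :=
  List.mem_map.2 ⟨j, List.mem_finRange j, rfl⟩

theorem shift_le (hn : offset L L.length ≤ n) (j : Fin L.length) :
    (L.get j).shift n (offset L j) ≤ codeOf n (parts L).flatten := by
  rw [← codeOf_gens n _ _ ((offset_add_le_length j).trans hn)]
  exact codeOf_le.2 fun g hg => dec_mem_codeOf (List.mem_flatten.2 ⟨_, gens_mem_parts j, hg⟩)

/-- The condition on the right is preserved by sums and holds for the generators; conversely, a word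
satisfying it is the sum of its restrictions to the blocks. -/
theorem mem_codeOf_parts (hn : offset L L.length ≤ n) {x : Fin n → K} :
    x ∈ codeOf n (parts L).flatten ↔
      (∀ j, (block n L j).indicator x ∈ (L.get j).shift n (offset L j)) ∧
        ∀ i, (∀ j, i ∉ block n L j) → x i = 0 := by
  constructor
  · intro hx
    refine AddSubgroup.closure_induction (p := fun x _ =>
      (∀ j, (block n L j).indicator x ∈ (L.get j).shift n (offset L j)) ∧
        ∀ i, (∀ j, i ∉ block n L j) → x i = 0) ?_ ?_ ?_ ?_ hx
    · rintro _ ⟨g, hg, rfl⟩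
      obtain ⟨p, hp, hgp⟩ := List.mem_flatten.1 hg
      obtain ⟨k, -, rfl⟩ := List.mem_map.1 hp
      have h1 : dec n g ∈ (L.get k).shift n (offset L k) := by
        rw [← codeOf_gens n _ _ ((offset_add_le_length k).trans hn)]
        exact dec_mem_codeOf hgp
      refine ⟨fun j => indicator_mem_shift h1, fun i hi => h1.1 i ?_⟩
      have := hi k
      simp only [block, Set.mem_ofPred_eq] at this
      omega
    · refine ⟨fun j => ?_, fun _ _ => rfl⟩
      rw [Set.indicator_zero']
      exact zero_mem _
    · rintro x y - - ⟨hx, hx'⟩ ⟨hy, hy'⟩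
      refine ⟨fun j => ?_, fun i hi => ?_⟩
      · rw [Set.indicator_add']
        exact add_mem (hx j) (hy j)
      · rw [Pi.add_apply, hx' i hi, hy' i hi, add_zero]
    · intro x _ hx
      rwa [neg_word]
  · rintro ⟨h1, h2⟩
    have h3 : x = ∑ j, (block n L j).indicator x := by
      funext i
      rw [Finset.sum_apply]
      by_cases hi : ∃ j, i ∈ block n L j
      · obtain ⟨j, hj⟩ := hi
        rw [Finset.sum_eq_single j, Set.indicator_of_mem hj]
        · intro k _ hk
          exact Set.indicator_of_notMem (fun h => hk (block_disjoint k j i h hj)) _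
        · simp
      · push Not at hi
        rw [h2 i hi]
        exact (Finset.sum_eq_zero fun j _ => Set.indicator_of_notMem (hi j) _).symm
    rw [h3]
    exact sum_mem fun j _ => shift_le hn j (h1 j)

theorem mem_shift_iff (hn : offset L L.length ≤ n) (j : Fin L.length) (x : Fin n → K) :
    x ∈ (L.get j).shift n (offset L j) ↔
      x ∈ codeOf n (parts L).flatten ∧ ∀ i ∉ block n L j, x i = 0 := by
  constructor
  · refine fun hx => ⟨shift_le hn j hx, fun i hi => hx.1 i ?_⟩
    simp only [block, Set.mem_ofPred_eq] at hi
    omega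
  · rintro ⟨h1, h2⟩
    have := ((mem_codeOf_parts hn).1 h1).1 j
    rwa [Set.indicator_eq_self.2] at this
    intro i hi
    by_contra h
    exact hi (h2 i h)

theorem pairWord_mem_shift (hn : offset L L.length ≤ n) {j : Fin L.length} {i i' : Fin n}
    (hi : i ∈ block n L j) (hi' : i' ∈ block n L j) (h : i ≠ i') :
    dec n (pairWord 1 i i') ∈ (L.get j).shift n (offset L j) := by
  have h1 : ∀ k : Fin n, dec n (pairWord 1 i i') k = if (k : ℕ) = i ∨ (k : ℕ) = i' then a else 0 :=
    dec_pairWord (by norm_num) fun h' => h (Fin.ext h')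
  have hle := (offset_add_le_length j).trans hn
  simp only [block, Set.mem_ofPred_eq] at hi hi'
  generalize offset L j = o at *
  generalize L.get j = s at *
  cases s with
  | δ l =>
    change _ ≤ _ ∧ _ < _ + l at hi hi'
    refine (mem_shift_δ hle).2 ⟨fun k (hk : (k : ℕ) < o ∨ o + l ≤ k) => ?_, fun k => ?_, ?_⟩
    · rw [h1, if_neg (by omega)]
    · rw [h1]
      split_ifs
      · exact Or.inr rfl
      · exact Or.inl rfl
    · rw [wt_pair h]
      · decide
      · rw [h1, if_pos (Or.inl rfl)]; decide
      · rw [h1, if_pos (Or.inr rfl)]; decide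
      · intro k hk hk'
        rw [h1, if_neg]
        rintro (h | h)
        · exact hk (Fin.ext h)
        · exact hk' (Fin.ext h)
  | ε =>
    change _ ≤ _ ∧ _ < _ + 2 at hi hi'
    have hii : (i : ℕ) ≠ i' := fun h' => h (Fin.ext h')
    refine (mem_shift_ε hle).2 ⟨fun k hk => ?_, ?_⟩
    · rw [h1, if_neg (by omega)]
    · rw [h1, h1, if_pos (by simp only; omega), if_pos (by simp only; omega)]

theorem dec_pairWord_ne_zero {i i' : Fin n} (h : i ≠ i') :
    dec n (pairWord 1 i i') i ≠ 0 ∧ dec n (pairWord 1 i i') i' ≠ 0 ∧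
      ∀ k, k ≠ i → k ≠ i' → dec n (pairWord 1 i i') k = 0 := by
  have h1 : ∀ k : Fin n, dec n (pairWord 1 i i') k = if (k : ℕ) = i ∨ (k : ℕ) = i' then a else 0 :=
    dec_pairWord (by norm_num) fun h' => h (Fin.ext h')
  refine ⟨?_, ?_, fun k hk hk' => ?_⟩
  · rw [h1, if_pos (Or.inl rfl)]; decide
  · rw [h1, if_pos (Or.inr rfl)]; decide
  · rw [h1, if_neg]
    rintro (h | h)
    · exact hk (Fin.ext h)
    · exact hk' (Fin.ext h)

/-- Pairs of positions in a block carry words of weight two, which connect the block, and evenness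
excludes words of weight one. The bound on the lengths is needed because δ_1 is zero. -/
theorem components_codeOf_parts (hn : offset L L.length ≤ n) (hL : ∀ s ∈ L, 2 ≤ s.length)
    (hev : IsEven (codeOf n (parts L).flatten)) : components (codeOf n (parts L).flatten) =
      Set.range fun j : Fin L.length => (L.get j).shift n (offset L j) := by
  refine components_eq (S := block n L) ?_ ?_ (mem_shift_iff hn) ?_ block_disjoint ?_ ?_
  · intro j hbot
    have h1 := hL _ (List.get_mem L j)
    have h2 := (offset_add_le_length j).trans hn
    have hne : (⟨offset L j, by omega⟩ : Fin n) ≠ ⟨offset L j + 1, by omega⟩ := by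
      intro h
      simp at h
    have h3 := pairWord_mem_shift hn (j := j) (i := ⟨offset L j, by omega⟩)
      (i' := ⟨offset L j + 1, by omega⟩) ⟨le_rfl, by simp only; omega⟩
      ⟨by simp only; omega, by simp only; omega⟩ hne
    rw [hbot, AddSubgroup.mem_bot] at h3
    exact (dec_pairWord_ne_zero hne).1 (congrFun h3 _)
  · exact fun j x hx => shift_le hn j (((mem_codeOf_parts hn).1 hx).1 j)
  · intro x hx i hi
    by_contra h
    push Not at h
    exact hi (((mem_codeOf_parts hn).1 hx).2 i h)
  · exact fun j i hi i' hi' h =>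
      ⟨_, shift_le hn j (pairWord_mem_shift hn hi hi' h), dec_pairWord_ne_zero h⟩
  · intro x hx i hi
    by_contra h
    have h3 : wt x = 1 := by
      rw [wt, hammingNorm, Finset.card_eq_one]
      refine ⟨i, Finset.eq_singleton_iff_unique_mem.2 ⟨by simpa using h, ?_⟩⟩
      intro k hk
      rw [Finset.mem_filter] at hk
      by_contra hki
      exact hk.2 (hi k hki)
    have := hev x hx
    rw [h3] at this
    exact absurd this (by decide)

theorem offset_length (L : List Component) :
    offset L L.length = ∑ j : Fin L.length, (L.get j).length := by
  rw [offset, List.take_length]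
  exact (Fin.sum_univ_fun_getElem L Component.length).symm

theorem hasType_codeOf_parts (hn : offset L L.length ≤ n) :
    HasType (codeOf n (parts L).flatten) L := by
  have hle : ∀ j : Fin L.length, offset L j + (L.get j).length ≤ n :=
    fun j => (offset_add_le_length j).trans hn
  -- The positions are enumerated block by block, followed by those belonging to no block.
  let f : ((j : Fin L.length) × Fin (L.get j).length) ⊕ Fin (n - offset L L.length) → Fin n :=
    Sum.elim (fun p => ⟨offset L p.1 + p.2, by have := hle p.1; omega⟩)
      fun i => ⟨offset L L.length + i, by omega⟩
  have hf : Function.Injective f := by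
    rintro (⟨j, i⟩ | i) (⟨j', i'⟩ | i') h
    · have h1 : offset L j + (i : ℕ) = offset L j' + i' := congrArg Fin.val h
      obtain rfl : j = j' := offset_disjoint (i := offset L j + i) ⟨by omega, by omega⟩
        ⟨by omega, by omega⟩
      congr 2
      exact Fin.ext (by omega)
    · have h1 : offset L j + (i : ℕ) = offset L L.length + i' := congrArg Fin.val h
      have := offset_add_le_length j
      omega
    · have h1 : offset L L.length + (i : ℕ) = offset L j' + i' := congrArg Fin.val h
      have := offset_add_le_length j'
      omega
    · have h1 : offset L L.length + (i : ℕ) = offset L L.length + i' := congrArg Fin.val h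
      congr 1
      exact Fin.ext (by omega)
  have hf' : Function.Bijective f := by
    refine (Fintype.bijective_iff_injective_and_card f).2 ⟨hf, ?_⟩
    rw [Fintype.card_sum, Fintype.card_sigma, Fintype.card_fin, Fintype.card_fin]
    simp only [Fintype.card_fin]
    rw [← offset_length]
    omega
  refine ⟨_, Equiv.ofBijective f hf', fun _ => AddEquiv.refl K, ?_⟩
  have hmem : ∀ x : Fin n → K, x ∈ codeOf n (parts L).flatten ↔ monomial (Equiv.ofBijective f hf')
      (fun _ => AddEquiv.refl K) x ∈ sum (directSum fun j : Fin L.length => (L.get j).code)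
        (⊥ : Code (Fin (n - offset L L.length))) := by
    intro x
    rw [mem_codeOf_parts hn]
    change _ ↔ (∀ j, (fun i : Fin (L.get j).length => x ⟨offset L j + i, _⟩) ∈ (L.get j).code) ∧
      (fun i : Fin (n - offset L L.length) => x ⟨offset L L.length + i, _⟩) ∈
        (⊥ : Code (Fin (n - offset L L.length)))
    refine and_congr (forall_congr' fun j => ?_) ?_
    · rw [mem_shift (hle j), and_iff_right]
      · have : (fun i : Fin (L.get j).length => (block n L j).indicator x
            ⟨offset L j + i, by have := hle j; omega⟩) = fun i : Fin (L.get j).length => x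
            ⟨offset L j + i, by have := hle j; omega⟩ := by
          funext i
          exact Set.indicator_of_mem (show _ ∈ block n L j from
            ⟨by simp only; omega, by simp only; omega⟩) _
        rw [this]
      · intro i hi
        refine Set.indicator_of_notMem ?_ _
        simp only [block, Set.mem_ofPred_eq]
        omega
    · rw [AddSubgroup.mem_bot]
      constructor
      · intro h
        funext i
        refine h _ fun j hj => ?_
        have h1 := offset_add_le_length j
        simp only [block, Set.mem_ofPred_eq] at hj
        omega
      · intro h i hi
        obtain ⟨p | p, hp⟩ := hf'.2 i
        · exact absurd (show i ∈ block n L p.1 from ⟨by rw [← hp]; simp [f], by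
            rw [← hp]; simp [f]⟩) (hi _)
        · rw [← hp]
          exact congrFun h p
  ext y
  constructor
  · rintro ⟨x, hx, rfl⟩
    exact (hmem x).1 hx
  · intro hy
    obtain ⟨x, rfl⟩ := (monomial (Equiv.ofBijective f hf') (fun _ => AddEquiv.refl K)).surjective y
    exact ⟨x, (hmem x).2 hy, rfl⟩

end sums

/-! ### The subcode of weight two and the orders of the groups -/

section orders

variable {n : ℕ}

/-- The group G_2 is Aut(C) modulo the kernel `fixComponents C` of its action on the components, and
G_1 is this kernel modulo G_0, so the two indices multiply. -/
theorem orderG1_mul_orderG2 (C : Code (Fin n)) :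
    orderG1 C * orderG2 C = (G0 C).relIndex (autGroup C) := by
  have h1 : orderG2 C = (fixComponents C).relIndex (autGroup C) := by
    rw [orderG2, relIndex_eq_ncard_image fun (g : Equiv.Perm (Fin n → K))
      (D : components (smallSubcode C)) => g • ((D : Code (Fin n)) : Set (Fin n → K))]
    · congr 1
      ext f
      constructor
      · rintro ⟨g, hg, h⟩
        exact ⟨g, hg, (funext h).symm⟩
      · rintro ⟨g, hg, rfl⟩
        exact ⟨g, hg, fun _ => rfl⟩
    · intro g hg h hh
      rw [fixComponents, Subgroup.mem_inf, and_iff_right (mul_mem (inv_mem hg) hh)]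
      simp only [Subgroup.mem_iInf, MulAction.mem_stabilizer_iff, mul_smul, inv_smul_eq_iff]
      constructor
      · exact fun e D hD => (congrFun e ⟨D, hD⟩).symm
      · exact fun e => funext fun D => (e D.1 D.2).symm
  rw [h1, orderG1]
  refine Subgroup.relIndex_mul_relIndex _ _ _ (fun g hg => hg.1) inf_le_left

/-- The words `ps` generate the subcode of weight two of the code generated by `gens`. -/
noncomputable def smallIs (n : ℕ) (gens ps : List ℕ) : Bool :=
  force (bitmap (words gens)) (fun B => ps.all fun g => inSet B g && Nat.beq (weight n g) 2) &&
    force (bitmap (words ps)) fun B => (words gens).all fun w =>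
      bif Nat.beq (weight n w) 2 then inSet B w else true

/-- Evenness leaves only the words of weight two. The test confirms that `ps` consists of such
codewords and that every such codeword is a sum of words of `ps`. -/
theorem smallSubcode_codeOf {gens ps : List ℕ} (hev : IsEven (codeOf n gens))
    (h : smallIs n gens ps = true) :
    smallSubcode (codeOf n gens) = codeOf n ps ∧ codeOf n ps ≤ codeOf n gens := by
  rw [smallIs, force_eq, force_eq, Bool.and_eq_true, List.all_eq_true, List.all_eq_true] at h
  obtain ⟨h1, h2⟩ := h
  have hps : ∀ g ∈ ps, dec n g ∈ codeOf n gens ∧ wt (dec n g) = 2 := by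
    intro g hg
    have := h1 g hg
    rw [Bool.and_eq_true, inSet_bitmap, Nat.beq_eq] at this
    exact ⟨mem_codeOf.2 ⟨g, this.1, rfl⟩, by rw [wt_dec, this.2]⟩
  refine ⟨le_antisymm ?_ (codeOf_le.2 fun g hg => AddSubgroup.subset_closure
    ⟨(hps g hg).1, Or.inr (hps g hg).2⟩), codeOf_le.2 fun g hg => (hps g hg).1⟩
  rw [smallSubcode, AddSubgroup.closure_le]
  rintro x ⟨hx, hx1 | hx2⟩
  · have := hev x hx
    rw [hx1] at this
    exact absurd this (by decide)
  · obtain ⟨w, hw, rfl⟩ := mem_codeOf.1 hx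
    rw [wt_dec] at hx2
    have := h2 w hw
    rw [hx2] at this
    exact mem_codeOf.2 ⟨w, (inSet_bitmap _ _).1 this, rfl⟩

/-- Both defining conditions of G_0 need to be checked on generators only. That `g` preserves the
code is then automatic, since g x differs from x by a word of the small subcode. -/
theorem card_G0 {gens : List ℕ} {L : List Component} (hgens : ∀ g ∈ gens, g < 4 ^ n)
    (hparts : ∀ p ∈ parts L, ∀ g ∈ p, g < 4 ^ n) (hev : IsEven (codeOf n gens))
    (hn : offset L L.length ≤ n) (hL : ∀ s ∈ L, 2 ≤ s.length)
    (hs : smallIs n gens (parts L).flatten = true) :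
    Nat.card (G0 (codeOf n gens)) = cosetFixOrder n gens (parts L) := by
  obtain ⟨hB, hBC⟩ := smallSubcode_codeOf hev hs
  have hcomp := components_codeOf_parts hn hL fun x hx => hev x (hBC hx)
  have hpart : ∀ p ∈ parts L, codeOf n p ≤ codeOf n (parts L).flatten := fun p hp =>
    codeOf_le.2 fun g hg => dec_mem_codeOf (List.mem_flatten.2 ⟨p, hp, hg⟩)
  refine card_cosetFix hgens hparts (fun p hp => (hpart p hp).trans hBC)
    (fun g hg => (mem_autGroup.1 hg.1.1).1) fun g hg => ?_
  have h1 : (∀ D ∈ components (smallSubcode (codeOf n gens)),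
      g • (D : Set (Fin n → K)) = D) ↔ ∀ p ∈ parts L, ∀ x ∈ p, g (dec n x) ∈ codeOf n p := by
    rw [hB, hcomp, Set.forall_mem_range, parts, List.forall_mem_map]
    simp only [List.mem_finRange, true_implies, smul_set_eq_iff]
    refine forall_congr' fun j => ?_
    rw [← codeOf_gens n _ _ ((offset_add_le_length j).trans hn)]
    exact ⟨fun h x hx => h _ (dec_mem_codeOf hx), isometry_maps_codeOf hg⟩
  have h2 : (∀ x ∈ codeOf n gens, g x - x ∈ smallSubcode (codeOf n gens)) ↔
      ∀ x ∈ gens, g (dec n x) + dec n x ∈ codeOf n (parts L).flatten := by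
    rw [hB]
    constructor
    · intro h x hx
      rw [← sub_word]
      exact h _ (dec_mem_codeOf hx)
    · intro h x hx
      have : codeOf n gens ≤ (codeOf n (parts L).flatten).comap
          (isometryHom hg - AddMonoidHom.id _) := codeOf_le.2 fun y hy => by
        have := h y hy
        rw [← sub_word] at this
        exact this
      exact this hx
  have h3 : g ∈ G0 (codeOf n gens) ↔ (g ∈ autGroup (codeOf n gens) ∧
      ∀ D ∈ components (smallSubcode (codeOf n gens)), g • (D : Set (Fin n → K)) = D) ∧
      ∀ x ∈ codeOf n gens, g x - x ∈ smallSubcode (codeOf n gens) := by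
    change g ∈ fixComponents (codeOf n gens) ∧ _ ↔ _
    rw [fixComponents, Subgroup.mem_inf]
    simp only [Subgroup.mem_iInf, MulAction.mem_stabilizer_iff]
  rw [h3, h1, h2, mem_autGroup]
  constructor
  · rintro ⟨⟨-, h4⟩, h5⟩
    exact ⟨h5, h4⟩
  · rintro ⟨h5, h4⟩
    refine ⟨⟨⟨hg, fun x hx => ?_⟩, h4⟩, h5⟩
    have h6 := h2.2 h5 x hx
    rw [hB] at h6
    have := add_mem (hBC h6) hx
    rwa [sub_add_cancel] at this

theorem orderG1_mul_orderG2_codeOf {gens : List ℕ} {L : List Component}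
    (hgens : ∀ g ∈ gens, g < 4 ^ n) (hparts : ∀ p ∈ parts L, ∀ g ∈ p, g < 4 ^ n)
    (hev : IsEven (codeOf n gens)) (hn : offset L L.length ≤ n) (hL : ∀ s ∈ L, 2 ≤ s.length)
    (hs : smallIs n gens (parts L).flatten = true) {m : ℕ}
    (hm : autOrder n gens = cosetFixOrder n gens (parts L) * m) :
    orderG1 (codeOf n gens) * orderG2 (codeOf n gens) = m := by
  rw [orderG1_mul_orderG2]
  have h1 := card_mul_relIndex (show G0 (codeOf n gens) ≤ autGroup (codeOf n gens) from
    fun g hg => hg.1.1)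
  rw [card_autGroup, hm, ← card_G0 hgens hparts hev hn hL hs] at h1
  exact Nat.eq_of_mul_eq_mul_left Nat.card_pos h1

end orders

/-! ### Children -/

section childAt

variable {ι κ μ : Type}

/-- The words of `C` whose symbols in each position are `0` or that of `w`, where `w` is not zero,
restricted to the positions given by `kept`. -/
def childAt (C : Code ι) (w : ι → K) (kept : κ → ι) : Code κ where
  carrier := {x | ∃ z ∈ C, (∀ i, w i ≠ 0 → z i = 0 ∨ z i = w i) ∧ x = z ∘ kept}
  zero_mem' := ⟨0, zero_mem _, fun _ _ => Or.inl rfl, rfl⟩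
  add_mem' := by
    rintro _ _ ⟨z, hz, h, rfl⟩ ⟨z', hz', h', rfl⟩
    have key : ∀ u k l : K, (k = 0 ∨ k = u) → (l = 0 ∨ l = u) → k + l = 0 ∨ k + l = u := by decide
    exact ⟨z + z', add_mem hz hz', fun i hi => key _ _ _ (h i hi) (h' i hi), rfl⟩
  neg_mem' := by
    intro x hx
    rwa [neg_word]

/-- The condition that an entry is 0 or that of `w` is unchanged when the same automorphism of `K`
is applied to both. -/
theorem childAt_map (C : Code ι) (w : ι → K) (e : μ ≃ ι) (σ : μ → (K ≃+ K)) (kept : κ → μ) :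
    childAt (C.map (monomial e σ).toAddMonoidHom) (monomial e σ w) kept =
      (childAt C w (e ∘ kept)).map
        (monomial (Equiv.refl κ) fun j => σ (kept j)).toAddMonoidHom := by
  have key : ∀ z : ι → K, (∀ i, monomial e σ w i ≠ 0 → monomial e σ z i = 0 ∨
      monomial e σ z i = monomial e σ w i) ↔ ∀ i, w i ≠ 0 → z i = 0 ∨ z i = w i := by
    intro z
    change (∀ i, σ i (w (e i)) ≠ 0 → σ i (z (e i)) = 0 ∨ σ i (z (e i)) = σ i (w (e i))) ↔ _
    simp only [ne_eq, EmbeddingLike.map_eq_zero_iff, EmbeddingLike.apply_eq_iff_eq]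
    constructor
    · intro h i
      have := h (e.symm i)
      rwa [Equiv.apply_symm_apply] at this
    · exact fun h i => h (e i)
  ext x
  constructor
  · rintro ⟨_, ⟨z, hz, rfl⟩, h, rfl⟩
    exact ⟨_, ⟨z, hz, (key z).1 h, rfl⟩, rfl⟩
  · rintro ⟨_, ⟨z, hz, h, rfl⟩, rfl⟩
    exact ⟨_, ⟨z, hz, rfl⟩, (key z).2 h, rfl⟩

theorem childAt_comp (C : Code ι) (w : ι → K) (kept : κ → ι) (π : μ ≃ κ) :
    childAt C w (kept ∘ π) =
      (childAt C w kept).map (monomial π fun _ => AddEquiv.refl K).toAddMonoidHom := by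
  ext x
  constructor
  · rintro ⟨z, hz, h, rfl⟩
    exact ⟨_, ⟨z, hz, h, rfl⟩, rfl⟩
  · rintro ⟨_, ⟨z, hz, h, rfl⟩, rfl⟩
    exact ⟨z, hz, h, rfl⟩

end childAt

/-! ### Cosets of δ_k and the residue -/

section words

variable {κ : Type} [Fintype κ]

theorem scalar_of_zero_or_a {y y' : κ → K} (h : ∀ j, y j = 0 ∨ y j = a)
    (h' : ∀ j, y' j = 0 ∨ y' j = a) : scalar y y' = 0 := by
  have key : ∀ k l : K, (k = 0 ∨ k = a) → (l = 0 ∨ l = a) → dot k l = 0 := by decide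
  exact Finset.sum_eq_zero fun j _ => key _ _ (h j) (h' j)

theorem scalar_single [DecidableEq κ] (y : κ → K) (j : κ) (l : K) :
    scalar y (Pi.single j l) = dot (y j) l := by
  have key : ∀ l : K, dot l 0 = 0 := by decide
  rw [scalar, Finset.sum_eq_single j, Pi.single_eq_same]
  · intro i _ hij
    rw [Pi.single_eq_of_ne hij]
    exact key _
  · simp

theorem dot_a_eq_zero : ∀ {l : K}, dot l a = 0 ↔ l = 0 ∨ l = a := by decide

theorem wt_add_cast {y y' : κ → K} (h : scalar y y' = 0) :
    (wt (y + y') : ZMod 2) = wt y + wt y' := by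
  rw [scalar_eq_wt] at h
  have key : ∀ p q r : ZMod 2, p + q + r = 0 → r = p + q := by decide
  exact key _ _ _ h

theorem not_even_wt_iff (x : κ → K) : ¬ Even (wt x) ↔ (wt x : ZMod 2) = 1 := by
  rw [even_wt_iff]
  have key : ∀ p : ZMod 2, p ≠ 0 ↔ p = 1 := by decide
  exact key _

theorem odd_wt_iff (x : κ → K) : Odd (wt x) ↔ (wt x : ZMod 2) = 1 := by
  rw [← Nat.not_even_iff_odd, not_even_wt_iff]

variable {k : ℕ}

theorem mem_delta {y : Fin k → K} :
    y ∈ delta k ↔ (∀ j, y j = 0 ∨ y j = a) ∧ (wt y : ZMod 2) = 0 :=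
  and_congr_right fun _ => even_wt_iff y

theorem mem_deltaCoset {y v : Fin k → K} : y ∈ deltaCoset v ↔ y + v ∈ delta k := by
  rw [← sub_word]
  rfl

theorem wordA_eq (k : ℕ) (j : Fin k) : wordA k j = 0 ∨ wordA k j = a := by
  rw [wordA]
  split_ifs
  · exact Or.inr rfl
  · exact Or.inl rfl

theorem wt_wordA (hk : 1 ≤ k) : (wt (wordA k) : ZMod 2) = 1 := by
  have : wt (wordA k) = 1 := by
    rw [wt, hammingNorm, Finset.card_eq_one]
    refine ⟨⟨0, hk⟩, Finset.eq_singleton_iff_unique_mem.2 ⟨?_, fun j hj => ?_⟩⟩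
    · rw [Finset.mem_filter]
      exact ⟨Finset.mem_univ _, show a ≠ 0 by decide⟩
    · rw [Finset.mem_filter] at hj
      refine Fin.ext ?_
      by_contra h
      exact hj.2 (if_neg h)
  rw [this]
  rfl

theorem add_zero_or_a {κ : Type} {y y' : κ → K} (h : ∀ j, y j = 0 ∨ y j = a)
    (h' : ∀ j, y' j = 0 ∨ y' j = a) (j : κ) : (y + y') j = 0 ∨ (y + y') j = a :=
  zero_or_a_add _ _ (h j) (h' j)

theorem add_wordA_mem_delta (hk : 1 ≤ k) {y : Fin k → K} :
    y + wordA k ∈ delta k ↔ (∀ j, y j = 0 ∨ y j = a) ∧ (wt y : ZMod 2) = 1 := by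
  have key : ∀ p : ZMod 2, p + 1 = 0 ↔ p = 1 := by decide
  rw [mem_delta]
  constructor
  · rintro ⟨h1, h2⟩
    have h3 := add_zero_or_a h1 (wordA_eq k)
    rw [add_assoc, add_self_word, add_zero] at h3
    rw [wt_add_cast (scalar_of_zero_or_a h3 (wordA_eq k)), wt_wordA hk, key] at h2
    exact ⟨h3, h2⟩
  · rintro ⟨h1, h2⟩
    refine ⟨add_zero_or_a h1 (wordA_eq k), ?_⟩
    rw [wt_add_cast (scalar_of_zero_or_a h1 (wordA_eq k)), wt_wordA hk, key]
    exact h2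

/-- Modulo `δ_k`, a word with entries `0` and `a` is `0` or `(a, 0, …, 0)`. -/
theorem mem_delta_or (hk : 1 ≤ k) {y : Fin k → K} :
    (∀ j, y j = 0 ∨ y j = a) ↔ y ∈ delta k ∨ y + wordA k ∈ delta k := by
  rw [mem_delta, add_wordA_mem_delta hk]
  have key : ∀ p : ZMod 2, p = 0 ∨ p = 1 := by decide
  constructor
  · intro h
    exact (key (wt y)).imp (fun h' => ⟨h, h'⟩) fun h' => ⟨h, h'⟩
  · rintro (h | h)
    · exact h.1
    · exact h.1

variable {m : ℕ}

theorem scalar_elim (x x' : Fin m → K) (y y' : Fin k → K) :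
    scalar (Sum.elim x y) (Sum.elim x' y') = scalar x x' + scalar y y' := by
  simp [scalar, Fintype.sum_sum_type]

theorem wt_elim (x : Fin m → K) (y : Fin k → K) :
    (wt (Sum.elim x y) : ZMod 2) = wt x + wt y := by
  rw [wt_cast, wt_cast, wt_cast, Fintype.sum_sum_type]
  rfl

theorem elim_add (x x' : Fin m → K) (y y' : Fin k → K) :
    Sum.elim x y + Sum.elim x' y' = Sum.elim (x + x') (y + y') := by
  funext i
  cases i <;> rfl

theorem forall_elim {p : (Fin m ⊕ Fin k → K) → Prop} :
    (∀ z, p z) ↔ ∀ x y, p (Sum.elim x y) :=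
  ⟨fun h _ _ => h _, fun h z => by
    have := h (z ∘ Sum.inl) (z ∘ Sum.inr)
    rwa [Sum.elim_comp_inl_inr] at this⟩

/-- The child of a code at the last `k` positions. -/
def residue (P : Code (Fin m ⊕ Fin k)) : Code (Fin m) :=
  childAt P (Sum.elim 0 fun _ => a) Sum.inl

theorem mem_residue {P : Code (Fin m ⊕ Fin k)} {x : Fin m → K} :
    x ∈ residue P ↔ ∃ y, (∀ j, y j = 0 ∨ y j = a) ∧ Sum.elim x y ∈ P := by
  constructor
  · rintro ⟨z, hz, h, rfl⟩
    refine ⟨z ∘ Sum.inr, fun j => h (Sum.inr j) (show a ≠ 0 by decide), ?_⟩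
    rwa [Sum.elim_comp_inl_inr]
  · rintro ⟨y, hy, h⟩
    refine ⟨_, h, ?_, rfl⟩
    rintro (i | j) hi
    · exact absurd rfl hi
    · exact hy j

theorem isParentOf_iff {D : Code (Fin m)} {P : Code (Fin m ⊕ Fin k)} : IsParentOf D k P ↔
    (IsEven D ∧ ∀ x y, Sum.elim x y ∈ P ↔ x ∈ D ∧ (y ∈ delta k ∨ y + wordB k ∈ delta k)) ∨
    (¬ IsEven D ∧ ∃ w : Fin m → K, w ∉ D ∧ (∀ x ∈ D, Even (wt x) → scalar w x = 0) ∧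
      ∀ x y, Sum.elim x y ∈ P ↔
        ((x ∈ D ∧ Even (wt x)) ∧ y ∈ delta k) ∨
        ((x ∈ D ∧ Odd (wt x)) ∧ y + wordA k ∈ delta k) ∨
        ((x + w ∈ D ∧ Even (wt (x + w))) ∧ y + wordB k ∈ delta k) ∨
        ((x + w ∈ D ∧ Odd (wt (x + w))) ∧ y + (wordA k + wordB k) ∈ delta k)) := by
  rw [IsParentOf, forall_elim]
  simp only [forall_elim (m := m) (k := k), Sum.elim_inl, Sum.elim_inr, Set.mem_union,
    mem_deltaCoset, add_zero, Set.mem_ofPred_eq, sub_word]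

end words

/-! ### Recovering a child from its parent -/

section parents

variable {m k : ℕ}

theorem wordB_not_zero_or_a (hk : 1 ≤ k) {y : Fin k → K} (h : ∀ j, y j = 0 ∨ y j = a)
    (h' : ∀ j, (y + wordB k) j = 0 ∨ (y + wordB k) j = a) : False := by
  have key : ∀ u : K, (u = 0 ∨ u = a) → (u + b = 0 ∨ u + b = a) → False := by decide
  exact key _ (h ⟨0, hk⟩) (h' ⟨0, hk⟩)

/-- The words of δ_k^0 and δ_k^1 have entries 0 and a, those of δ_k^2 and δ_k^3 have entries b and
c. So the residue keeps D_0 and D_1, or all of an even D, and nothing else. -/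
theorem IsParentOf.residue_eq (hk : 1 ≤ k) {D : Code (Fin m)} {P : Code (Fin m ⊕ Fin k)}
    (h : IsParentOf D k P) : residue P = D := by
  ext x
  rw [mem_residue]
  obtain ⟨-, h⟩ | ⟨-, w, -, -, h⟩ := isParentOf_iff.1 h
  · constructor
    · rintro ⟨y, -, hy⟩
      exact ((h x y).1 hy).1
    · exact fun hx => ⟨0, fun _ => Or.inl rfl, (h x 0).2 ⟨hx, Or.inl (zero_mem _)⟩⟩
  · constructor
    · rintro ⟨y, hA, hy⟩
      obtain h1 | h1 | h1 | h1 := (h x y).1 hy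
      · exact h1.1.1
      · exact h1.1.1
      · exact (wordB_not_zero_or_a hk hA (mem_delta.1 h1.2).1).elim
      · refine (wordB_not_zero_or_a hk (add_zero_or_a hA (wordA_eq k)) ?_).elim
        rw [add_assoc]
        exact (mem_delta.1 h1.2).1
    · intro hx
      by_cases hev : Even (wt x)
      · exact ⟨0, fun _ => Or.inl rfl, (h x 0).2 (Or.inl ⟨⟨hx, hev⟩, zero_mem _⟩)⟩
      · refine ⟨wordA k, wordA_eq k,
          (h x _).2 (Or.inr (Or.inl ⟨⟨hx, Nat.not_even_iff_odd.1 hev⟩, ?_⟩))⟩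
        rw [add_self_word]
        exact zero_mem _

theorem IsParentOf.elim_zero_mem {D : Code (Fin m)} {P : Code (Fin m ⊕ Fin k)}
    (h : IsParentOf D k P) {y : Fin k → K} (hy : y ∈ delta k) : Sum.elim (0 : Fin m → K) y ∈ P := by
  obtain ⟨-, h⟩ | ⟨-, w, -, -, h⟩ := isParentOf_iff.1 h
  · exact (h 0 y).2 ⟨zero_mem _, Or.inl hy⟩
  · exact (h 0 y).2 (Or.inl ⟨⟨zero_mem _, by simp [wt]⟩, hy⟩)

variable {P : Code (Fin m ⊕ Fin k)}

/-- The words which are zero in the first positions and have entries `0` and `a` in the last `k`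
positions. -/
def tailCode (m k : ℕ) : Code (Fin m ⊕ Fin k) where
  carrier := {z | (∀ i, z (Sum.inl i) = 0) ∧ ∀ j, z (Sum.inr j) = 0 ∨ z (Sum.inr j) = a}
  zero_mem' := ⟨fun _ => rfl, fun _ => Or.inl rfl⟩
  add_mem' := fun {z z'} h h' => ⟨fun i => by rw [Pi.add_apply, h.1, h'.1, add_zero], fun j =>
    zero_or_a_add _ _ (h.2 j) (h'.2 j)⟩
  neg_mem' := fun {z} h => by rwa [neg_word]

/-- If x is orthogonal to the residue, then (x, 0) is orthogonal to the words of P with last entries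
in {0, a}, which form the dual of P + `tailCode m k`. By double duality (x, 0) lies in this sum, and
subtracting its second summand shows that x is in the residue. -/
theorem isSelfDual_residue (hP : IsSelfDual P) : IsSelfDual (residue P) := by
  refine le_antisymm ?_ ?_
  · intro x hx
    have h1 : Sum.elim x 0 ∈ dual (dual (P ⊔ tailCode m k)) := by
      intro u hu
      have h2 : u ∈ P := by
        rw [← show dual P = P from hP]
        exact fun z hz => hu z (AddSubgroup.mem_sup_left hz)
      have h3 : ∀ j, u (Sum.inr j) = 0 ∨ u (Sum.inr j) = a := by
        intro j
        have h4 : Sum.elim (0 : Fin m → K) (Pi.single j a) ∈ tailCode m k := by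
          refine ⟨fun _ => rfl, fun i => ?_⟩
          change (Pi.single j a : Fin k → K) i = 0 ∨ (Pi.single j a : Fin k → K) i = a
          by_cases hij : i = j
          · subst hij
            rw [Pi.single_eq_same]
            exact Or.inr rfl
          · rw [Pi.single_eq_of_ne hij]
            exact Or.inl rfl
        have h5 := hu _ (AddSubgroup.mem_sup_right h4)
        rw [← Sum.elim_comp_inl_inr u, scalar_elim, scalar_comm, scalar_zero_left, zero_add,
          scalar_single, dot_a_eq_zero] at h5
        exact h5
      rw [← Sum.elim_comp_inl_inr u, scalar_elim, scalar_zero_left, add_zero]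
      refine hx _ (mem_residue.2 ⟨_, h3, ?_⟩)
      exact (Sum.elim_comp_inl_inr u).symm ▸ h2
    rw [dual_dual, AddSubgroup.mem_sup] at h1
    obtain ⟨z, hz, t, ht, h⟩ := h1
    refine mem_residue.2 ⟨z ∘ Sum.inr, fun j => ?_, ?_⟩
    · have h2 : z (Sum.inr j) + t (Sum.inr j) = 0 := congrFun h (Sum.inr j)
      have key : ∀ u v : K, u + v = 0 → (v = 0 ∨ v = a) → u = 0 ∨ u = a := by decide
      exact key _ _ h2 (ht.2 j)
    · have h2 : x = z ∘ Sum.inl := by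
        funext i
        have h3 : z (Sum.inl i) + t (Sum.inl i) = x i := congrFun h (Sum.inl i)
        rw [ht.1, add_zero] at h3
        exact h3.symm
      rw [h2, Sum.elim_comp_inl_inr]
      exact hz
  · rintro x hx y hy
    obtain ⟨u, hu, hxu⟩ := mem_residue.1 hx
    obtain ⟨v, hv, hyv⟩ := mem_residue.1 hy
    have h1 : Sum.elim x u ∈ dual P := (show dual P = P from hP).ge hxu
    have h2 := h1 _ hyv
    rwa [scalar_elim, scalar_of_zero_or_a hu hv, add_zero] at h2

end parents

/-! ### Every suitable code is a parent of its residue -/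

section backward

variable {m k : ℕ} {P : Code (Fin m ⊕ Fin k)}

theorem wordA_eq_single (hk : 1 ≤ k) : wordA k = Pi.single ⟨0, hk⟩ a := by
  funext j
  by_cases h : (j : ℕ) = 0
  · obtain rfl : j = ⟨0, hk⟩ := Fin.ext h
    rw [Pi.single_eq_same]
    rfl
  · rw [Pi.single_eq_of_ne fun h' => h (congrArg Fin.val h')]
    exact if_neg h

theorem scalar_wordA (hk : 1 ≤ k) (y : Fin k → K) : scalar y (wordA k) = dot (y ⟨0, hk⟩) a := by
  rw [wordA_eq_single hk, scalar_single]

/-- In each word the last `k` entries lie in `{0, a}` or in `{b, c}`. -/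
theorem zero_or_a_or (hk : 1 ≤ k) (hsd : IsSelfDual P)
    (hδ : ∀ y ∈ delta k, Sum.elim (0 : Fin m → K) y ∈ P) {x : Fin m → K} {y : Fin k → K}
    (h : Sum.elim x y ∈ P) : (∀ j, y j = 0 ∨ y j = a) ∨
      ∀ j, (y + wordB k) j = 0 ∨ (y + wordB k) j = a := by
  have h1 : ∀ j, dot (y ⟨0, hk⟩) a = dot (y j) a := by
    intro j
    have hs : ∀ i, (Pi.single j a : Fin k → K) i = 0 ∨ (Pi.single j a : Fin k → K) i = a := by
      intro i
      by_cases hij : i = j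
      · subst hij
        rw [Pi.single_eq_same]
        exact Or.inr rfl
      · rw [Pi.single_eq_of_ne hij]
        exact Or.inl rfl
    -- The word with `a` in the first position and in position `j`, or zero if these coincide.
    -- Orthogonality to it compares the two entries.
    have h2 : Pi.single j a + wordA k ∈ delta k := by
      refine (add_wordA_mem_delta hk).2 ⟨hs, ?_⟩
      rw [wt, hammingNorm, Finset.card_eq_one.2 ⟨j, ?_⟩]
      · rfl
      · ext i
        rw [Finset.mem_filter, Finset.mem_singleton]
        constructor
        · rintro ⟨-, hi⟩
          by_contra hij
          exact hi (Pi.single_eq_of_ne hij _)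
        · rintro rfl
          rw [Pi.single_eq_same]
          exact ⟨Finset.mem_univ _, by decide⟩
    have h3 : Sum.elim x y ∈ dual P := (show dual P = P from hsd).ge h
    have h4 := h3 _ (hδ _ h2)
    rw [scalar_elim, scalar_comm, scalar_zero_left, zero_add, scalar_add_right, scalar_single,
      scalar_wordA hk] at h4
    have key : ∀ p q : ZMod 2, p + q = 0 → q = p := by decide
    exact key _ _ h4
  have key : ∀ u : K, dot u a ≠ 0 → u + b = 0 ∨ u + b = a := by decide
  by_cases h0 : dot (y ⟨0, hk⟩) a = 0
  · exact Or.inl fun j => dot_a_eq_zero.1 ((h1 j).symm.trans h0)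
  · exact Or.inr fun j => key _ fun h => h0 ((h1 j).trans h)

theorem wt_eq_of_mem (hev : IsEven P) {x : Fin m → K} {y : Fin k → K} (h : Sum.elim x y ∈ P) :
    (wt x : ZMod 2) = wt y := by
  have h1 := (even_wt_iff _).1 (hev _ h)
  rw [wt_elim] at h1
  have key : ∀ p q : ZMod 2, p + q = 0 → p = q := by decide
  exact key _ _ h1

/-- Two tails with entries 0 and a and the same parity differ by a word of δ_k, and evenness of `P`
prescribes the parity. -/
theorem elim_mem_iff (hev : IsEven P) (hδ : ∀ y ∈ delta k, Sum.elim (0 : Fin m → K) y ∈ P)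
    {x : Fin m → K} {y : Fin k → K} (hy : ∀ j, y j = 0 ∨ y j = a) :
    Sum.elim x y ∈ P ↔ x ∈ residue P ∧ (wt x : ZMod 2) = wt y := by
  constructor
  · exact fun h => ⟨mem_residue.2 ⟨y, hy, h⟩, wt_eq_of_mem hev h⟩
  · rintro ⟨hx, hxy⟩
    obtain ⟨y', hy', h⟩ := mem_residue.1 hx
    have h1 : y' + y ∈ delta k := by
      refine mem_delta.2 ⟨add_zero_or_a hy' hy, ?_⟩
      rw [wt_add_cast (scalar_of_zero_or_a hy' hy), ← hxy, ← wt_eq_of_mem hev h]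
      exact CharTwo.add_self_eq_zero _
    have h2 := add_mem h (hδ _ h1)
    rwa [elim_add, add_zero, ← add_assoc, add_self_word, zero_add] at h2

/-- The code has a word which is not orthogonal to `(0, …, 0, a, 0, …, 0)`. -/
theorem exists_mem_wordB (hk : 1 ≤ k) (hev : IsEven P) (hsd : IsSelfDual P)
    (hδ : ∀ y ∈ delta k, Sum.elim (0 : Fin m → K) y ∈ P) :
    ∃ (x : Fin m → K) (y : Fin k → K), Sum.elim x y ∈ P ∧
      ∀ j, (y + wordB k) j = 0 ∨ (y + wordB k) j = a := by
  by_contra hc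
  push Not at hc
  -- If all tails had entries 0 and a, this word of weight one would be orthogonal to `P` and so
  -- belong to it.
  have h1 : Sum.elim (0 : Fin m → K) (wordA k) ∈ P := by
    rw [← show dual P = P from hsd]
    intro z hz
    rw [← Sum.elim_comp_inl_inr z] at hz ⊢
    rw [scalar_elim, scalar_zero_left, zero_add]
    refine scalar_of_zero_or_a (wordA_eq k) ?_
    refine (zero_or_a_or hk hsd hδ hz).resolve_right fun h => ?_
    obtain ⟨j, hj⟩ := hc _ _ hz
    exact (h j).elim hj.1 hj.2
  have h2 := wt_eq_of_mem hev h1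
  rw [wt_wordA hk] at h2
  simp [wt] at h2

/-- If the residue has an odd word o, adding (o, a0…0) moves between the tails in δ_k^2 and those in
δ_k^3, so both occur. If the residue is even, only one of these cosets occurs, and `hb` says that it
is the right one. -/
theorem isParentOf_residue (hk : 1 ≤ k) (hev : IsEven P) (hsd : IsSelfDual P)
    (hδ : ∀ y ∈ delta k, Sum.elim (0 : Fin m → K) y ∈ P)
    (hb : IsEven (residue P) → ∃ (u : Fin m → K) (y : Fin k → K), Sum.elim u y ∈ P ∧
      y + wordB k ∈ delta k) : IsParentOf (residue P) k P := by
  have hD := isSelfDual_residue hsd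
  have hswap : ∀ y y' : Fin k → K, y + y' = (y + wordB k) + (y' + wordB k) := by
    intro y y'
    rw [show (y + wordB k) + (y' + wordB k) = (y + y') + (wordB k + wordB k) by abel,
      add_self_word, add_zero]
  rw [isParentOf_iff]
  by_cases hDev : IsEven (residue P)
  · refine Or.inl ⟨hDev, ?_⟩
    obtain ⟨u, v, huv, hv⟩ := hb hDev
    have hmem : ∀ x y, (∀ j, y j = 0 ∨ y j = a) →
        (Sum.elim x y ∈ P ↔ x ∈ residue P ∧ y ∈ delta k) := by
      intro x y hy
      rw [elim_mem_iff hev hδ hy, mem_delta, and_iff_right hy]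
      refine and_congr_right fun hx => ?_
      rw [(even_wt_iff _).1 (hDev x hx)]
      exact eq_comm
    -- So the first part of the word can be removed, and P splits as a direct sum.
    have hu : u ∈ residue P := by
      rw [← show dual (residue P) = residue P from hD]
      intro x hx
      have h1 : Sum.elim x 0 ∈ P := (hmem x 0 fun _ => Or.inl rfl).2 ⟨hx, zero_mem _⟩
      have h2 := (show dual P = P from hsd).ge huv _ h1
      rwa [scalar_elim, scalar_comm v, scalar_zero_left, add_zero] at h2
    have h0v : Sum.elim (0 : Fin m → K) v ∈ P := by
      have h1 : Sum.elim u 0 ∈ P := (hmem u 0 fun _ => Or.inl rfl).2 ⟨hu, zero_mem _⟩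
      have h2 := add_mem h1 huv
      rwa [elim_add, add_self_word, zero_add] at h2
    have hadd : ∀ x y, Sum.elim x y ∈ P ↔ Sum.elim x (y + v) ∈ P := by
      intro x y
      have h1 : ∀ x y, Sum.elim x y ∈ P → Sum.elim x (y + v) ∈ P := by
        intro x y h
        have h2 := add_mem h h0v
        rwa [elim_add, add_zero] at h2
      refine ⟨h1 x y, fun h => ?_⟩
      have h2 := h1 _ _ h
      rwa [add_assoc, add_self_word, add_zero] at h2
    intro x y
    constructor
    · intro h
      rcases zero_or_a_or hk hsd hδ h with hy | hy
      · have := (hmem x y hy).1 h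
        exact ⟨this.1, Or.inl this.2⟩
      · have h1 : ∀ j, (y + v) j = 0 ∨ (y + v) j = a := by
          rw [hswap]
          exact add_zero_or_a hy (mem_delta.1 hv).1
        have h2 := (hmem x _ h1).1 ((hadd x y).1 h)
        refine ⟨h2.1, Or.inr ?_⟩
        have h3 := add_mem h2.2 hv
        rwa [hswap y v, add_assoc, add_self_word, add_zero] at h3
    · rintro ⟨hx, hy | hy⟩
      · exact (hmem x y (mem_delta.1 hy).1).2 ⟨hx, hy⟩
      · have h1 : y + v ∈ delta k := by
          rw [hswap]
          exact add_mem hy hv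
        exact (hadd x y).2 ((hmem x _ (mem_delta.1 h1).1).2 ⟨hx, h1⟩)
  · refine Or.inr ⟨hDev, ?_⟩
    obtain ⟨o, ho, ho'⟩ : ∃ o ∈ residue P, (wt o : ZMod 2) = 1 := by
      simp only [IsEven] at hDev
      push Not at hDev
      obtain ⟨o, ho, h⟩ := hDev
      exact ⟨o, ho, (not_even_wt_iff o).1 h⟩
    have hoA : Sum.elim o (wordA k) ∈ P :=
      (elim_mem_iff hev hδ (wordA_eq k)).2 ⟨ho, by rw [ho', wt_wordA hk]⟩
    obtain ⟨w, v, hwv, hv⟩ : ∃ (w : Fin m → K) (v : Fin k → K), Sum.elim w v ∈ P ∧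
        v + wordB k ∈ delta k := by
      obtain ⟨u, y, huy, hy⟩ := exists_mem_wordB hk hev hsd hδ
      rcases (mem_delta_or hk).1 hy with h | h
      · exact ⟨u, y, huy, h⟩
      · refine ⟨_, _, elim_add .. ▸ add_mem huy hoA, ?_⟩
        rwa [add_right_comm]
    have hadd : ∀ x y, Sum.elim x y ∈ P ↔ Sum.elim (x + w) (y + v) ∈ P := by
      intro x y
      have h1 : ∀ x y, Sum.elim x y ∈ P → Sum.elim (x + w) (y + v) ∈ P := by
        intro x y h
        have h2 := add_mem h hwv
        rwa [elim_add] at h2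
      refine ⟨h1 x y, fun h => ?_⟩
      have h2 := h1 _ _ h
      rwa [add_assoc, add_assoc, add_self_word, add_self_word, add_zero, add_zero] at h2
    refine ⟨w, ?_, ?_, ?_⟩
    · intro hw
      obtain ⟨y, hy, hwy⟩ := mem_residue.1 hw
      have h1 := (hadd w y).1 hwy
      rw [add_self_word] at h1
      have h2 := (show dual P = P from hsd).ge h1 _ hoA
      rw [scalar_elim, scalar_zero_left, zero_add, scalar_wordA hk, dot_a_eq_zero] at h2
      have h3 := (mem_delta.1 hv).1 ⟨0, hk⟩
      have h4 := hy ⟨0, hk⟩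
      have key : ∀ p q : K, (p = 0 ∨ p = a) → (p + q = 0 ∨ p + q = a) →
          (q + b = 0 ∨ q + b = a) → False := by decide
      exact key _ _ h4 h2 h3
    · intro x hx hxe
      have h1 : Sum.elim x 0 ∈ P := (elim_mem_iff hev hδ fun _ => Or.inl rfl).2
        ⟨hx, by
          rw [(even_wt_iff _).1 hxe, show wt (fun _ : Fin k => (0 : K)) = 0 from hammingNorm_zero]
          rfl⟩
      have h2 := (show dual P = P from hsd).ge hwv _ h1
      rwa [scalar_elim, scalar_comm v, scalar_zero_left, add_zero] at h2
    · have hyv : ∀ y, (∀ j, (y + wordB k) j = 0 ∨ (y + wordB k) j = a) → ∀ x,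
          (Sum.elim x y ∈ P ↔ x + w ∈ residue P ∧
            (wt (x + w) : ZMod 2) = wt (y + wordB k)) := by
        intro y hy x
        have h1 : ∀ j, (y + v) j = 0 ∨ (y + v) j = a := by
          rw [hswap]
          exact add_zero_or_a hy (mem_delta.1 hv).1
        rw [hadd, elim_mem_iff hev hδ h1, hswap,
          wt_add_cast (scalar_of_zero_or_a hy (mem_delta.1 hv).1), (mem_delta.1 hv).2, add_zero]
      intro x y
      rw [even_wt_iff, odd_wt_iff, even_wt_iff, odd_wt_iff, add_comm (wordA k), ← add_assoc,
        add_wordA_mem_delta hk, add_wordA_mem_delta hk, mem_delta, mem_delta]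
      have key : ∀ p q : ZMod 2, p = q ↔ (p = 0 ∧ q = 0) ∨ (p = 1 ∧ q = 1) := by decide
      constructor
      · intro h
        rcases zero_or_a_or hk hsd hδ h with hy | hy
        · have h1 := (elim_mem_iff hev hδ hy).1 h
          obtain h2 | h2 := (key _ _).1 h1.2
          · exact Or.inl ⟨⟨h1.1, h2.1⟩, hy, h2.2⟩
          · exact Or.inr (Or.inl ⟨⟨h1.1, h2.1⟩, hy, h2.2⟩)
        · have h1 := (hyv y hy x).1 h
          obtain h2 | h2 := (key _ _).1 h1.2
          · exact Or.inr (Or.inr (Or.inl ⟨⟨h1.1, h2.1⟩, hy, h2.2⟩))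
          · exact Or.inr (Or.inr (Or.inr ⟨⟨h1.1, h2.1⟩, hy, h2.2⟩))
      · rintro (h | h | h | h)
        · exact (elim_mem_iff hev hδ h.2.1).2 ⟨h.1.1, h.1.2.trans h.2.2.symm⟩
        · exact (elim_mem_iff hev hδ h.2.1).2 ⟨h.1.1, h.1.2.trans h.2.2.symm⟩
        · exact (hyv y h.2.1 x).2 ⟨h.1.1, h.1.2.trans h.2.2.symm⟩
        · exact (hyv y h.2.1 x).2 ⟨h.1.1, h.1.2.trans h.2.2.symm⟩

/-- If the residue is even and the tails with entries b, c lie in δ_k^3, interchanging b and c in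
the first of the last `k` positions moves them to δ_k^2. Tails with entries 0 and a are not
affected, so the residue stays the same. -/
theorem exists_isParentOf_residue (hk : 1 ≤ k) (hev : IsEven P) (hsd : IsSelfDual P)
    (hδ : ∀ y ∈ delta k, Sum.elim (0 : Fin m → K) y ∈ P) :
    ∃ P', IsParentOf (residue P) k P' ∧ Equivalent P P' := by
  by_cases hb : IsEven (residue P) → ∃ (u : Fin m → K) (y : Fin k → K), Sum.elim u y ∈ P ∧
      y + wordB k ∈ delta k
  · exact ⟨P, isParentOf_residue hk hev hsd hδ hb, Equivalent.refl P⟩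
  · push Not at hb
    obtain ⟨-, hb⟩ := hb
    obtain ⟨u, y, huy, hy⟩ := exists_mem_wordB hk hev hsd hδ
    have hy' := ((mem_delta_or hk).1 hy).resolve_left (hb u y huy)
    -- This fixes a and interchanges b and c.
    let ρ : K ≃+ K := autK a c (by decide) (by decide)
    have hρ : ∀ l : K, (l = 0 ∨ l = a) → ρ l = l := by
      change ∀ l : K, (l = 0 ∨ l = a) → (l.1.val • a + l.2.val • c : K) = l
      decide
    have hρ' : ∀ l : K, (l + b = 0 ∨ l + b = a) → ρ l = l + a := by
      change ∀ l : K, (l + b = 0 ∨ l + b = a) → (l.1.val • a + l.2.val • c : K) = l + a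
      decide
    let τ : Fin m ⊕ Fin k → (K ≃+ K) := Sum.elim (fun _ => AddEquiv.refl K)
      fun j => if (j : ℕ) = 0 then ρ else AddEquiv.refl K
    have hτ : ∀ (x : Fin m → K) (y : Fin k → K), (∀ j, y j = 0 ∨ y j = a) →
        monomial (Equiv.refl _) τ (Sum.elim x y) = Sum.elim x y := by
      intro x y hy
      funext i
      rcases i with i | j
      · rfl
      · change (if (j : ℕ) = 0 then ρ else AddEquiv.refl K) (y j) = y j
        split_ifs
        · exact hρ _ (hy j)
        · rfl
    have he : Equivalent P (P.map (monomial (Equiv.refl _) τ).toAddMonoidHom) := ⟨_, _, rfl⟩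
    have hmem : ∀ (x : Fin m → K) (y : Fin k → K), (∀ j, y j = 0 ∨ y j = a) →
        (Sum.elim x y ∈ P.map (monomial (Equiv.refl _) τ).toAddMonoidHom ↔ Sum.elim x y ∈ P) := by
      intro x y hy
      constructor
      · rintro ⟨z, hz, h⟩
        have h1 : z = Sum.elim x y :=
          (monomial (Equiv.refl _) τ).injective (h.trans (hτ x y hy).symm)
        exact h1 ▸ hz
      · exact fun h => ⟨_, h, hτ x y hy⟩
    have hres : residue (P.map (monomial (Equiv.refl _) τ).toAddMonoidHom) = residue P := by
      ext x
      rw [mem_residue, mem_residue]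
      exact exists_congr fun y => and_congr_right fun hy => hmem x y hy
    refine ⟨_, ?_, he⟩
    rw [← hres]
    refine isParentOf_residue hk (he.isEven hev) (he.isSelfDual hsd)
      (fun y hy => (hmem 0 y (mem_delta.1 hy).1).2 (hδ y hy)) fun _ =>
      ⟨u, y + wordA k, ⟨_, huy, ?_⟩, ?_⟩
    · funext i
      rcases i with i | j
      · rfl
      · change (if (j : ℕ) = 0 then ρ else AddEquiv.refl K) (y j) = y j + wordA k j
        rw [wordA]
        split_ifs with hj
        · exact hρ' _ (hy j)
        · exact (add_zero _).symm
    · rwa [add_right_comm]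

end backward

/-! ### Children correspond to words of weight one or two -/

section isChild

variable {n m k : ℕ}

theorem monomial_elim_zero_a_ne {e : Fin n ≃ Fin m ⊕ Fin k} {σ : Fin n → (K ≃+ K)} {i : Fin n} :
    monomial e σ (Sum.elim (0 : Fin m → K) fun _ : Fin k => a) i = 0 ↔ ∃ j, e i = Sum.inl j := by
  change σ i ((Sum.elim 0 fun _ => a : Fin m ⊕ Fin k → K) (e i)) = 0 ↔ _
  rw [EmbeddingLike.map_eq_zero_iff]
  rcases e i with j | j
  · exact ⟨fun _ => ⟨j, rfl⟩, fun _ => rfl⟩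
  · simp only [Sum.elim_inr, reduceCtorEq, exists_false, iff_false]
    decide

theorem wt_elim_zero_a (m k : ℕ) : wt (Sum.elim (0 : Fin m → K) fun _ : Fin k => a) = k := by
  rw [wt, hammingNorm, Finset.card_filter, Fintype.sum_sum_type]
  have : a ≠ 0 := by decide
  simp [this]

/-- The word is the image of (0, a…a) under the equivalence of the parent with `C`. For k = 2 it is
a codeword, since aa lies in δ_2. -/
theorem IsChild.exists_word (hk : 1 ≤ k) {D : Code (Fin m)} {C : Code (Fin n)}
    (h : IsChild k D C) : ∃ w : Fin n → K, wt w = k ∧ (k = 2 → w ∈ C) ∧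
      ∀ kept : Fin m → Fin n, Function.Injective kept → (∀ j, w (kept j) = 0) →
        Equivalent D (childAt C w kept) := by
  obtain ⟨-, P, hP, e, σ, rfl⟩ := h
  refine ⟨monomial e σ (Sum.elim (0 : Fin m → K) fun _ => a), ?_, ?_, ?_⟩
  · rw [wt_monomial, wt_elim_zero_a]
  · rintro rfl
    refine ⟨_, hP.elim_zero_mem ?_, rfl⟩
    exact ⟨fun _ => Or.inr rfl, by decide⟩
  · intro kept hinj h0
    choose π hπ using fun j => monomial_elim_zero_a_ne.1 (h0 j)
    have hπi : Function.Injective π := by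
      intro i j hij
      refine hinj (e.injective ?_)
      rw [hπ, hπ, hij]
    have h1 : e ∘ kept = Sum.inl ∘ Equiv.ofBijective π (Finite.injective_iff_bijective.1 hπi) :=
      funext hπ
    rw [childAt_map, h1, childAt_comp, ← hP.residue_eq hk]
    exact Equivalent.trans ⟨_, _, rfl⟩ ⟨_, _, rfl⟩

theorem exists_aut_eq_a : ∀ u : K, u ≠ 0 → ∃ ρ : K ≃+ K, ρ u = a := by
  intro u hu
  have h1 : ∀ u : K, u ≠ 0 → u = a ∨ u = b ∨ u = c := by decide
  obtain rfl | rfl | rfl := h1 u hu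
  · exact ⟨AddEquiv.refl K, rfl⟩
  · exact ⟨autK b a (by decide) (by decide), rfl⟩
  · exact ⟨autK c b (by decide) (by decide), rfl⟩

/-- Up to equivalence `w` is (0, a…a). The parent must contain δ_k, which is zero for k = 1 and {00,
aa} for k = 2; this is why `w` is arbitrary in the first case and a codeword in the second. -/
theorem isChild_childAt (hk : k = 1 ∨ k = 2) (hn : n = m + k) {C : Code (Fin n)} (hev : IsEven C)
    (hsd : IsSelfDual C) {w : Fin n → K} (hw : wt w = k) (hwC : k = 2 → w ∈ C)
    {kept : Fin m → Fin n} (hinj : Function.Injective kept) (h0 : ∀ j, w (kept j) = 0) :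
    IsChild k (childAt C w kept) C := by
  have hcard : Fintype.card {i // w i ≠ 0} = Fintype.card (Fin k) := by
    rw [Fintype.card_subtype, Fintype.card_fin]
    exact hw
  let s := Fintype.equivOfCardEq hcard
  have hf : Function.Bijective (Sum.elim kept fun j => (s.symm j : Fin n)) := by
    refine (Fintype.bijective_iff_injective_and_card _).2 ⟨?_, by simp [hn]⟩
    refine Function.Injective.sumElim hinj (Subtype.val_injective.comp s.symm.injective) ?_
    intro i j h
    exact (s.symm j).2 (by rw [← h]; exact h0 i)
  let e : Fin m ⊕ Fin k ≃ Fin n := Equiv.ofBijective _ hf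
  choose ρ hρ using fun j => exists_aut_eq_a _ (s.symm j).2
  let σ : Fin m ⊕ Fin k → (K ≃+ K) := Sum.elim (fun _ => AddEquiv.refl K) ρ
  have hwe : monomial e σ w = Sum.elim (0 : Fin m → K) fun _ => a := by
    funext i
    rcases i with i | j
    · exact h0 i
    · exact hρ j
  have he : Equivalent C (C.map (monomial e σ).toAddMonoidHom) := ⟨_, _, rfl⟩
  have hres : residue (C.map (monomial e σ).toAddMonoidHom) = childAt C w kept := by
    rw [residue, ← hwe, childAt_map]
    have h1 : (monomial (Equiv.refl (Fin m)) fun j => σ (Sum.inl j)) = AddEquiv.refl _ :=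
      monomial_refl
    rw [h1]
    exact AddSubgroup.map_id _
  have hδ : ∀ y ∈ delta k, Sum.elim (0 : Fin m → K) y ∈ C.map (monomial e σ).toAddMonoidHom := by
    intro y hy
    have h1 : y = 0 ∨ (k = 2 ∧ y = fun _ => a) := by
      obtain rfl | rfl := hk
      · have key : ∀ y : Fin 1 → K, ((∀ i, y i = 0 ∨ y i = a) ∧ Even (hammingNorm y)) → y = 0 := by
          decide
        exact Or.inl (key y hy)
      · have key : ∀ y : Fin 2 → K, ((∀ i, y i = 0 ∨ y i = a) ∧ Even (hammingNorm y)) →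
            y = 0 ∨ (2 = 2 ∧ y = fun _ => a) := by
          decide
        exact key y hy
    obtain rfl | ⟨h2, rfl⟩ := h1
    · have : Sum.elim (0 : Fin m → K) (0 : Fin k → K) = 0 := by
        funext i
        cases i <;> rfl
      rw [this]
      exact zero_mem _
    · exact ⟨w, hwC h2, hwe⟩
  obtain ⟨P, hP, hP'⟩ := exists_isParentOf_residue (hk.elim (fun h => h.ge) fun h => by omega)
    (he.isEven hev) (he.isSelfDual hsd) hδ
  rw [hres] at hP
  refine ⟨?_, P, hP, (he.trans hP').symm⟩
  rw [← hres]
  exact isSelfDual_residue (he.isSelfDual hsd)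

end isChild

/-! ### Computation of children -/

/-- The digit `d` is neither `0` nor `e`. -/
def clash (d e : ℕ) : Bool := !(Nat.beq d 0 || Nat.beq d e)

theorem clash_iff {d e : ℕ} (hd : d < 4) (he : e < 4) (h0 : e ≠ 0) :
    clash d e = true ↔ dot (sym d) (sym e) = 1 := by
  interval_cases d <;> interval_cases e <;> first | exact absurd rfl h0 | decide

/-- Generators of the sums of the given words on which a linear functional vanishes. -/
def kernel (φ : ℕ → Bool) : List ℕ → List ℕ
  | [] => []
  | g :: gs => bif φ g then gs.map fun h => bif φ h then Nat.xor g h else h else g :: kernel φ gs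

/-- Elimination: the first generator on which the functional is nonzero serves as pivot. It is
dropped and added to each later generator on which the functional is nonzero. -/
theorem mem_codeOf_kernel {n : ℕ} {φ : ℕ → Bool} (ψ : (Fin n → K) →+ ZMod 2)
    (hφ : ∀ w, φ w = true ↔ ψ (dec n w) = 1) {gens : List ℕ} {z : Fin n → K} :
    z ∈ codeOf n (kernel φ gens) ↔ z ∈ codeOf n gens ∧ ψ z = 0 := by
  have h01 : ∀ p : ZMod 2, p ≠ 1 → p = 0 := by decide
  have h11 : ∀ p q : ZMod 2, p = 1 → q = 1 → p + q = 0 := by decide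
  have h10 : ∀ p : ZMod 2, p + 1 = 1 → p = 0 := by decide
  induction gens generalizing z with
  | nil =>
    rw [kernel, mem_codeOf]
    simp only [words, List.mem_singleton, exists_eq_left, dec_zero]
    exact ⟨fun h => ⟨h, by rw [← h, map_zero]⟩, fun h => h.1⟩
  | cons g gs ih =>
    by_cases hg : φ g = true
    · have hg' := (hφ g).1 hg
      rw [kernel, hg, cond_true]
      constructor
      · have hle : codeOf n (gs.map fun h => bif φ h then Nat.xor g h else h) ≤
            codeOf n (g :: gs) ⊓ ψ.ker := by
          refine codeOf_le.2 fun w hw => ?_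
          obtain ⟨h, hh, rfl⟩ := List.mem_map.1 hw
          have h1 : dec n h ∈ codeOf n (g :: gs) := dec_mem_codeOf (List.mem_cons_of_mem _ hh)
          by_cases hp : φ h = true
          · rw [hp, cond_true, dec_xor]
            refine ⟨add_mem (dec_mem_codeOf List.mem_cons_self) h1, ?_⟩
            change ψ _ = 0
            rw [map_add]
            exact h11 _ _ hg' ((hφ h).1 hp)
          · rw [Bool.eq_false_iff.2 hp, cond_false]
            exact ⟨h1, h01 _ fun h => hp ((hφ _).2 h)⟩
        exact fun hz => hle hz
      · have key : ∀ u ∈ codeOf n gs,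
            (ψ u = 0 → u ∈ codeOf n (gs.map fun h => bif φ h then Nat.xor g h else h)) ∧
            (ψ u = 1 → dec n g + u ∈
              codeOf n (gs.map fun h => bif φ h then Nat.xor g h else h)) := by
          intro u hu
          refine AddSubgroup.closure_induction (p := fun u _ =>
            (ψ u = 0 → u ∈ codeOf n (gs.map fun h => bif φ h then Nat.xor g h else h)) ∧
            (ψ u = 1 → dec n g + u ∈
              codeOf n (gs.map fun h => bif φ h then Nat.xor g h else h))) ?_ ?_ ?_ ?_ hu
          · rintro _ ⟨h, hh, rfl⟩
            have h1 := dec_mem_codeOf (n := n)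
              (List.mem_map_of_mem (f := fun h => bif φ h then Nat.xor g h else h) hh)
            by_cases hp : φ h = true
            · rw [hp, cond_true, dec_xor] at h1
              refine ⟨fun h0 => ?_, fun _ => h1⟩
              rw [(hφ h).1 hp] at h0
              exact absurd h0 (by decide)
            · rw [Bool.eq_false_iff.2 hp, cond_false] at h1
              exact ⟨fun _ => h1, fun h2 => absurd ((hφ h).2 h2) hp⟩
          · refine ⟨fun _ => zero_mem _, fun h => ?_⟩
            rw [map_zero] at h
            exact absurd h (by decide)
          · rintro x y - - ⟨hx, hx'⟩ ⟨hy, hy'⟩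
            rw [map_add]
            have hs : (dec n g + x) + (dec n g + y) = x + y := by
              rw [show (dec n g + x) + (dec n g + y) = (dec n g + dec n g) + (x + y) by abel,
                add_self_word, zero_add]
            have hc : ∀ p : ZMod 2, p = 0 ∨ p = 1 := by decide
            obtain h | h := hc (ψ x) <;> obtain h' | h' := hc (ψ y) <;> rw [h, h']
            · refine ⟨fun _ => add_mem (hx h) (hy h'), fun h2 => absurd h2 (by decide)⟩
            · refine ⟨fun h2 => absurd h2 (by decide), fun _ => ?_⟩
              rw [add_left_comm]
              exact add_mem (hx h) (hy' h')
            · refine ⟨fun h2 => absurd h2 (by decide), fun _ => ?_⟩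
              rw [← add_assoc]
              exact add_mem (hx' h) (hy h')
            · refine ⟨fun _ => ?_, fun h2 => absurd h2 (by decide)⟩
              rw [← hs]
              exact add_mem (hx' h) (hy' h')
          · intro x _ hx
            rwa [neg_word]
        rintro ⟨hz, h0⟩
        obtain hz | hz := mem_codeOf_cons.1 hz
        · exact (key z hz).1 h0
        · have h1 := (key _ hz).2 (by rw [map_add, hg', h0, add_zero])
          rwa [← add_assoc, add_self_word, zero_add] at h1
    · have hg' : ψ (dec n g) = 0 := h01 _ fun h => hg ((hφ g).2 h)
      rw [kernel, Bool.eq_false_iff.2 hg, cond_false, mem_codeOf_cons, mem_codeOf_cons]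
      refine (or_congr ih ih).trans ?_
      rw [map_add, hg', zero_add]
      tauto

/-- The word formed by the digits of a word in the given positions. -/
def pull : List ℕ → ℕ → ℕ
  | [], _ => 0
  | p :: ps, v => Nat.add (dig v p) (Nat.mul 4 (pull ps v))

theorem dig_pull (ps : List ℕ) (v : ℕ) {j : ℕ} (hj : j < ps.length) :
    dig (pull ps v) j = dig v ps[j] := by
  induction ps generalizing j with
  | nil => simp at hj
  | cons p ps ih =>
    have h : pull (p :: ps) v = dig v p + 4 * pull ps v := rfl
    have hp := dig_lt v p
    cases j with
    | zero =>
      rw [dig_eq, h, List.getElem_cons_zero]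
      omega
    | succ j =>
      rw [List.getElem_cons_succ, ← ih (by simpa using hj), dig_eq, dig_eq, h, pow_succ',
        ← Nat.div_div_eq_div_mul]
      congr 2
      omega

/-- The positions of the digit `0` of a word. -/
def zeros (n w : ℕ) : List ℕ := (List.range n).filter fun i => Nat.beq (dig w i) 0

/-- The positions of the nonzero digits of a word. -/
def support (n w : ℕ) : List ℕ := (List.range n).filter fun i => !Nat.beq (dig w i) 0

theorem mem_zeros {n w i : ℕ} : i ∈ zeros n w ↔ i < n ∧ dig w i = 0 := by
  rw [zeros, List.mem_filter, List.mem_range, Nat.beq_eq]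

theorem mem_support {n w i : ℕ} : i ∈ support n w ↔ i < n ∧ dig w i ≠ 0 := by
  rw [support, List.mem_filter, List.mem_range, Bool.not_eq_true', Bool.eq_false_iff, Ne,
    Nat.beq_eq]

theorem length_support (n w : ℕ) : (support n w).length = wt (dec n w) := by
  rw [wt_dec, weight_eq_countP, support, List.countP_eq_length_filter]
  congr 2
  funext i
  rw [Bool.eq_iff_iff, Bool.not_eq_true', Bool.eq_false_iff, Ne, Nat.beq_eq, decide_eq_true_iff]

theorem length_zeros (n w : ℕ) : (zeros n w).length + wt (dec n w) = n := by
  have h := List.length_eq_countP_add_countP (l := List.range n) fun i => Nat.beq (dig w i) 0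
  rw [List.length_range] at h
  rw [← length_support, support, zeros, ← List.countP_eq_length_filter,
    ← List.countP_eq_length_filter]
  refine Eq.trans (congrArg _ (List.countP_congr fun i _ => ?_)) h.symm
  rw [decide_eq_true_iff, Bool.not_eq_true', Bool.not_eq_true]

/-- The positions of the digit `0` of a word of length `m + k` and weight `k`. -/
def keptPositions (n m w : ℕ) (h : (zeros n w).length = m) (j : Fin m) : Fin n :=
  ⟨(zeros n w)[j], (mem_zeros.1 (List.getElem_mem _)).1⟩

theorem keptPositions_injective {n m w : ℕ} (h : (zeros n w).length = m) :
    Function.Injective (keptPositions n m w h) := by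
  intro i j hij
  have h1 : (zeros n w)[i] = (zeros n w)[j] := congrArg Fin.val hij
  have h2 : (zeros n w).Nodup := List.nodup_range.filter _
  exact Fin.ext ((h2.getElem_inj_iff).1 h1)

theorem dec_keptPositions {n m w : ℕ} (h : (zeros n w).length = m) (j : Fin m) :
    dec n w (keptPositions n m w h j) = 0 := by
  have h1 := (mem_zeros.1 (List.getElem_mem (l := zeros n w) (n := j) (by omega))).2
  exact congrArg sym h1

/-- Generators of the child at the word `w`. -/
def childGens (n : ℕ) (gens : List ℕ) (w : ℕ) : List ℕ :=
  match support n w with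
  | [] => []
  | i :: _ => force (dig w i) fun d => forceList (zeros n w) fun ps =>
      (kernel (fun v => clash (dig v i) d) gens).map (pull ps)

theorem map_codeOf {n m : ℕ} {ps : List ℕ} (hl : ps.length = m) {kept : Fin m → Fin n}
    (hk : ∀ j : Fin m, (kept j : ℕ) = ps[j]) {gens : List ℕ} {x : Fin m → K} :
    x ∈ codeOf m (gens.map (pull ps)) ↔ ∃ z ∈ codeOf n gens, x = z ∘ kept := by
  have hd : ∀ w, dec m (pull ps w) = dec n w ∘ kept := by
    intro w
    funext j
    rw [Function.comp_apply, dec, dec, dig_pull _ _ (by omega), hk]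
    rfl
  have hz : dec n 0 ∘ kept = 0 := by
    rw [dec_zero]
    rfl
  have : codeOf m (gens.map (pull ps)) = (codeOf n gens).map
      (AddMonoidHom.mk' (fun z : Fin n → K => z ∘ kept) fun _ _ => rfl) := by
    rw [codeOf, codeOf, AddMonoidHom.map_closure]
    congr 1
    ext y
    constructor
    · rintro ⟨_, hg', rfl⟩
      obtain ⟨g, hg, rfl⟩ := List.mem_map.1 hg'
      exact ⟨_, ⟨g, hg, rfl⟩, (hd g).symm⟩
    · rintro ⟨_, ⟨g, hg, rfl⟩, rfl⟩
      exact ⟨pull ps g, List.mem_map_of_mem hg, hd g⟩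
  rw [this]
  exact exists_congr fun z => and_congr_right fun _ => eq_comm

/-- Testing the first position of the support of `w` is enough. For k = 2 a codeword is orthogonal
to the codeword `w`, so its products with `w` in the two positions of the support are equal. -/
theorem codeOf_childGens {n m k w : ℕ} {gens : List ℕ} (hk : k = 1 ∨ k = 2)
    (hsd : IsSelfDual (codeOf n gens)) (hw : wt (dec n w) = k)
    (hwC : k = 2 → dec n w ∈ codeOf n gens) (hl : (zeros n w).length = m) :
    codeOf m (childGens n gens w) =
      childAt (codeOf n gens) (dec n w) (keptPositions n m w hl) := by
  have hlen := length_support n w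
  rw [hw] at hlen
  unfold childGens
  cases hs : support n w with
  | nil =>
    rw [hs] at hlen
    simp only [List.length_nil] at hlen
    omega
  | cons i is =>
    obtain ⟨hi, hwi⟩ := mem_support.1 (hs ▸ List.mem_cons_self : i ∈ support n w)
    simp only [force_eq, forceList_eq]
    let ψ : (Fin n → K) →+ ZMod 2 := AddMonoidHom.mk' (fun z => dot (z ⟨i, hi⟩) (dec n w ⟨i, hi⟩))
      fun x y => dot_add_left _ _ _
    have hψ : ∀ v, clash (dig v i) (dig w i) = true ↔ ψ (dec n v) = 1 := fun v =>
      clash_iff (dig_lt v i) (dig_lt w i) hwi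
    have hmem : ∀ j : Fin n, dec n w j ≠ 0 ↔ (j : ℕ) ∈ i :: is := by
      intro j
      rw [← hs, mem_support, Ne, dec, sym_eq_zero (dig_lt w j), and_iff_right j.2]
    have hdot : ∀ z ∈ codeOf n gens, ∀ j : Fin n, dec n w j ≠ 0 →
        dot (z j) (dec n w j) = ψ z := by
      intro z hz j hj
      change _ = dot (z ⟨i, hi⟩) (dec n w ⟨i, hi⟩)
      by_cases hji : (j : ℕ) = i
      · obtain rfl : j = ⟨i, hi⟩ := Fin.ext hji
        rfl
      · rw [hs, List.length_cons] at hlen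
        have h1 := (hmem j).1 hj
        rw [List.mem_cons] at h1
        have h2 := h1.resolve_left hji
        have hk2 : k = 2 := by
          have := List.length_pos_of_mem h2
          omega
        obtain ⟨l, rfl⟩ := List.length_eq_one_iff.1 (show is.length = 1 by omega)
        rw [List.mem_singleton] at h2
        have h3 := (show dual (codeOf n gens) = codeOf n gens from hsd).ge hz _ (hwC hk2)
        have key : ∀ u : K, dot u 0 = 0 := by decide
        rw [scalar, Finset.sum_eq_add (⟨i, hi⟩ : Fin n) j] at h3
        · have key2 : ∀ p q : ZMod 2, p + q = 0 → q = p := by decide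
          exact key2 _ _ h3
        · intro h
          exact hji (congrArg Fin.val h).symm
        · rintro u - ⟨hu, hu'⟩
          have : dec n w u = 0 := by
            by_contra h
            have := (hmem u).1 h
            rw [List.mem_cons, List.mem_singleton] at this
            rcases this with h | h
            · exact hu (Fin.ext h)
            · exact hu' (Fin.ext (h.trans h2.symm))
          rw [this]
          exact key _
        · simp
        · simp
    ext x
    rw [map_codeOf hl (kept := keptPositions n m w hl) fun j => rfl]
    constructor
    · rintro ⟨z, hz, rfl⟩
      obtain ⟨hz, h0⟩ := (mem_codeOf_kernel ψ hψ).1 hz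
      refine ⟨z, hz, fun j hj => ?_, rfl⟩
      have h1 := (hdot z hz j hj).trans h0
      have key : ∀ u v : K, v ≠ 0 → dot u v = 0 → u = 0 ∨ u = v := by decide
      exact key _ _ hj h1
    · rintro ⟨z, hz, h, rfl⟩
      refine ⟨z, (mem_codeOf_kernel ψ hψ).2 ⟨hz, ?_⟩, rfl⟩
      have key : ∀ u v : K, (u = 0 ∨ u = v) → dot u v = 0 := by decide
      exact key _ _ (h ⟨i, hi⟩ ((hmem _).2 List.mem_cons_self))

/-! ### Counting children -/

/-- All words of weight one. -/
def unitWords (n : ℕ) : List ℕ := (List.range n).flatMap fun i => [unitWord 1 i, unitWord 2 i, unitWord 3 i]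

/-- The codes given by the generators in a list are pairwise inequivalent. -/
noncomputable def inequivalent (m : ℕ) : List (List ℕ) → Bool
  | [] => true
  | g :: gs => forceList g fun g => gs.all (fun h => !embeds m g h) && inequivalent m gs

theorem inequivalent_iff {m : ℕ} {l : List (List ℕ)} (h : inequivalent m l = true)
    {i j : Fin l.length} (hij : i < j) :
    ¬ Equivalent (codeOf m (l.get i)) (codeOf m (l.get j)) := by
  induction l with
  | nil => exact i.elim0
  | cons g gs ih =>
    rw [inequivalent, forceList_eq, Bool.and_eq_true, List.all_eq_true] at h
    obtain ⟨j, hj⟩ := j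
    obtain ⟨i, hi⟩ := i
    cases j with
    | zero => exact absurd hij (Nat.not_lt_zero _)
    | succ j =>
      cases i with
      | zero =>
        refine not_equivalent_of_embeds ?_
        have := h.1 (gs.get ⟨j, by simpa using hj⟩) (List.get_mem _ _)
        simpa using this
      | succ i =>
        exact ih h.2 (i := ⟨i, by simpa using hi⟩) (j := ⟨j, by simpa using hj⟩)
          (by simpa using hij)

/-- The children at the words `l` are equivalent to that at the word `r`. -/
noncomputable def sameClass (m n : ℕ) (gens : List ℕ) (r : ℕ) (l : List ℕ) : Bool :=
  forceList (childGens n gens r) fun R => l.all fun w =>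
    forceList (childGens n gens w) fun W => embeds m W R

/-- The words which define the children of length `n - k`. -/
noncomputable def candidates (k n : ℕ) (gens : List ℕ) : List ℕ :=
  bif Nat.beq k 1 then unitWords n else (words gens).filter fun w => Nat.beq (weight n w) k

/-- The words which define the children of length `n - k` are those in the given classes, with one
class for each equivalence class of children. -/
noncomputable def childrenAre (k n : ℕ) (gens : List ℕ) (classes : List (ℕ × List ℕ)) : Bool :=
  force (bitmap (words gens)) (fun B => classes.all fun p =>
    Nat.beq (weight n p.1) k && (Nat.beq k 1 || inSet B p.1)) &&
  force (bitmap (classes.flatMap fun p => p.1 :: p.2)) (fun B =>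
    (candidates k n gens).all fun w => inSet B w) &&
  classes.all (fun p => sameClass (Nat.sub n k) n gens p.1 p.2) &&
  forceLists (classes.map fun p => childGens n gens p.1) (inequivalent (Nat.sub n k))

theorem exists_unitWord {n : ℕ} {w : Fin n → K} (h : wt w = 1) :
    ∃ v ∈ unitWords n, dec n v = w := by
  rw [wt, hammingNorm, Finset.card_eq_one] at h
  obtain ⟨i, hi⟩ := h
  have h1 : ∀ j, w j ≠ 0 ↔ j = i := by
    intro j
    rw [← Finset.mem_singleton, ← hi, Finset.mem_filter, and_iff_right (Finset.mem_univ j)]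
  refine ⟨unitWord (num (w i)) i, ?_, ?_⟩
  · rw [unitWords, List.mem_flatMap]
    refine ⟨i, List.mem_range.2 i.2, ?_⟩
    have h2 : ∀ u : K, u ≠ 0 → num u = 1 ∨ num u = 2 ∨ num u = 3 := by decide
    obtain h | h | h := h2 _ ((h1 i).2 rfl) <;> simp [h]
  · funext j
    rw [dec, dig_unitWord (num_lt _)]
    by_cases hj : j = i
    · rw [hj, if_pos rfl, sym_num]
    · rw [if_neg fun h => hj (Fin.ext h)]
      by_contra h
      exact hj ((h1 j).1 (Ne.symm h))

/-- Every child is equivalent to the child at one of the candidate words, and each candidate occurs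
in one of the given classes. The searches confirm that children within a class are equivalent and
that the representatives are not. -/
theorem numChildren_codeOf {n k : ℕ} {gens : List ℕ} {classes : List (ℕ × List ℕ)}
    (hk : k = 1 ∨ k = 2) (hkn : k ≤ n) (hev : IsEven (codeOf n gens))
    (hsd : IsSelfDual (codeOf n gens)) (h : childrenAre k n gens classes = true) :
    numChildren (codeOf n gens) k = classes.length := by
  rw [childrenAre, force_eq, force_eq, forceLists_eq, Bool.and_eq_true, Bool.and_eq_true,
    Bool.and_eq_true, List.all_eq_true, List.all_eq_true, List.all_eq_true] at h
  obtain ⟨⟨⟨h1, h2⟩, h3⟩, h4⟩ := h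
  have hlen : ∀ {w}, wt (dec n w) = k → (zeros n w).length = n - k := by
    intro w hw
    have := length_zeros n w
    omega
  have hmem : ∀ p ∈ classes, wt (dec n p.1) = k ∧ (k = 2 → dec n p.1 ∈ codeOf n gens) := by
    intro p hp
    have := h1 p hp
    rw [Bool.and_eq_true, Bool.or_eq_true, Nat.beq_eq, Nat.beq_eq, inSet_bitmap] at this
    refine ⟨by rw [wt_dec, this.1], fun hk2 => mem_codeOf.2 ⟨p.1, this.2.resolve_left ?_, rfl⟩⟩
    omega
  have hchild : ∀ w, wt (dec n w) = k → (k = 2 → dec n w ∈ codeOf n gens) →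
      IsChild k (codeOf (n - k) (childGens n gens w)) (codeOf n gens) := by
    intro w hw hw'
    rw [codeOf_childGens hk hsd hw hw' (hlen hw)]
    exact isChild_childAt hk (by omega) hev hsd hw hw' (keptPositions_injective _)
      (dec_keptPositions _)
  rw [numChildren]
  refine ncard_classes (rep := fun i : Fin classes.length =>
    codeOf (n - k) (childGens n gens (classes.get i).1)) ?_ ?_ ?_
  · intro i
    obtain ⟨h5, h6⟩ := hmem _ (List.get_mem classes i)
    exact hchild _ h5 h6
  · have key : ∀ i j : Fin classes.length, i < j → ¬ Equivalent
        (codeOf (n - k) (childGens n gens (classes.get i).1))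
        (codeOf (n - k) (childGens n gens (classes.get j).1)) := by
      intro i j hij
      have := inequivalent_iff h4 (i := ⟨i, by simp⟩) (j := ⟨j, by simp⟩) hij
      simpa using this
    intro i j hij
    rcases lt_trichotomy i j with h | h | h
    · exact absurd hij (key i j h)
    · exact h
    · exact absurd hij.symm (key j i h)
  · intro D hD
    obtain ⟨w, hw, hw', hall⟩ := hD.exists_word (by omega)
    obtain ⟨v, hv, rfl⟩ : ∃ v ∈ candidates k n gens, dec n v = w := by
      obtain rfl | rfl := hk
      · exact exists_unitWord hw
      · obtain ⟨v, hv, rfl⟩ := mem_codeOf.1 (hw' rfl)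
        refine ⟨v, List.mem_filter.2 ⟨hv, ?_⟩, rfl⟩
        rw [Nat.beq_eq, ← wt_dec, hw]
    have h5 := h2 v hv
    rw [inSet_bitmap, List.mem_flatMap] at h5
    obtain ⟨p, hp, hvp⟩ := h5
    obtain ⟨i, rfl⟩ := List.get_of_mem hp
    refine ⟨i, Equivalent.symm (Equivalent.trans
      (hall _ (keptPositions_injective (hlen hw)) (dec_keptPositions _)) ?_)⟩
    rw [← codeOf_childGens hk hsd hw hw']
    rw [List.mem_cons] at hvp
    obtain rfl | hvp := hvp
    · exact Equivalent.refl _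
    · have h6 := h3 _ hp
      rw [sameClass, forceList_eq, List.all_eq_true] at h6
      have h7 := h6 v hvp
      rw [forceList_eq] at h7
      -- Self-dual codes of the same length have the same order, so an embedding is an equivalence.
      refine equivalent_of_embeds h7 ?_
      obtain ⟨h8, h9⟩ := hmem _ hp
      rw [(hchild _ h8 h9).1.card, (hchild _ hw hw').1.card]

/-! ### Verification of the table -/

/-- A code together with data for the verification of its row in the table: generators, the order of
the automorphism group, and, for each class of children of length `n - 1` and `n - 2`, the words
which define them. -/
structure Entry where
  gens : List ℕ
  order : ℕ
  classes1 : List (ℕ × List ℕ)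
  classes2 : List (ℕ × List ℕ)

/-- The code of an entry. -/
def Entry.code (e : Entry) (n : ℕ) : Code (Fin n) := codeOf n e.gens

/-- The entry has the invariants of the row `r`. -/
noncomputable def Entry.check (n : ℕ) (e : Entry) (r : Row) : Bool :=
  bounded n e.gens && independent e.gens && Nat.beq e.gens.length n &&
  Nat.ble r.A.length (n / 2 + 1) && weightsAre n e.gens r.A &&
  forceLists (parts r.comps) (fun ps => bounded n ps.flatten) &&
  Nat.ble (offset r.comps r.comps.length) n && r.comps.all (fun s => Nat.ble 2 s.length) &&
  smallIs n e.gens (parts r.comps).flatten &&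
  Nat.beq (autOrder n e.gens) e.order &&
  forceLists (parts r.comps) (fun ps => Nat.beq (Nat.mul (cosetFixOrder n e.gens ps) r.order)
    e.order) &&
  Nat.beq e.classes1.length r.n1 && Nat.beq e.classes2.length r.n2 &&
  childrenAre 1 n e.gens e.classes1 && childrenAre 2 n e.gens e.classes2

theorem Entry.spec {n : ℕ} {e : Entry} {r : Row} (hn : 2 ≤ n) (h : e.check n r = true) :
    IsEven (e.code n) ∧ IsSelfDual (e.code n) ∧ HasRow (e.code n) r ∧
      Nat.card (autGroup (e.code n)) = e.order := by
  simp only [Entry.check, Bool.and_eq_true, forceLists_eq, Nat.beq_eq, Nat.ble_eq,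
    List.all_eq_true] at h
  obtain ⟨⟨⟨⟨⟨⟨⟨⟨⟨⟨⟨⟨⟨⟨hb, hi⟩, hl⟩, hA⟩, hw⟩, hp⟩, ho⟩, hL⟩, hs⟩, haut⟩, hfix⟩, hn1⟩, hn2⟩, hc1⟩,
    hc2⟩ := h
  have hb' := lt_of_bounded hb
  have hwc := weightCount_codeOf hb' hi hA hw
  have hev : IsEven (e.code n) := isEven_of_weightCount fun j => (hwc j).2
  have hsd : IsSelfDual (e.code n) := isSelfDual_codeOf hb' hi hl hev
  have hps : ∀ p ∈ parts r.comps, ∀ g ∈ p, g < 4 ^ n := fun p hp' g hg =>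
    lt_of_bounded hp g (List.mem_flatten.2 ⟨p, hp', hg⟩)
  refine ⟨hev, hsd, ⟨?_, ?_, hwc, ?_, ?_⟩, (card_autGroup n e.gens).trans haut⟩
  · rw [Entry.code, (smallSubcode_codeOf hev hs).1]
    exact hasType_codeOf_parts ho
  · exact orderG1_mul_orderG2_codeOf hb' hps hev ho hL hs (haut.trans hfix.symm)
  · rw [← hn1]
    exact numChildren_codeOf (Or.inl rfl) (by omega) hev hsd hc1
  · rw [← hn2]
    exact numChildren_codeOf (Or.inr rfl) hn hev hsd hc2

/-- Equivalent codes have the same class, whose size determines the order of the group. -/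
theorem Equivalent.card_autGroup_eq {n : ℕ} {C D : Code (Fin n)} (h : Equivalent C D) :
    Nat.card (autGroup C) = Nat.card (autGroup D) := by
  have h1 := ncard_equivalent_mul_card_autGroup C
  have h2 : {E : Code (Fin n) | Equivalent C E} = {E | Equivalent D E} := by
    ext E
    exact ⟨fun h' => h.symm.trans h', fun h' => h.trans h'⟩
  rw [h2, ← ncard_equivalent_mul_card_autGroup D] at h1
  refine Nat.eq_of_mul_eq_mul_left ?_ h1
  exact (Set.ncard_pos (Set.toFinite _)).2 ⟨D, Equivalent.refl D⟩

/-- A complete list of entries: they are distinguished by `A_2` and the order of the automorphism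
group, and exhaust the mass. -/
structure Complete (n : ℕ) (es : List Entry) (rows : List Row) : Prop where
  check : List.Forall₂ (fun e r => e.check n r = true) es rows
  nodup : (List.zipWith (fun (e : Entry) (r : Row) => (e.order, r.A.getD 1 0)) es rows).Nodup
  mass : ∏ i ∈ Finset.range n, extensions n i ≤
    (es.map fun e => isometriesOrder n / e.order).sum * ∏ i : Fin n, (2 ^ n - 2 ^ (i : ℕ))

theorem Complete.classification {n : ℕ} {es : List Entry} {rows : List Row} (h : Complete n es rows)
    (hn : Even n) (h2 : 2 ≤ n) : numEvenSelfDual n = rows.length ∧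
      ∃ rep : Fin rows.length → Code (Fin n),
        (∀ i, IsEven (rep i) ∧ IsSelfDual (rep i) ∧ HasRow (rep i) (rows.get i)) ∧
        ∀ C : Code (Fin n), IsEven C → IsSelfDual C → ∃! i, Equivalent C (rep i) := by
  have hl := h.check.length_eq
  have hspec : ∀ i : Fin rows.length, IsEven ((es.get (i.cast hl.symm)).code n) ∧
      IsSelfDual ((es.get (i.cast hl.symm)).code n) ∧
      HasRow ((es.get (i.cast hl.symm)).code n) (rows.get i) ∧
      Nat.card (autGroup ((es.get (i.cast hl.symm)).code n)) = (es.get (i.cast hl.symm)).order :=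
    fun i => Entry.spec h2 (h.check.get (i.cast hl.symm).2 i.2)
  have hne : ∀ i j : Fin rows.length, Equivalent ((es.get (i.cast hl.symm)).code n)
      ((es.get (j.cast hl.symm)).code n) → i = j := by
    intro i j hij
    have h3 := hij.card_autGroup_eq
    rw [(hspec i).2.2.2, (hspec j).2.2.2] at h3
    have h4 := hij.weightCount_eq (2 * 1)
    rw [((hspec i).2.2.1.2.2.1 1).1, ((hspec j).2.2.1.2.2.1 1).1] at h4
    have hz : ∀ k : Fin rows.length, (k : ℕ) < (List.zipWith (fun (e : Entry) (r : Row) =>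
        (e.order, r.A.getD 1 0)) es rows).length := fun k => by
      rw [List.length_zipWith, hl, min_self]
      exact k.2
    -- Equality of the group orders and of A_2 means equal entries of a list without repetitions.
    have h5 := (h.nodup.getElem_inj_iff (hi := hz i) (hj := hz j)).1 (by
      rw [List.getElem_zipWith, List.getElem_zipWith]
      exact Prod.ext h3 h4)
    exact Fin.ext h5
  have hmass : ∑ i : Fin rows.length, Nat.card (isometries (Fin n)) /
      Nat.card (autGroup ((es.get (i.cast hl.symm)).code n)) =
        (es.map fun e => isometriesOrder n / e.order).sum := by
    simp only [(hspec _).2.2.2, card_isometries]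
    rw [← Fin.sum_univ_fun_getElem]
    exact Fintype.sum_equiv (finCongr hl.symm) _ _ fun i => rfl
  have hex : ∀ C : Code (Fin n), IsEven C ∧ IsSelfDual C →
      ∃ i : Fin rows.length, Equivalent ((es.get (i.cast hl.symm)).code n) C :=
    fun C hC => exists_equivalent_of_mass hn (fun i => ⟨(hspec i).1, (hspec i).2.1⟩) hne
      (by rw [hmass]; exact h.mass) hC.1 hC.2
  refine ⟨ncard_classes (fun i => ⟨(hspec i).1, (hspec i).2.1⟩) hne hex, _,
    fun i => ⟨(hspec i).1, (hspec i).2.1, (hspec i).2.2.1⟩, fun C hC hC' => ?_⟩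
  obtain ⟨i, hi⟩ := hex C ⟨hC, hC'⟩
  exact ⟨i, hi.symm, fun j hj => hne j i (hj.symm.trans hi.symm)⟩

/-! ### The codes of the table -/

/-- The even self-dual codes of length 2. -/
def entries2 : List Entry :=
  [⟨[5, 10], 12, [(1, [2, 3, 4, 8, 12])], [(5, [10, 15])]⟩]

/-- The even self-dual codes of length 4. -/
def entries4 : List Entry :=
  [⟨[5, 17, 65, 171], 192, [(1, [4, 16, 64]), (2, [3, 8, 12, 32, 48, 128, 192])], [(5, [17, 20,
      65, 68, 80])]⟩,
   ⟨[5, 10, 80, 160], 288, [(1, [2, 3, 4, 8, 12, 16, 32, 48, 64, 128, 192])], [(5, [10, 15, 80,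
      160, 240])]⟩]

/-- The even self-dual codes of length 6. -/
def entries6 : List Entry :=
  [⟨[5, 17, 65, 257, 1025, 2731], 23040, [(1, [4, 16, 64, 256, 1024]), (2, [3, 8, 12, 32, 48, 128,
      192, 512, 768, 2048, 3072])], [(5, [17, 20, 65, 68, 80, 257, 260, 272, 320, 1025, 1028,
      1040, 1088, 1280])]⟩,
   ⟨[5, 17, 65, 1280, 2560, 170], 2304, [(1, [4, 16, 64]), (256, [512, 768, 1024, 2048, 3072]),
      (2, [3, 8, 12, 32, 48, 128, 192])], [(5, [17, 20, 65, 68, 80]), (1280, [2560, 3840])]⟩,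
   ⟨[5, 17, 320, 1088, 107, 2689], 1152, [(1, [4, 16, 64, 256, 1024]), (2, [3, 8, 12, 32, 48, 128,
      192, 512, 768, 2048, 3072])], [(5, [17, 20, 320, 1088, 1280])]⟩,
   ⟨[5, 10, 80, 160, 1280, 2560], 10368, [(1, [2, 3, 4, 8, 12, 16, 32, 48, 64, 128, 192, 256, 512,
      768, 1024, 2048, 3072])], [(5, [10, 15, 80, 160, 240, 1280, 2560, 3840])]⟩,
   ⟨[5, 80, 1280, 170, 283, 2577], 384, [(1, [4, 16, 64, 256, 1024]), (2, [3, 8, 12, 32, 48, 128,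
      192, 512, 768, 2048, 3072])], [(5, [80, 1280])]⟩,
   ⟨[2577, 417, 282, 1360, 1285, 1826], 2160, [(1, [2, 3, 4, 8, 12, 16, 32, 48, 64, 128, 192, 256,
      512, 768, 1024, 2048, 3072])], []⟩]

/-- The even self-dual codes of length 8. -/
def entries8 : List Entry :=
  [⟨[5, 17, 65, 257, 1025, 4097, 16385, 43691], 5160960, [(1, [4, 16, 64, 256, 1024, 4096,
      16384]), (2, [3, 8, 12, 32, 48, 128, 192, 512, 768, 2048, 3072, 8192, 12288, 32768,
      49152])], [(5, [17, 20, 65, 68, 80, 257, 260, 272, 320, 1025, 1028, 1040, 1088, 1280, 4097,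
      4100, 4112, 4160, 4352, 5120, 16385, 16388, 16400, 16448, 16640, 17408, 20480])]⟩,
   ⟨[5, 17, 65, 257, 1025, 20480, 40960, 2730], 276480, [(1, [4, 16, 64, 256, 1024]), (4096,
      [8192, 12288, 16384, 32768, 49152]), (2, [3, 8, 12, 32, 48, 128, 192, 512, 768, 2048,
      3072])], [(5, [17, 20, 65, 68, 80, 257, 260, 272, 320, 1025, 1028, 1040, 1088, 1280]),
      (20480, [40960, 61440])]⟩,
   ⟨[5, 17, 65, 257, 5120, 17408, 43009, 1706], 46080, [(1, [4, 16, 64, 256]), (1024, [4096,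
      16384]), (2048, [3072, 8192, 12288, 32768, 49152]), (2, [3, 8, 12, 32, 48, 128, 192, 512,
      768])], [(5, [17, 20, 65, 68, 80, 257, 260, 272, 320]), (5120, [17408, 20480])]⟩,
   ⟨[5, 17, 65, 1280, 4352, 16640, 170, 43520], 73728, [(1, [4, 16, 64, 256, 1024, 4096, 16384]),
      (2, [3, 8, 12, 32, 48, 128, 192, 512, 768, 2048, 3072, 8192, 12288, 32768, 49152])], [(5,
      [17, 20, 65, 68, 80, 1280, 4352, 5120, 16640, 17408, 20480])]⟩,
   ⟨[5, 17, 65, 1280, 2560, 20480, 40960, 170], 55296, [(1, [4, 16, 64]), (256, [512, 768, 1024,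
      2048, 3072, 4096, 8192, 12288, 16384, 32768, 49152]), (2, [3, 8, 12, 32, 48, 128, 192])],
      [(5, [17, 20, 65, 68, 80]), (1280, [2560, 3840, 20480, 40960, 61440])]⟩,
   ⟨[5, 17, 65, 1280, 20480, 6913, 43520, 2730], 6144, [(1, [4, 16, 64]), (256, [1024, 4096,
      16384]), (512, [768, 2048, 3072, 8192, 12288, 32768, 49152]), (2, [3, 8, 12, 32, 48, 128,
      192])], [(5, [17, 20, 65, 68, 80]), (1280, [20480])]⟩,
   ⟨[5, 17, 320, 1088, 20480, 40960, 106, 2689], 13824, [(1, [4, 16, 64, 256, 1024]), (4096,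
      [8192, 12288, 16384, 32768, 49152]), (2, [3, 8, 12, 32, 48, 128, 192, 512, 768, 2048,
      3072])], [(5, [17, 20, 320, 1088, 1280]), (20480, [40960, 61440])]⟩,
   ⟨[5, 17, 320, 1088, 20480, 4138, 6784, 41025], 4608, [(1, [4, 16, 64, 256, 1024]), (4096,
      [16384]), (2, [3, 8, 12, 32, 48, 128, 192, 512, 768, 2048, 3072]), (8192, [12288, 32768,
      49152])], [(5, [17, 20, 320, 1088, 1280]), (20480, [])]⟩,
   ⟨[5, 17, 320, 5120, 11968, 17473, 32810, 34432], 768, [(1, [4, 16]), (64, [256, 1024, 4096]),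
      (32768, []), (128, [192, 512, 768, 2048, 3072, 8192, 12288]), (16384, []), (49152, []), (2,
      [3, 8, 12, 32, 48])], [(5, [17, 20]), (320, [5120])]⟩,
   ⟨[5, 17, 3521, 4737, 9600, 18368, 33921, 1642], 2880, [(1, [4, 16]), (64, [128, 192, 256, 512,
      768, 1024, 2048, 3072, 4096, 8192, 12288, 16384, 32768, 49152]), (2, [3, 8, 12, 32, 48])],
      [(5, [17, 20])]⟩,
   ⟨[5, 10, 80, 160, 1280, 2560, 20480, 40960], 497664, [(1, [2, 3, 4, 8, 12, 16, 32, 48, 64, 128,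
      192, 256, 512, 768, 1024, 2048, 3072, 4096, 8192, 12288, 16384, 32768, 49152])], [(5, [10,
      15, 80, 160, 240, 1280, 2560, 3840, 20480, 40960, 61440])]⟩,
   ⟨[5, 10, 80, 1280, 20480, 2992, 4512, 41232], 4608, [(16, [64, 256, 1024, 4096, 16384]), (1,
      [2, 3, 4, 8, 12]), (32, [48, 128, 192, 512, 768, 2048, 3072, 8192, 12288, 32768, 49152])],
      [(80, [1280, 20480]), (5, [10, 15])]⟩,
   ⟨[5, 10, 1696, 2544, 4448, 9136, 16784, 33760], 25920, [(1, [2, 3, 4, 8, 12]), (16, [32, 48,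
      64, 128, 192, 256, 512, 768, 1024, 2048, 3072, 4096, 8192, 12288, 16384, 32768, 49152])],
      [(5, [10, 15])]⟩,
   ⟨[5, 80, 1280, 20480, 170, 2570, 4369, 40970], 6144, [(1, [4, 16, 64, 256, 1024, 4096, 16384]),
      (2, [3, 8, 12, 32, 48, 128, 192, 512, 768, 2048, 3072, 8192, 12288, 32768, 49152])], [(5,
      [80, 1280, 20480])]⟩,
   ⟨[5, 80, 1280, 20480, 283, 2720, 4257, 45067], 2048, [(1, [4, 16, 64, 256, 1024, 4096, 16384]),
      (2, [3, 8, 12, 32, 48, 128, 192, 512, 768, 2048, 3072, 8192, 12288, 32768, 49152])], [(5,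
      [80, 1280, 20480])]⟩,
   ⟨[5, 80, 1280, 4257, 10768, 12555, 18945, 33184], 384, [(1, [4, 16, 64, 256, 1024]), (4096,
      [8192, 12288, 16384, 32768, 49152]), (2, [3, 8, 12, 32, 48, 128, 192, 512, 768, 2048,
      3072])], [(5, [80, 1280])]⟩,
   ⟨[5, 80, 2577, 4512, 7179, 9488, 17328, 34049], 256, [(1, [4, 16, 64]), (256, [768, 1024, 3072,
      4096, 12288, 16384, 49152]), (512, [2048, 8192, 32768]), (2, [3, 8, 12, 32, 48, 128, 192])],
      [(5, [80])]⟩,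
   ⟨[5, 170, 1553, 3009, 4913, 8769, 16650, 33360], 192, [(1, [4]), (16, [48, 64, 192, 512, 768,
      1024, 2048, 4096, 8192, 32768, 49152]), (32, [128, 256, 3072, 12288, 16384]), (2, [3, 8,
      12])], [(5, [])]⟩,
   ⟨[329, 646, 1170, 2145, 4118, 8233, 16488, 32916], 8064, [(1, [2, 3, 4, 8, 12, 16, 32, 48, 64,
      128, 192, 256, 512, 768, 1024, 2048, 3072, 4096, 8192, 12288, 16384, 32768, 49152])], []⟩,
   ⟨[504, 649, 1158, 2130, 4239, 8428, 16406, 32815], 1152, [(1, [2, 3, 4, 8, 12, 16, 32, 48, 64,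
      128, 192, 256, 512, 768, 1024, 2048, 3072, 4096, 8192, 12288, 16384, 32768, 49152])], []⟩,
   ⟨[250, 338, 1805, 2625, 4871, 8740, 16445, 33285], 336, [(1, [2, 3, 4, 8, 12, 16, 32, 48, 64,
      128, 192, 256, 512, 768, 1024, 2048, 3072, 4096, 8192, 12288, 16384, 32768, 49152])], []⟩]

/-- In this and the other lengths the number is 6^n · n!. -/
theorem isometriesOrder_2 : isometriesOrder 2 = 72 := by decide +kernel

theorem complete_2 : Complete 2 entries2 (table 2) where
  check := by
    repeat refine .cons (by decide +kernel) ?_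
    exact .nil
  nodup := by decide +kernel
  mass := by
    rw [isometriesOrder_2]
    decide +kernel

theorem isometriesOrder_4 : isometriesOrder 4 = 31104 := by decide +kernel

theorem complete_4 : Complete 4 entries4 (table 4) where
  check := by
    repeat refine .cons (by decide +kernel) ?_
    exact .nil
  nodup := by decide +kernel
  mass := by
    rw [isometriesOrder_4]
    decide +kernel

theorem isometriesOrder_6 : isometriesOrder 6 = 33592320 := by decide +kernel

theorem complete_6 : Complete 6 entries6 (table 6) where
  check := by
    repeat refine .cons (by decide +kernel) ?_
    exact .nil
  nodup := by decide +kernel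
  mass := by
    rw [isometriesOrder_6]
    decide +kernel

theorem isometriesOrder_8 : isometriesOrder 8 = 67722117120 := by decide +kernel

set_option maxHeartbeats 0 in
theorem complete_8 : Complete 8 entries8 (table 8) where
  check := by
    repeat refine .cons (by decide +kernel) ?_
    exact .nil
  nodup := by decide +kernel
  mass := by
    rw [isometriesOrder_8]
    decide +kernel

/-- The numbers are the six given generators, with the first position as lowest digit to the base 4;
for instance a0a0bb is 1 + 16 + 2·256 + 2·1024 = 2577. -/
theorem hexacode_eq : hexacode = codeOf 6 [2577, 417, 282, 1360, 1285, 1826] := by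
  have h : ∀ x : Fin 6 → K, (∃ g ∈ [2577, 417, 282, 1360, 1285, 1826], dec 6 g = x) ↔
      x ∈ ({![a, 0, a, 0, b, b], ![a, 0, b, b, a, 0], ![b, b, a, 0, a, 0],
        ![0, 0, a, a, a, a], ![a, a, 0, 0, a, a], ![b, 0, b, 0, c, a]} : Set (Fin 6 → K)) := by
    intro x
    have h1 : dec 6 2577 = ![a, 0, a, 0, b, b] := by decide
    have h2 : dec 6 417 = ![a, 0, b, b, a, 0] := by decide
    have h3 : dec 6 282 = ![b, b, a, 0, a, 0] := by decide
    have h4 : dec 6 1360 = ![0, 0, a, a, a, a] := by decide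
    have h5 : dec 6 1285 = ![a, a, 0, 0, a, a] := by decide
    have h6 : dec 6 1826 = ![b, 0, b, 0, c, a] := by decide
    simp [h1, h2, h3, h4, h5, h6, eq_comm]
  rw [hexacode, codeOf]
  congr 1
  ext x
  exact (h x).symm

theorem hexacode_spec : IsEven hexacode ∧ IsSelfDual hexacode ∧ HasRow hexacode hexacodeRow := by
  have h := Entry.spec (by norm_num)
    (complete_6.check.get (i := 5) (by decide) (by decide))
  rw [hexacode_eq]
  exact ⟨h.1, h.2.1, h.2.2.1⟩

end Kleinian

/-! ### The classification theorem -/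

theorem theorem9 :
    (Kleinian.numEvenSelfDual 2 = 1 ∧ Kleinian.numEvenSelfDual 4 = 2 ∧ Kleinian.numEvenSelfDual 6 = 6 ∧
      Kleinian.numEvenSelfDual 8 = 21) ∧
    (∀ n : ℕ, 1 ≤ n → n ≤ 8 →
      ∃ rep : Fin (Kleinian.table n).length → Kleinian.Code (Fin n),
        (∀ i, Kleinian.IsEven (rep i) ∧ Kleinian.IsSelfDual (rep i) ∧
          Kleinian.HasRow (rep i) ((Kleinian.table n).get i)) ∧
        ∀ C : Kleinian.Code (Fin n), Kleinian.IsEven C → Kleinian.IsSelfDual C →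
          ∃! i, Kleinian.Equivalent C (rep i)) ∧
    (Kleinian.IsEven Kleinian.hexacode ∧ Kleinian.IsSelfDual Kleinian.hexacode ∧
      Kleinian.HasRow Kleinian.hexacode Kleinian.hexacodeRow) := by
  have h2 := Kleinian.complete_2.classification (by decide) (by decide)
  have h4 := Kleinian.complete_4.classification (by decide) (by decide)
  have h6 := Kleinian.complete_6.classification (by decide) (by decide)
  have h8 := Kleinian.complete_8.classification (by decide) (by decide)
  refine ⟨⟨h2.1, h4.1, h6.1, h8.1⟩, fun n hn hn' => ?_, Kleinian.hexacode_spec⟩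
  by_cases hev : Even n
  · obtain rfl | rfl | rfl | rfl : n = 2 ∨ n = 4 ∨ n = 6 ∨ n = 8 := by
      rw [Nat.even_iff] at hev
      omega
    · exact h2.2
    · exact h4.2
    · exact h6.2
    · exact h8.2
  -- In odd length the table is empty, so the family of representatives is vacuous and it remains to
  -- see that no code exists.
  · have ht : (Kleinian.table n).length = 0 := by
      interval_cases n <;> first | rfl | exact absurd (by decide) hev
    refine ⟨fun _ => ⊥, fun i => (Fin.cast ht i).elim0, fun C hC hC' => absurd ?_ hev⟩
    have := Kleinian.even_card_of_isEven_isSelfDual hC hC'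
    rwa [Fintype.card_fin] at this
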